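/- For $\mu=(\mu_1,\mu_2)\in\mathbb{C}^2$ and a symmetric matrix $\Sigma=(\sigma_{ij})\in\mathbb{C}^{2\times 2}$, define the Gaussian moments $m_{i_1i_2}=m_{i_1i_2}(\mu,\Sigma)$ by the identity of formal power series $$\sum_{i_1,i_2\ge 0}\frac{m_{i_1i_2}}{i_1!\,i_2!}\,t_1^{i_1}t_2^{i_2}=\exp(t_1\mu_1+t_2\mu_2)\cdot\exp\Bigl(\tfrac12\sum_{i,j=1}^2\sigma_{ij}t_it_j\Bigr).$$ Let $\mathbb{P}^{14}$ be the complex projective space whose $15$ homogeneous coordinates are indexed by the pairs $(i_1,i_2)$ with $i_1+i_2\le 4$, and let $\mathcal{G}_{2,4}\subset\mathbb{P}^{14}$ be the Zariski closure of the set of all points $(m_{i_1i_2}(\mu,\Sigma))_{i_1+i_2\le 4}$ (the Gaussian moment variety of order $4$ for $n=2$). Then $\mathcal{G}_{2,4}$ has dimension $5$ and degree $102$ in $\mathbb{P}^{14}$. Its homogeneous vanishing ideal is prime and is minimally generated by $99$ cubics, $41$ quartics and one quintic. The Hilbert series of its homogeneous coordinate ring equals $$\frac{1+9t+45t^2+66t^3-27t^4+13t^5-8t^6+4t^7-t^8}{(1-t)^6}.$$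 -/

import Mathlib

open scoped LinearAlgebra.Projectivization

noncomputable section

/-! ### Projective varieties over a field, in the classical language -/

namespace ProjVar

variable {K : Type*} [Field K] {ι : Type*}

/-- The set of points of projective space (with homogeneous coordinates indexed by `ι`)
at which all polynomials in `T` vanish. It is only used for sets `T` of homogeneous polynomials,
for which the choice of a representative of `p` is immaterial. -/
def zeroLocus (T : Set (MvPolynomial ι K)) : Set (ℙ K (ι → K)) :=
  {p | ∀ f ∈ T, MvPolynomial.eval p.rep f = 0}

/-- A set of homogeneous polynomials (of possibly different degrees). -/
def IsHomogeneousSet (T : Set (MvPolynomial ι K)) : Prop :=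
  ∀ f ∈ T, ∃ d : ℕ, f.IsHomogeneous d

/-- The Zariski topology on projective space: the closed sets are the zero loci of sets of
homogeneous polynomials. -/
abbrev zariskiTopology (K : Type*) [Field K] (ι : Type*) : TopologicalSpace (ℙ K (ι → K)) :=
  TopologicalSpace.ofClosed
    {X | ∃ T : Set (MvPolynomial ι K), IsHomogeneousSet T ∧ X = zeroLocus T}
    (by
      refine ⟨{1}, ?_, ?_⟩
      · rintro f rfl
        exact ⟨0, MvPolynomial.isHomogeneous_one ι K⟩
      · ext p
        simp [zeroLocus])
    (by
      intro A hA
      refine ⟨{f | (∃ d : ℕ, f.IsHomogeneous d) ∧ ∃ X ∈ A, ∀ p ∈ X,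
        MvPolynomial.eval p.rep f = 0}, fun f hf => hf.1, ?_⟩
      ext p
      constructor
      · rintro hp f ⟨-, X, hX, hf⟩
        exact hf p (hp X hX)
      · intro hp X hX
        obtain ⟨T, hT, rfl⟩ := hA hX
        intro f hf
        exact hp f ⟨hT f hf, _, hX, fun q hq => hq f hf⟩)
    (by
      rintro _ ⟨S, hS, rfl⟩ _ ⟨T, hT, rfl⟩
      refine ⟨{h | ∃ f ∈ S, ∃ g ∈ T, h = f * g}, ?_, ?_⟩
      · rintro h ⟨f, hf, g, hg, rfl⟩
        obtain ⟨a, ha⟩ := hS f hf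
        obtain ⟨b, hb⟩ := hT g hg
        exact ⟨a + b, ha.mul hb⟩
      · ext p
        constructor
        · rintro (hp | hp) h ⟨f, hf, g, hg, rfl⟩
          · simp [hp f hf]
          · simp [hp g hg]
        · intro hp
          by_contra hcon
          simp only [Set.mem_union, not_or] at hcon
          obtain ⟨h1, h2⟩ := hcon
          simp only [zeroLocus, Set.mem_ofPred_eq, not_forall] at h1 h2
          obtain ⟨f, hf, hf0⟩ := h1
          obtain ⟨g, hg, hg0⟩ := h2
          have := hp (f * g) ⟨f, hf, g, hg, rfl⟩
          rw [map_mul] at this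
          exact (mul_ne_zero hf0 hg0) this)

/-- The Zariski closure of a set of points of projective space. -/
def zariskiClosure (X : Set (ℙ K (ι → K))) : Set (ℙ K (ι → K)) :=
  @closure _ (zariskiTopology K ι) X

/-- The homogeneous vanishing ideal of a set of points of projective space: the ideal generated by
all homogeneous polynomials that vanish on it. -/
def vanishingIdeal (X : Set (ℙ K (ι → K))) : Ideal (MvPolynomial ι K) :=
  Ideal.span {f | (∃ d : ℕ, f.IsHomogeneous d) ∧ ∀ p ∈ X, MvPolynomial.eval p.rep f = 0}

/-- The dimension of a subset of projective space: its Krull dimension in the Zariski topology. -/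
def dimension (X : Set (ℙ K (ι → K))) : WithBot ℕ∞ :=
  @topologicalKrullDim X (TopologicalSpace.induced Subtype.val (zariskiTopology K ι))

/-- The Hilbert function of `K[x] / I` for a homogeneous ideal `I`: its value at `d` is the
dimension of the image of the space of forms of degree `d` in `K[x] / I`. -/
def hilbertFunction (I : Ideal (MvPolynomial ι K)) (d : ℕ) : ℕ :=
  Module.finrank K ((MvPolynomial.homogeneousSubmodule ι K d).map
    (Ideal.Quotient.mkₐ K I).toLinearMap)

/-- The Hilbert series of `K[x] / I`. -/
def hilbertSeries (I : Ideal (MvPolynomial ι K)) : PowerSeries ℚ :=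
  PowerSeries.mk fun d => (hilbertFunction I d : ℚ)

/-- `P` is the Hilbert polynomial of `K[x] / I`. -/
def IsHilbertPolynomial (I : Ideal (MvPolynomial ι K)) (P : Polynomial ℚ) : Prop :=
  ∀ᶠ d : ℕ in Filter.atTop, P.eval (d : ℚ) = (hilbertFunction I d : ℚ)

/-- The projective variety `X` has degree `δ`: if `r` is the degree of the Hilbert polynomial of the
homogeneous coordinate ring of `X`, then its leading coefficient is `δ / r!`. -/
def HasDegree (X : Set (ℙ K (ι → K))) (δ : ℕ) : Prop :=
  ∃ P : Polynomial ℚ, IsHilbertPolynomial (vanishingIdeal X) P ∧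
    (P.natDegree.factorial : ℚ) * P.leadingCoeff = (δ : ℚ)

/-- `B` generates the ideal `I`, and no proper subset of `B` does. -/
def IsMinimalGeneratingSet (I : Ideal (MvPolynomial ι K)) (B : Set (MvPolynomial ι K)) : Prop :=
  Ideal.span B = I ∧ ∀ C : Set (MvPolynomial ι K), C ⊂ B → Ideal.span C ≠ I

end ProjVar

/-! ### Gaussian moment varieties -/

namespace GaussianMoment

variable {n : ℕ}

/-- The linear form `t₁ μ₁ + ⋯ + tₙ μₙ`. -/
def linearPart (μ : Fin n → ℂ) : MvPowerSeries (Fin n) ℂ :=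
  ∑ i, MvPowerSeries.C (μ i) * MvPowerSeries.X i

/-- The quadratic form `½ ∑ σᵢⱼ tᵢ tⱼ`. -/
def quadraticPart (S : Matrix (Fin n) (Fin n) ℂ) : MvPowerSeries (Fin n) ℂ :=
  MvPowerSeries.C (1 / 2 : ℂ) *
    ∑ i, ∑ j, MvPowerSeries.C (S i j) * (MvPowerSeries.X i * MvPowerSeries.X j)

/-- The moment generating function
`exp(t₁ μ₁ + ⋯ + tₙ μₙ) · exp(½ ∑ σᵢⱼ tᵢ tⱼ)` of the Gaussian distribution,
as a formal power series in `t₁, …, tₙ`. -/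
def mgf (μ : Fin n → ℂ) (S : Matrix (Fin n) (Fin n) ℂ) : MvPowerSeries (Fin n) ℂ :=
  (PowerSeries.exp ℂ).subst (linearPart μ) * (PowerSeries.exp ℂ).subst (quadraticPart S)

/-- The moment `m_{i₁ ⋯ iₙ}`: the coefficient of `t₁^{i₁} ⋯ tₙ^{iₙ} / (i₁! ⋯ iₙ!)` in the moment
generating function. -/
def moment (μ : Fin n → ℂ) (S : Matrix (Fin n) (Fin n) ℂ) (i : Fin n →₀ ℕ) : ℂ :=
  (∏ k, ((i k).factorial : ℂ)) * MvPowerSeries.coeff i (mgf μ S)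

/-- The exponent vectors `(i₁, …, iₙ)` with `i₁ + ⋯ + iₙ ≤ d`. -/
abbrev Index (n d : ℕ) : Type := {i : Fin n →₀ ℕ // i.degree ≤ d}

/-- The vector of all moments of order at most `d`. -/
def momentVector (d : ℕ) (μ : Fin n → ℂ) (S : Matrix (Fin n) (Fin n) ℂ) : Index n d → ℂ :=
  fun i => moment μ S i.1

lemma constantCoeff_subst_exp (a : MvPowerSeries (Fin n) ℂ)
    (ha : MvPowerSeries.constantCoeff a = 0) :
    MvPowerSeries.constantCoeff ((PowerSeries.exp ℂ).subst a) = 1 := by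
  rw [PowerSeries.constantCoeff_subst (PowerSeries.HasSubst.of_constantCoeff_zero ha),
    finsum_eq_single _ 0]
  · simp
  · intro d hd
    simp [ha, hd]

lemma moment_zero (μ : Fin n → ℂ) (S : Matrix (Fin n) (Fin n) ℂ) : moment μ S 0 = 1 := by
  have h1 : MvPowerSeries.constantCoeff (linearPart μ) = 0 := by simp [linearPart]
  have h2 : MvPowerSeries.constantCoeff (quadraticPart S) = 0 := by simp [quadraticPart]
  simp [moment, mgf, constantCoeff_subst_exp _ h1, constantCoeff_subst_exp _ h2]

lemma momentVector_ne_zero (d : ℕ) (μ : Fin n → ℂ) (S : Matrix (Fin n) (Fin n) ℂ) :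
    momentVector d μ S ≠ 0 := by
  intro h
  have h0 : momentVector d μ S ⟨0, by simp⟩ = 0 := by rw [h]; rfl
  simp [momentVector, moment_zero] at h0

/-- The points of projective space given by the moments of order at most `d`, for all means `μ` and
all symmetric matrices `S`. -/
def momentPoints (n d : ℕ) : Set (ℙ ℂ (Index n d → ℂ)) :=
  {p | ∃ (μ : Fin n → ℂ) (S : Matrix (Fin n) (Fin n) ℂ), S.IsSymm ∧
    p = Projectivization.mk ℂ (momentVector d μ S) (momentVector_ne_zero d μ S)}

/-- The Gaussian moment variety of order `d`. -/
def gaussianMomentVariety (n d : ℕ) : Set (ℙ ℂ (Index n d → ℂ)) :=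
  ProjVar.zariskiClosure (momentPoints n d)

end GaussianMoment

end

/-! ### Integer polynomials as lists of terms -/

noncomputable section

namespace TermList

/-! Let φ send the fifteen moment coordinates to polynomials in the five moments of order one and
two, with m_00 ↦ 1. All values of these five moments occur, so a form vanishes on the variety
exactly when φ kills it. Let J be the ideal generated by the 141 explicit forms. That φ kills them
is a finite computation (`substTerms_relations`). The substance is the converse: J contains every
form killed by φ.

Reductions of S-polynomials enlarge the 141 forms to a list of elements of J with known leading
monomials for a reverse lexicographic order (`groebner_leads`). Buchberger's criterion is not
checked. Division by the list shows that the standard monomials, those divisible by no leading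
monomial of the list, span the quotient by J (`exists_std`), and their independence comes from a
count. The relations are homogeneous both for the degree and for the order of the moments, and no
leading monomial involves m_00. The Hilbert series of the monomial ideal shows that the standard
monomials free of m_00 are, in each weight, as numerous as the monomials in the five parameters
(`countingSeries_isStd_eq`). Division also shows that their images under φ span the parameter ring,
weight bound by weight bound (`monomial_mem_span`). As many vectors as the dimension of what they
span are independent (`linearIndependent_stdImage`). Hence a form killed by φ has remainder zero
(`mem_relationIdeal`), and the list is a Gröbner basis after all.

The algebraic claims follow. J is prime as the kernel of a map to a domain, namely φ with each
coordinate multiplied by a new variable (`relationIdeal_eq_ker`). The Hilbert function counts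
standard monomials, which gives the series; the Hilbert polynomial has degree 5 and leading
coefficient 102/5!, which gives the degree. Minimality is again a count: in the bidegree of any
generator, J contains as many independent elements as there are multiples of generators, so omitting
one generator leaves too few (`span_rel_ne`). In degree 4 and weight 12 one linear syzygy among the
cubics corrects this count.

For the dimension, the closures of the images of coordinate subspaces form a strict chain of length
five (`coordinateSubvariety_lt`). Conversely, in a chain of irreducible closed sets, multiplication
by a form that vanishes on the smaller set but not on the larger raises the growth rate of the
Hilbert function by one at each step (`Grows.succ`), so no chain is longer than the degree of the
Hilbert polynomial. -/

/-- A polynomial as a list of terms, each one a coefficient and the code of a monomial. The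
exponents of a monomial are the digits of its code in some base `2 ^ k`. -/
abbrev Terms := List (ℤ × ℕ)

/-- `f n`, arranged so that the kernel evaluates `n` first. -/
def forceNat {α : Type} (n : ℕ) (f : ℕ → α) : α :=
  Nat.rec (f 0) (fun m _ => f m.succ) n

/-- `f ((z, m) :: acc)` if `z` is not zero, and `f acc` otherwise, arranged so that the kernel
evaluates `z` and `m` first. -/
def push {α : Type} (z : ℤ) (m : ℕ) (acc : Terms) (f : Terms → α) : α :=
  Int.rec (fun n => Nat.rec (f acc) (fun k _ => forceNat m fun m => f ((.ofNat k.succ, m) :: acc)) n)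
    (fun n => forceNat n fun n => forceNat m fun m => f ((.negSucc n, m) :: acc)) z

/-- `f (l.reverse ++ acc)`, with evaluated entries. -/
def forceReverse {α : Type} (f : Terms → α) (l : Terms) : Terms → α :=
  List.rec (motive := fun _ => Terms → α) f (fun x _ ih acc => push x.1 x.2 acc ih) l

/-- `f l`, arranged so that the kernel evaluates `l` first. -/
def forceTerms {α : Type} (l : Terms) (f : Terms → α) : α :=
  forceReverse (fun l => forceReverse f l []) l []

/-- `f (L.reverse ++ acc)`, with evaluated entries. -/
def forceReverseAll {α : Type} (f : List Terms → α) (L : List Terms) : List Terms → α :=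
  List.rec (motive := fun _ => List Terms → α) f
    (fun l _ ih acc => forceTerms l fun l => ih (l :: acc)) L

/-- `f L`, arranged so that the kernel evaluates `L` first. -/
def forceAll {α : Type} (L : List Terms) (f : List Terms → α) : α :=
  forceReverseAll (fun L => forceReverseAll f L []) L []

/-- The reversal of `a * f + c * x ^ t * g`, put in front of the last argument. -/
def mergeAux (a c : ℤ) (t : ℕ) (f : Terms) : Terms → Terms → Terms :=
  List.rec (motive := fun _ => Terms → Terms → Terms)
    (fun g => List.rec (motive := fun _ => Terms → Terms) (fun acc => acc)
      (fun y _ ih acc => push (Int.mul c y.1) (Nat.add y.2 t) acc ih) g)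
    (fun x _ ihf g => List.rec (motive := fun _ => Terms → Terms)
      (fun acc => push (Int.mul a x.1) x.2 acc (ihf []))
      (fun y g ihg acc => forceNat (Nat.add y.2 t) fun m =>
        Bool.rec
          (Bool.rec (push (Int.add (Int.mul a x.1) (Int.mul c y.1)) m acc (ihf g))
            (push (Int.mul c y.1) m acc ihg) (Nat.blt m x.2))
          (push (Int.mul a x.1) x.2 acc (ihf (y :: g))) (Nat.blt x.2 m)) g) f

/-- The code of the top bits of fifteen digits in base `32`. -/
def topBits : ℕ := 0x4210842108421084210

/-- Whether no digit of `c` has its top bit set. -/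
def isSmall (c : ℕ) : Bool := Nat.beq (Nat.land c topBits) 0

/-- `a * f + c * x ^ t * g`, unless digits could overflow. -/
def combine (a c : ℤ) (t : ℕ) (f g : Terms) : Option Terms :=
  cond (isSmall t && g.all fun y => isSmall y.2) (some (mergeAux a c t f g []).reverse) none

/-- Cancel the leading term of `f` by a multiple of `g`. -/
def cancelLead (f g : Terms) : Option Terms :=
  List.rec none (fun x _ _ => List.rec none (fun y _ _ =>
    forceNat (Int.gcd x.1 y.1) fun h =>
      -- Dividing by the gcd keeps the coefficients integral and small. The difference of codes is
      -- the quotient monomial if the lead of `g` divides that of `f`; otherwise the result is still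
      -- a combination of `f` and `g`, so soundness does not depend on divisibility.
      combine (Int.tdiv y.1 h) (Int.neg (Int.tdiv x.1 h)) (Nat.sub x.2 y.2) f g) g) f

/-- The entry of a list with the given number. -/
def entry (G : List Terms) : ℕ → Terms :=
  List.rec (fun _ => []) (fun g _ ih i => Nat.rec g (fun m _ => ih m) i) G

/-- Cancel leading terms by multiples of the entries of `G` with the given numbers. -/
def reduceLead (G : List Terms) (ks : List ℕ) : Terms → Option Terms :=
  List.rec (motive := fun _ => Terms → Option Terms) some
    (fun k _ ih f => Option.rec none (fun h => forceTerms h ih) (cancelLead f (entry G k))) ks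

/-- The digitwise maximum of two codes with `n` digits in base `32`. -/
def codeSup : ℕ → ℕ → ℕ → ℕ
  | 0, _, _ => 0
  | n + 1, a, b => max (a % 32) (b % 32) + 32 * codeSup n (a / 32) (b / 32)

/-- A monomial multiple of `f` with the same leading monomial as the S-polynomial of `f` and `g`
before cancellation. -/
def liftLead : Terms → Terms → Option Terms
  | x :: f, y :: _ => combine 0 1 (codeSup 15 x.2 y.2 - x.2) [] (x :: f)
  | _, _ => none

/-- Extend a list of polynomials by reductions of S-polynomials, according to recipes: the first two
numbers are those of the polynomials that give the S-polynomial, and the others those of the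
polynomials to reduce it with. -/
def extend : List (List ℕ) → List Terms → Option (List Terms)
  | (i :: ks) :: ps, G =>
    -- The S-polynomial arises as the first reduction step: the lifted polynomial has the least
    -- common multiple as its lead, and the first reducer cancels it.
    match liftLead (entry G i) (entry G (ks.headD 0)) with
    | none => none
    | some h =>
      forceTerms h fun h =>
      match reduceLead G ks h with
      | none => none
      -- New elements go in front, so the numbers in a recipe count back from the latest element.
      | some f => forceTerms f fun f => extend ps (f :: G)
  | _, G => some G

/-- The weighted degree of the monomial with the given code in base `32`. -/
def codeWeight : List ℕ → ℕ → ℕ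
  | [], _ => 0
  | w :: ws, c => w * (c % 32) + codeWeight ws (c / 32)

/-- Whether the codes of `f` are larger than `m`, and of degree `d` and weight `n`. -/
def allAbove (m d n : ℕ) (f : Terms) : Bool :=
  List.rec true (fun y _ ih => and (Nat.blt m y.2) (and (Nat.blt y.2 (32 ^ 15))
    (and (Nat.beq (codeWeight [1,1,1,1,1,1,1,1,1,1,1,1,1,1,1] y.2) d)
      -- The weights are the orders of the moments in their numbering; the last coordinate is m_00.
      (and (Nat.beq (codeWeight [3, 2, 1, 3, 2, 3, 1, 2, 3, 4, 4, 4, 4, 4, 0] y.2) n) ih)))) f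

/-- Whether the first term of `f` has code `m`, and the codes of the others are larger, of the same
degree and of the same weight. -/
def hasLead (f : Terms) (m : ℕ) : Bool :=
  match f with
  | [] => false
  | x :: f => Nat.beq x.2 m && x.1 != 0 && Nat.blt m (32 ^ 15) &&
    forceNat (codeWeight [1,1,1,1,1,1,1,1,1,1,1,1,1,1,1] m) fun d =>
      forceNat (codeWeight [3, 2, 1, 3, 2, 3, 1, 2, 3, 4, 4, 4, 4, 4, 0] m) fun n =>
        allAbove m d n f

/-- Whether the polynomials have the given leading monomials in the sense of `hasLead`. -/
def allLeads : List Terms → List ℕ → Bool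
  | [], [] => true
  | f :: fs, m :: ms => hasLead f m && allLeads fs ms
  | _, _ => false

/-- The code of a product of variables; the hexadecimal digit `i + 1` stands for the variable with
number `i`. -/
def monoCode : ℕ → ℕ → ℕ
  | 0, _ => 0
  | k + 1, n => cond (Nat.beq n 0) 0 (32 ^ (n % 16 - 1) + monoCode k (n / 16))

/-- Read a polynomial from a sequence of hexadecimal digits: three for a coefficient, to which `2048`
is added, and five for the product of the variables. -/
def readPoly : ℕ → ℕ → Terms → Terms
  | 0, _, acc => acc
  | k + 1, n, acc => cond (Nat.beq n 0) acc
    (forceNat (n / 0x100000000) fun m =>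
      push (Int.subNatNat (n / 0x100000 % 0x1000) 0x800) (monoCode 5 (n % 0x100000)) acc
        (readPoly k m))

/-- Read a list of polynomials. -/
def readTerms (L : List ℕ) : List Terms := L.map fun n => readPoly 100 n []

end TermList

end

/-! ### The explicit relations and the Gröbner basis computation. -/

noncomputable section

namespace TermList
/-- Ninety-nine cubic relations between the moments. -/
def cubics : List Terms := readTerms [
  0x802003337fd00f3280100ff4, 0x803003327fd00f227ff00f4380100ffb,
  0x803003227fe004337fd00f4280200fb3, 0x803002227fb0043280200b3380100f447ff00fb2,
  0x802007337fe00f537ff00f7280100ff1, 0x803007327fd00f527ff00f7480100ffd,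
  0x806005337fd00f317fa00f5280100f7480200ffd, 0x803007227fe007437fd00f2180200fd3,
  0x803005327fe007437fd00f2180100fb780100fd3, 0x803003317fd007437fd00f2180300f5480100fb77ff00fd3,
  0x801005437ff0074280100b737ff00d337ff00fb580100fd2,
  0x803005227fb0074280400b737fe00d3380100f417fe00fb580100fd2, 0x803003217fd0074280200b737fe00d33,
  0x801004317ff0074480100b727ff00d327ff00fb180100fd4,
  0x803002217fd0054280200b537fe00d327ff00fb180100fd4,
  0x801004217ff005447ff00b3180100b527ff00d2280100d43, 0x802007737fe00f757ff00f8380100ff6,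
  0x801007727ff0083380100f637ff00f71, 0x80200753801008337fe00f557ff00f637ff00f8280100ffa,
  0x802007747fd0083280300f627fe00fd7, 0x802007317fc007528010083280200f5180100f627fe00fa3,
  0x802006337fe007527ff0083280200f5180100f847fe00fa3, 0x802005537fd00752801008327ff00fa380100fd7,
  0x804007547fd00822801008437fe00d737ff00f6480300fa27fe00fd5,
  0x80600721803008227f50084380c00a337f600d737fa00f1180700f647f100fa280400fb880a00fd5,
  0x806006327fd008227ff008437fe00d737ff00f647fd00fa280200fb880200fd5,
  0x80c00552803008227e70084381800a3380400b777ee00d737f400f1181100f647e500fa280800fb880e00fd5,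
  0x80c00531803008227ef0084380c00a3380400b777f200d737f400f1180d00f647f100fa280400fb880a00fd5,
  0x803006227fe00643802007417fd0084280200b837fe00d72,
  0x802005547fe00643802007417fe0084280300a3280100b837fe00d537fe00d727ff00fa480100fb6,
  0x803005217fe00643802007417fd0084280300a3280200b7580100b837fe00d537fc00d7280100fb67ff00fd1,
  0x80300311802006437fb007417fd00a3280200b757fe00d5380300d7280300fa47fe00fb67ff00fd1,
  0x802005417fd006428010084480300a227fe00a4380200b637ff00b827fe00d52,
  0x803002117fc006428010084480300a227ff00a4380200b5580200b637ff00b717ff00b827ff00d317fc00d5280100d74,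
  0x802007777fd00f8780100ff9, 0x803008737fd00f857ff00f9380100ffe,
  0x806007757fd00f767fa00f8580100f9380200ffe, 0x803008727fe009337fd00f8180200fe3,
  0x806007717fa008537fe0093380600f657fd00f8180300f927fa00fa780200fe3,
  0x803007637fa008538010093380300f6580300f817fd00fa77ff00fe3,
  0x806007557f7008538020093380300f817fd00fa780100fe3, 0x801008747ff009327ff00fd880100fe2,
  0x803008317fd00852802009327fe00e337ff00f9480100fe2,
  0x803007627fd00852802009327fe00d777ff00f9480300fd87fe00fe2,
  0x80c007517f700852803009327fa00a737fe00d7780200e337fd00f6180300fd8,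
  0x80c006537f700852803009327fa00a7380200d777fe00e337fd00f6180300fd8,
  0x818005557d900852819009327fa00a737fe00d777fe00e3380300f617f800f947f400fa581500fd87fc00fe2,
  0x803008547fd009227fd00d8380300e3280100fb97ff00fe4,
  0x801007647fd00821803009227ff0094380300a727fc00d7580400d837fd00e327ff00fb980100fd6,
  0x806007117df00821821009227fa009437f400a5381e00a727fc00b877e000d7583000d837e200e3280600fa17f600fb980400fd6,
  0x803006527fd009227fd00a7280100b8780200d757fd00d8380300e3280100fb97ff00fd6,
  0x803006317f10082180f009227fd009437fa00a5380f00a727ff00b877f200d7581500d837f100e3280300fa17fb00fb980100fd680100fe4,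
  0x80200551801008217fd009227fd00a7280100b8780200d757fc00d8380400e327ff00fa180100fb9,
  0x80900a5280300a7480300b7680300b857fe00b937fa00d5580300d637fa00d717fd00d827fd00e227ff00e43,
  0x803008417fd0094280200b937fd00d8280300e227fe00e43,
  0x803006217fe006547ff0094280200a7480200b857fe00d717fe00d82,
  0x803005117fc00654801009427fd00a3180100a7480100b857ff00b9380300d637ff00d717ff00d8280100e43,
  0x80300a2180200b657ff00b817fe00d517fe00d6280100d847ff00e42, 0x803008777fd00f887ff00f9780100ffc,
  0x803008837fe009737fd00f8680200fe7, 0x803008757fe009737fd00f8680100fc380100fe7,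
  0x803007767fd009737fd00f8680300f9580100fc37ff00fe7,
  0x803008827fc009537ff0097280200e7380100f917fd00fa880200fe5,
  0x803008717fe009537ff009727fd00fa880100fc280200fe5,
  0x80300863802009537fb0097280600a777fa00e737fd00f6680300f917fa00fa880200fc280400fe5,
  0x80300855801009537fa0097280600a7780100c337fb00e737fd00f6680400f917fa00fa880200fc280300fe5,
  0x80300765801009537fc0097280300a7780100c337fc00e737fd00f6680300f917fd00fa880100fc280200fe5,
  0x803008847fd009527fd00d8780300e727ff00fc480100fd9,
  0x803008627ff009317fd00952801009747fd00a8380400e537ff00e7280100fd97ff00fe1,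
  0x803008517fd009527fd00a8380100c3280200e5380100fd97ff00fe1,
  0x803007617fb00931802009747fa00a757ff00c3280600e5380100e7280300fa680100fd97fc00fe1,
  0x806006637f500931805009747f400a757fd00a837fc00c3280300d8780c00e5380400e7280600fa680100fc47f900fe1,
  0x80600655801009317fa009527ff009747fa00a8380300c3280300d8780200e537fe00e727fd00fa680200fd980100fe1,
  0x80900a637f700a7180300b8880100b977fd00c227ff00c4380300d767fa00d857fb00d937fd00e3180600e5280500e74,
  0x803008647fd0092180100b977ff00c437fd00d8580100d9380300e527ff00e74,
  0x803008117ff009217fe009547fd00a8280100c2280200d937fe00e3180200e52,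
  0x809006627fd009217fa009547f700a8280300b8880100b977ff00c437fa00d7680300d8580100d9380300e5280500e74,
  0x80300651804009217f90095480600a557fd00a717fd00a8280300b887ff00b9780200c227fd00d8580100d937ff00e317fb00e5280400e747fd00faa7ff00fcb80400fed,
  0x80300a8480200b957ff00c427fd00d817fe00d9280300e217fe00e54, 0x803008877fe009777fd00f9880200fc7,
  0x801009757ff0098380100c737ff00e777ff00fc580100fe8,
  0x803008857fb0098380400c737fe00e7780100f967fe00fc580100fe8, 0x803008767fd0098380200c737fe00e77,
  0x80200955802009637fe009717fe0098280300a8780100c727fe00e757fe00e837ff00fa980100fc1,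
  0x80300881802009637fe009717fd0098280200c727fe00e83,
  0x80300865802009637fe009717fd0098280300a8780200c5380100c727fe00e757fc00e8380100fc17ff00fe6,
  0x803007667fb00963802009717fd00a8780200c537fe00e7580300e8380300fa97fe00fc17ff00fe6,
  0x80900a8580300a9380300c3180300c527fe00c747fd00d887ff00d977fa00e557fa00e6380300e717fd00e82,
  0x803009627fd0098480200c7480300d887fe00d977fd00e82,
  0x803008617fe009517ff0098480200a9380200c527fe00e637fe00e82,
  0x803006657fc00951801009847fd00a7680100a9380100c527ff00c7480100d977ff00e6380300e717ff00e82,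
  0x80300a927ff00b9880200c5480300d867fe00d957fd00e627fe00e84,
  0x803008887fb0098780200c7780100f997ff00fc8, 0x801009767ff0099380100c837ff00e877ff00fc680100fe9,
  0x803008867fd0098580200c757fe00e877ff00fc680100fe9,
  0x802009657fd009818010099280300a887fe00a9780200c717ff00c827fe00e85,
  0x803008667fc009818010099280300a887ff00a9780200c557ff00c6380200c717ff00c827ff00e767fc00e8580100e93,
  0x80300a8680200c517ff00c627ff00d987fe00e657fe00e8180100e92,
  0x801009867ff009957ff00c7680100c857ff00e8880100e97]

/-- Forty-one quartic relations between the moments. -/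
def quartics : List Terms := readTerms [
  0x8010b6547ff0b9427ff0ba748010bb767ff0bb858010bb937ff0d6428010d8448030da227fc0da438020db557fe0db637fe0db718040dd317fc0dd528020dd748010eb438030fdba7fe0fddd7ff0febb,
  0x806041117f706441803094447f40ba317ee0ba7480a0bb767ee0bb858040bb9381b0da227dc0da438240db557ea0db637ec0db718120db8282c0dd317ca0dd5281c0dd747f70eb228160eb4381e0fdba7ec0fddd7f60febb,
  0x8060a4418060b1117fd0b6417ff0b9448060bb657fd0bb818010bb927f40d4118060d6447fa0da427fa0db517f70db628030db848060dba380c0dd217fc0ddd37fe0e4448020eb427fe0ebb3,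
  0x81b0aa227d30aa437df0b92181e0b9547ee0ba557d30ba718120ba827f40bb888100bb978030c4427eb0cb228020cb437f40d6548120d94282d0da318270da7481e0db7680c0db857e00db937e80dd558120dd637e20dd717fa0dd827fa0e5447fa0eb3183c0eb527f60eb747dc0ed228120ed438360fbaa8020fcbb7e80fdda7e00fedb,
  0x803064117fa06644803094418090aa438110b9217f20b9548120ba558030ba717fd0ba828060bb887fa0bb977fd0c4428070cb228020cb438040d6547f60d9427f70da317ff0da747fc0db858060db937fe0dd717fb0dd828060e5448040eb317e40eb528060eb748090ed227f40ed437ee0fbaa7fe0fcbb8060fdda80e0fedb,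
  0x812011117ca06644824094418510aa438c90b9217520b95490e0ba557c10ba717ee0ba828540bb887c40bb977e50c4428420cb228120cb4383c0d65478e0d9427af0da318090da7481e0db767ac0db8582c0db937dc0dd558120dd637ee0dd717be0dd828360e5448360eb316bc0eb528660eb7486c0ed2277a0ed4374c0fbaa7e40fcbb8300fdda8a00fedb,
  0x81e0a6447ee0aa4281b0b6117fa0b6647f70b9417ee0ba517e50ba628120baa38020bb957fe0c4448050cb427fe0cbb37f40d1117e80d6418020d9447f40da547ee0db658060db818050db928060dba78240dd518180dd627fa0dd847f40dda37fc0ddd77fa0e4417fd0eb2180a0eb547fe0ebb780e0ed427fc0edb3,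
  0x8060a4118090b6117fa0b6647ff0b9417ee0ba518030ba628060baa38020bb957fd0cb428020cbb37f40d1118060d6417f40da547fe0db657fe0db817ff0db928060dba78140dd517fc0dd628020dd847fc0ddd77fe0e4418030eb2180a0eb547fe0ebb78020ed427f80edb3,
  0x8030b9847fd0c5447fd0cb318030cb527fe0cb747fa0d9217ff0db977fd0dd858030dd938060e6427f70ea228090ea437fa0eb558090eb717f70ed3180f0ed527fa0ed748020fdcb7fa0feba8040fedd,
  0x809066417ee09411809096447ee0ba767ee0ba938060cb317ee0cb528060cb747d00d9218300d9547dc0da5581b0da827fa0db888160db977ea0dc4380c0dd767e80dd858040dd937e80e6428180e8448120ea227e80ea4380c0eb5581e0eb637fa0eb717f10eb828180ed3182a0ed527f00ed748120fdaa8120feba7dc0fedd,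
  0x809061117e509411812096448120aa747ca0ba767c40ba9380c0cb317ca0cb528140cb747a00d9218600d9547b80da557ee0da718360da827ee0db8883e0db977fd0dc227de0dc4382a0dd767ca0dd8580a0dd937d00e6428300e84483f0ea227a60ea4383c0eb558480eb637d00eb717f40eb8285a0ed318240ed527ea0ed748240fdaa7f60fdcb8420feba7a40fedd,
  0x8060a9448030b6618020b9117ff0b9648060ba658030ba817fa0baa78010bb987fe0c4418040cb218020cb547fe0cbb77f60d9417fd0db867fe0db958020dc427fe0dcb38040dd927fe0e4118040e6447fa0ea427fa0eb517f40eb627ff0eb848060eba38080ed218080edb77fc0edd3,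
  0x8060a6418090b6617fa0b9118010b9647ee0ba658030ba818060baa77fd0bb987fe0c4418020cb548020cbb77f40d6648020d94180c0da518060da627f40daa38090db868020db958080dc427fa0dcb37fa0dd818040dd927fa0e4118080e6447fa0ea428060eb517fa0eb627fd0eb848060eba37fa0ed217fc0ed547f80edb780c0edd3,
  0x8120a1118240aa5482d0b6617d00b9118150b9647a60ba6582d0ba818120baa77e90bb987f40c4418060cb2180a0cb5480e0cbb78120d6117b80d66480c0d9418480da518360da627940daa38450db868020db958420dc427ce0dcb37e80dd657c40dd818240dd9280c0dda77d60e41183c0e6447d00ea4282a0eb517ca0eb627e10eb8482a0eba37c40ed217d00ed547d40edb78740edd3,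
  0x8010d9517ff0d9847ff0da938010dc317ff0dc528010dc748010dd977ff0e6548010e9428010ea747ff0eb768010eb857ff0eb938020ed637fe0ed717ff0ee437ff0fddc8010feeb,
  0x81b0aa827f70ba887f70ca227f40cb558030cb828060da938060dc318180dc527fc0dc748030dd887fe0dd978060ea748060eb768180eb857fc0eb937f40ed557fa0ed637fa0ed717d60ed828030ee227fe0ee43,
  0x812091117e509641809099448240a9547f70ba888060ba978060c6428060c8448120ca227dc0ca4380c0cb637fa0cb717f10cb827f40d9847dc0da938360dc317ca0dc5281c0dc747eb0dd8882c0dd977e80e6547f40e9428180ea747d00eb768420eb857ea0eb937f40ed558300ed637d00ed7180f0ed8280c0ee227ec0ee4380c0fcba7d60fddc8060feda8180feeb,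
  0x806066647f7096418030994480c0a9548020c6428020c8448030ca227f60ca438020cb637fb0cb827fc0d9848040dc318020dc528020dc747f80e6547fc0e9427fc0ea747fe0eb768020eb857fc0ed557fc0ed638040ed718050ed827fd0ee228080ee438040fcba7fc0fddc8020feda7fe0feeb,
  0x81b066117ca0964181b099448d80a9547940aa557ee0ba888540c6427f40c8447ca0ca227e80ca4380c0cb557e80cb637e80cb827b80d9847580da938480dc317880dc528580dc747e20dd888800dd977400e6547e80e9428180ea747700eb768600eb857e00eb938600ed558d80ed637a00ed7186c0ed8282a0ee227d80ee438360faaa82a0fcba79a0fddc7c40feda8420feeb,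
  0x8020b9617fe0c4118030d6617fc0d9117fd0d9648060da658030da817fa0daa78030db988060dc217fe0dc547fe0dcb77f70dd868020dd957fe0ddc38010e6418030e9447fe0eb658010eb817fd0eb927fc0ed517ff0ed628020ed848080edd77fe0ee428020eeb3,
  0x80c0a94180c0b6667fe0b9947fa0c41180c0cb517fa0cb628020cb847f70d6617f10d9647ee0da657f70da818120daa77f70db987fa0dc2180e0dc548020dcb781b0dd8680a0dd957fe0ddc37f40e1118150e6417ff0e9447e80ea547e20eb657f70eb818070eb9280c0eba78240ed518030ed627fe0ed847e00edd78020ee428020eeb3,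
  0x80c0a6648240aa6280c0b6667fe0b9947e80ba957fe0c4117fc0c6447e80ca427fc0cb517f20cb628060cb848100cba37f10d6618080d9117ef0d9647e20da658090da818060daa77f90db9881e0dc2181a0dc547fe0dcb78150dd868160dd957f20ddc37f40e11180f0e6418050e9447e80ea548160eb657e90eb818110eb9280c0eba780c0ed517c50ed627fa0ed848080eda37f00edd780e0ee427f60eeb3,
  0x8240a6118480aa518b40aa627b80aaa383c0b6667fe0b9947880ba957da0c4117f80c6447c40ca427dc0cb517d20cb628120cb848280cba37df0d6617f00d9117b10d9647760da658270da817fa0daa78030db988ba0dc218460dc547f20dcb77f70dd868920dd957ae0ddc37c40e11185d0e64182f0e9447a00ea5488a0eb657bb0eb818170eb928240eba77dc0ed516e70ed628120ed848800eda37f00edd77fe0ee427f20eeb3,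
  0x8010c6547ff0c9427ff0ca748010cb767ff0cb858010cb937ff0d9818010d9928030da887fc0da978020dc557fc0dc638010ec438040ed767fc0ed858020ed938030fdca7ff0fecb7fe0feed,
  0x803096117fa09664803099417fa0ca317fa0ca748020cb767fa0cb858020cb937f80d9818080d9928060da887f80da978040dc557fe0dc6380a0dc717fb0dc827f00e9218100e9547f40ea558090ea827fe0eb977fe0ec228020ec438080ed767fe0ed858040ee318080ee527fc0ee748060fdca8060feaa7f40feed,
  0x809066617e509664812099418120aa937ca0ca317c40ca7480c0cb767ca0cb858140cb937d00d9818300d99283f0da887a60da9783c0dc557d00dc638480dc717f40dc827a00e9218600e9547b80ea557ee0ea718360ea828030eb887e80ec2281c0ec438600ed767b80ed858240ee318360ee527f40ee748420fdca8240feaa7f60fecb7a40feed,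
  0x8020b9667fe0c6417ff0d9617fd0d9948020dc517ff0dc628030dc848020dd987fe0ddc77fd0e6118040e6648030e9417fa0ea517fd0ea628060eaa37fa0eb868020eb957fd0ec428020ecb38040ed658010ed817fe0ed928090ee217fe0ee548020eeb77f80eed3,
  0x8060a9648060c1117fd0c6417ff0c9448060cb657fd0cb818010cb927fa0d6668090d9617fb0d9947f40da957f40dc517fa0dc628080dc848060dca38040dd987fe0ddc77f70e6118060e6647fd0e9417ee0ea517f70ea628120eaa37f40eb8680a0eb957f70ec428040ecb38180ed658030ed817fc0ed9281b0ee218020ee548020eeb77e40eed3,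
  0x8060a9118120aa817fe0b9917f40ba988060c1117ff0c6417ff0c9447f40ca547fe0cb657f90cb818030cb928080cba77fa0d6668070d9618010d9947f40da9580c0dc517f40dc6280a0dc848060dca38080dd987fa0ddc77f70e6118060e6647f90e9417ee0ea518030ea628060eaa380c0eb8680e0eb957fb0ec428080ed657e30ed817fc0ed928040eda780f0ee2180a0ee547fa0eeb77f40eed3,
  0x8120a6618240aa6585a0aa817dc0aaa77fc0b9917e20ba9881e0c1117ed0c6417ff0c9447c40ca547ee0cb657e90cb818090cb928140cba77e20d6668250d9617fb0d9947d00da958580dc517d40dc628280dc848120dca38120dd987e60ddc77d30e61181e0e6647f50e9417820ea517f70ea628360eaa38240eb868360eb957e50ec4280c0ecb38140ed6577d0ed817f60ed928400eda78510ee218360ee547ea0eeb77ac0eed3,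
  0x81b0aa887d30aa978030b9987df0c92181e0c9547ee0ca557d30ca718120ca827fa0cb888120cb977e50cc227fa0d9958090dc767fd0dc857e80dc937f40e9518120e98482d0ea768270ea9380f0ec3184b0ec527ee0ec747dc0ed888120ed977e80ee557e20ee638120ee717fa0ee828360fcaa8020fccb7e00fedc7e80feea,
  0x803096617fa09911803099648090aa977fd0b9988110c9217f20c9548120ca558030ca717fd0ca828060cb887fc0cb978070cc228060d9958030dc767f70dc858020dc938040e9517f60e9847f70ea767ff0ea938010ec317e90ec5280a0ec748090ed887f40ed977fe0ee637fb0ee827ee0fcaa7fe0fccb80e0fedc8060feea,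
  0x812066667ca09911824099648510aa977e50b9988c90c9217520c95490e0ca557c10ca717ee0ca828570cb887d60cb9783f0cc228360d99584b0dc7675b0dc8583c0e95178e0e9847af0ea768090ea938090ec3170d0ec528920ec7486c0ed8877a0ed977dc0ee557ee0ee638120ee717be0ee8274c0fcaa7e40fccb8a00fedc8300feea,
  0x8060a9947fe0b9968030c6118020c6647ff0c9418060ca518030ca627fa0caa38040cb868020cb958010cc427fe0ccb37fe0d9668040d9917fa0da987fa0dc657f40dc817ff0dc928060dca77f60e9648020eb987fd0ec217fe0ec547fe0ecb78080ed868080edc38040ee847fc0eed7,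
  0x8060a9617fe0b9968090c6117fa0c6648010c9417ee0ca518030ca628060caa38020cb957fd0cc428020ccb37fa0d9668080d9917fa0da988060dc657fa0dc817fd0dc928060dca77f40e9118020e96480c0ea658060ea817f40eaa78080eb988090ec218020ec547fa0ecb77fa0ed867fc0ed957f80edc37fa0ee628040ee8480c0eed7,
  0x8120a6668240aa957f40b99682d0c6117d00c6648150c9417a60ca5182d0ca628120caa38060cb8680a0cb957e90cc4280e0ccb37d60d96683c0d9917d00da9882a0dc657ca0dc817e10dc9282a0dca78120e6617b80e91180c0e9648480ea658360ea817940eaa78420eb988450ec218020ec547ce0ecb77c40ed867d00ed957d40edc37e80ee517c40ee628240ee8480c0eea38740eed7,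
  0x8010c9517ff0c9847ff0ca938010cc317ff0cc528010cc748010dc977ff0e9818010e9928030ea887fc0ea978020ec557fe0ec637fe0ec718040ee767fc0ee858020ee937ff0fdcc8030feca7fe0feee,
  0x806096667f709961803099947f40ca767ee0ca9380a0cc317ee0cc528040cc747f70dc888160dc9781b0ea887dc0ea978240ec557ec0ec637ea0ec718120ec8282c0ee767ca0ee8581c0ee937f60fdcc81e0feca7ec0feee,
  0x81e0a9917ee0aa987fe0b99981b0c6617fa0c9117f70c9647ee0ca657e50ca818120caa78050cb988020cc547fe0ccb77fa0d9967fd0dc8680a0dc957fe0dcc37f40e6667e80e9618020e9947f40ea957ee0ec518060ec628050ec848060eca380e0ed987fc0edc78240ee658180ee817fa0ee927f40eea77fc0eee3,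
  0x8060a9668090c6617fa0c9117ff0c9647ee0ca658030ca818060caa77fd0cb988020cc548020ccb77fe0d9968030dc8680a0dc957fe0dcc37f40e6668060e9617f40ea957fe0ec517fe0ec627ff0ec848060eca38020ed987f80edc78140ee657fc0ee818020ee927fc0eee3,
  0x8060a9968060c6667fd0c9617ff0c9948060cc517fd0cc628010cc847fe0d9998020dc987fe0dcc77f40e9668060e9917fa0ea987fa0ec657f70ec818030ec928060eca780c0ee867fc0eee7]

/-- A quintic relation between the moments. -/
def quintics : List Terms := readTerms [
  0x809baa967f7caa417ffcbb96801ccb417fddba99809dca11806dca64803dcb66802dcb917ffdcc447fadda967f7ddc617ffddc94802ddd997f7eba667faeba91801ebb99803eca447fdecb117feecb647feedb96802edc41806edd66804edd91806eea41809eeb61801eeb947faeed117fceed647feeee44]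

/-- The recipes for the remaining elements of a Gröbner basis. -/
def recipes : List (List ℕ) := [
  [35, 82], [55, 85], [69, 94], [15, 60], [44, 84], [87, 102], [21, 61], [30, 87], [96, 103],
  [77, 107], [99, 108], [26, 68], [86, 110], [110, 111], [27, 45], [70, 72], [102, 109],
  [106, 114], [82, 116], [27, 72], [73, 77], [81, 108], [100, 109], [76, 114], [92, 121],
  [49, 82], [90, 123], [60, 84], [124, 125], [34, 41, 46], [45, 54, 53], [98, 109, 122],
  [106, 110, 89], [48, 66, 65], [130, 132, 129], [101, 128, 16], [90, 114, 127], [51, 94, 90],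
  [132, 135, 125], [68, 122, 37, 80], [79, 133, 35, 58], [106, 128, 132], [129, 139, 115],
  [56, 70, 66, 12], [118, 126, 68, 36], [55, 67, 68, 48, 63], [93, 124, 137, 129],
  [135, 138, 125, 145], [74, 101, 71, 126], [113, 123, 61, 59, 68], [100, 116, 58, 57, 67],
  [108, 142, 146, 18], [82, 109, 125, 130], [138, 150, 126, 144],
  [116, 135, 76, 134, 59, 72, 71], [125, 148, 45, 135, 98, 97], [67, 109, 52, 101, 99, 98],
  [80, 97, 68, 67, 98, 59, 92, 75], [68, 103, 101, 105, 61, 38, 97],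
  [103, 139, 101, 56, 100, 37, 79], [86, 143, 148, 84, 52, 97, 15],
  [90, 108, 135, 102, 128, 11, 120], [131, 149, 37, 38, 155, 30],
  [104, 141, 154, 143, 23, 73, 127, 126, 125], [128, 137, 127, 37, 155, 22, 156],
  [116, 138, 114, 122, 156, 150, 149, 18], [90, 115, 80, 79, 113, 107, 69, 75, 74, 73, 7, 103],
  [92, 140, 124, 41, 145, 18, 133, 132, 130, 129],
  [132, 157, 95, 92, 60, 106, 155, 23, 7, 77, 76, 75],
  [134, 141, 164, 162, 111, 66, 110, 130, 128, 47, 90, 89, 9, 88],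
  [116, 122, 139, 82, 81, 90, 123, 89, 20, 131, 130, 8, 72], [163, 200], [62, 9], [206, 212],
  [55, 10, 38], [193, 208], [194, 206], [203, 210], [165, 22, 169], [166, 22, 170],
  [83, 182, 94], [206, 219, 192], [207, 218, 200], [201, 206, 208], [28, 27, 111, 110, 109, 108],
  [176, 17, 20, 88], [186, 192, 187, 196], [97, 23, 106, 37, 25, 16, 127, 126, 125],
  [215, 225, 59, 179, 217], [194, 209, 61, 167, 191], [36, 25, 18],
  [32, 3, 128, 24, 113, 112, 111], [39, 6, 121, 163, 140, 167, 139, 166, 159, 106, 105, 11],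
  [184, 12, 146, 150, 116, 67, 171, 44, 140, 41, 159, 158, 156, 155, 66, 184, 51, 28], [223, 22],
  [197, 1],
  [72, 3, 123, 149, 121, 153, 119, 70, 174, 47, 189, 143, 44, 33, 162, 161, 193, 159, 158, 69, 187, 54, 31],
  [6, 2], [9, 3], [3, 2, 114], [10, 4, 203, 216, 218], [238, 2],
  [90, 2, 115, 117, 131, 130, 87, 81, 180, 105, 49, 197, 156, 50, 131, 173, 150, 159, 149, 180, 169, 116, 115, 193, 78, 129, 155, 127, 159, 125, 76, 180, 53, 171, 186, 153, 190, 151, 195, 93, 149, 50, 39, 168, 167, 199, 165, 164, 75, 193, 60, 37],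
  [213, 2, 135, 179, 157, 181, 118, 91, 118, 132, 131, 88, 82, 181, 106, 50, 221, 26, 118, 198, 157, 194, 132, 174, 151, 160, 150, 181, 170, 117, 116, 194, 79, 130, 156, 128, 160, 126, 77, 181, 54, 210, 172, 187, 170, 176, 191, 152, 196, 160, 150, 194, 80, 169, 168, 200, 166, 76, 194, 61, 201, 187, 186, 86, 37, 51, 195, 38, 204, 208],
  [6, 2], [2, 1, 205, 208],
  [211, 0, 207, 138, 72, 184, 208, 16, 209, 222, 206, 224, 5, 138, 182, 160, 184, 121, 94, 119, 121, 135, 134, 91, 85, 184, 109, 53, 121, 201, 160, 54, 135, 177, 154, 163, 153, 184, 173, 120, 119, 197, 82, 133, 159, 131, 163, 129, 80, 184, 57, 175, 190, 173, 157, 194, 155, 199, 97, 153, 54, 43, 172, 171, 203, 169, 168, 79, 197, 64, 41]]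

/-- The leading monomials of the Gröbner basis. -/
def leadCodes : List ℕ := List.map (monoCode 11) [
  0xcccca444444, 0xcccb664444, 0xbbbb999999, 0xccaa44442, 0xccca44442, 0xbbaa99998, 0xcb994444,
  0xccb95444, 0xbb999991, 0xbbb99998, 0xcca4443, 0xcaa4443, 0xbaa9997, 0xca4422, 0xcb9744,
  0xddd752, 0xbb9997, 0xaaa43, 0xaaa97, 0xdd853, 0xb9644, 0xca432, 0xdc822, 0xb9941, 0xb9994,
  0xcb964, 0xb9542, 0xbaa73, 0xcaa73, 0xb9964, 0xb9911, 0xbb996, 0xdc853, 0xb9996, 0xb9974,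
  0xb9988, 0xc433, 0xc832, 0xc743, 0xb972, 0xb933, 0xb971, 0xb987, 0xd953, 0xb993, 0xb973,
  0xb977, 0xc752, 0xb853, 0xd833, 0xb852, 0xc852, 0xe833, 0xaa87, 0xaa32, 0xb992, 0xa833, 0xa832,
  0xaa33, 0xb995, 0xb963, 0xb833, 0xa933, 0xa433, 0xa971, 0xaa77, 0xc833, 0xb983, 0xa993, 0xa744,
  0xb951, 0xa977, 0x9981, 0x6442, 0xb981, 0xb985, 0x8422, 0x8433, 0xa981, 0xa642, 0xa953, 0xa822,
  0xa931, 0xa974, 0xa943, 0xa973, 0xa741, 0xa743, 0x9953, 0xa951, 0x9963, 0xa654, 0x6443, 0xa995,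
  0x9921, 0xa544, 0x9951, 0x9931, 0x9821, 0x9822, 0x6544, 0xa983, 0x9853, 0xa742, 0x9852, 0x9643,
  0x9833, 0x333, 0x332, 0x322, 0x222, 0x733, 0x732, 0x533, 0x722, 0x532, 0x331, 0x543, 0x522,
  0x321, 0x431, 0x221, 0x421, 0x773, 0x772, 0x753, 0x774, 0x731, 0x633, 0x553, 0x754, 0x721,
  0x632, 0x552, 0x531, 0x622, 0x554, 0x521, 0x311, 0x541, 0x211, 0x777, 0x873, 0x775, 0x872,
  0x771, 0x763, 0x755, 0x874, 0x831, 0x762, 0x751, 0x653, 0x555, 0x854, 0x764, 0x711, 0x652,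
  0x631, 0x551, 0xa52, 0x841, 0x621, 0x511, 0xa21, 0x877, 0x883, 0x875, 0x776, 0x882, 0x871,
  0x863, 0x855, 0x765, 0x884, 0x862, 0x851, 0x761, 0x663, 0x655, 0xa63, 0x864, 0x811, 0x662,
  0x651, 0xa84, 0x887, 0x975, 0x885, 0x876, 0x955, 0x881, 0x865, 0x766, 0xa85, 0x962, 0x861,
  0x665, 0xa92, 0x888, 0x976, 0x886, 0x965, 0x866, 0xa86, 0x986, 0xb654, 0x4111, 0xa441, 0xaa22,
  0x6411, 0x1111, 0xa644, 0xa411, 0xb984, 0x6641, 0x6111, 0xa944, 0xa641, 0xa111, 0xd951, 0xaa82,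
  0x9111, 0x6664, 0x6611, 0xb961, 0xa941, 0xa664, 0xa611, 0xc654, 0x9611, 0x6661, 0xb966, 0xa964,
  0xa911, 0xa661, 0xaa88, 0x9661, 0x6666, 0xa994, 0xa961, 0xa666, 0xc951, 0x9666, 0xa991, 0xa966,
  0xa996, 0xbaa96]

end TermList

end

noncomputable section

namespace TermList
-- The recipes need no justification: whatever they do, the results are combinations of the
-- relations. Only the outcome is checked, namely the leading monomials and the homogeneity of each
-- element for degree and weight.
theorem groebner_leads : forceAll (cubics ++ quartics ++ quintics) (fun G =>
  Option.rec false (fun G => allLeads G leadCodes) (extend recipes G)) = true := by decide +kernel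

end TermList

end

/-! ### Soundness: computations with term lists stay inside the ideal. -/

noncomputable section

namespace TermList

variable {S : Type*} [CommRing S] {n : ℕ}

/-- The value at `x` of the monomial with the given code. -/
def monoValue (x : Fin n → S) (c : ℕ) : S := ∏ i, x i ^ (c / 32 ^ (i : ℕ) % 32)

/-- The sum of the terms of a polynomial, given the values of the monomials. -/
def termSum (μ : ℕ → S) (f : Terms) : S := (f.map fun y => (y.1 : S) * μ y.2).sum

/-- The value at `x` of a polynomial given by its terms. -/
def value (x : Fin n → S) (f : Terms) : S := termSum (monoValue x) f

@[simp] lemma termSum_nil (μ : ℕ → S) : termSum μ [] = 0 := rfl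

@[simp] lemma termSum_cons (μ : ℕ → S) (y : ℤ × ℕ) (f : Terms) :
    termSum μ (y :: f) = y.1 * μ y.2 + termSum μ f := by simp [termSum]

@[simp] lemma termSum_reverse (μ : ℕ → S) (f : Terms) : termSum μ f.reverse = termSum μ f := by
  simp [termSum, List.sum_reverse]

lemma forceNat_eq {α : Type} (n : ℕ) (f : ℕ → α) : forceNat n f = f n := by cases n <;> rfl

lemma push_eq {α : Type} (z : ℤ) (m : ℕ) (acc : Terms) (f : Terms → α) :
    push z m acc f = if z = 0 then f acc else f ((z, m) :: acc) := by
  rcases z with (_ | k) | k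
  · rfl
  · rw [if_neg (by simp; omega)]
    exact forceNat_eq m fun m => f ((.ofNat k.succ, m) :: acc)
  · rw [if_neg (by simp)]
    exact (forceNat_eq k fun k => forceNat m fun m => f ((.negSucc k, m) :: acc)).trans
      (forceNat_eq m fun m => f ((.negSucc k, m) :: acc))

lemma forceReverse_eq {α : Type} (f : Terms → α) (l acc : Terms) :
    forceReverse f l acc = f ((l.filter fun x => x.1 ≠ 0).reverse ++ acc) := by
  induction l generalizing acc with
  | nil => rfl
  | cons x l ih =>
    have : forceReverse f (x :: l) acc = push x.1 x.2 acc (forceReverse f l) := rfl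
    rw [this, push_eq]
    split_ifs with h <;> simp [ih, h]

lemma forceTerms_eq {α : Type} (l : Terms) (f : Terms → α) :
    forceTerms l f = f (l.filter fun x => x.1 ≠ 0) := by
  simp [forceTerms, forceReverse_eq, List.filter_reverse]

lemma forceReverseAll_eq {α : Type} (f : List Terms → α) (L acc : List Terms) :
    forceReverseAll f L acc = f ((L.map fun l => l.filter fun x => x.1 ≠ 0).reverse ++ acc) := by
  induction L generalizing acc with
  | nil => rfl
  | cons l L ih =>
    have : forceReverseAll f (l :: L) acc =
      forceTerms l fun l => forceReverseAll f L (l :: acc) := rfl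
    rw [this, forceTerms_eq, ih]
    simp

lemma forceAll_eq {α : Type} (L : List Terms) (f : List Terms → α) :
    forceAll L f = f (L.map fun l => l.filter fun x => x.1 ≠ 0) := by
  simp [forceAll, forceReverseAll_eq, Function.comp_def]

@[simp] lemma termSum_filter (μ : ℕ → S) (f : Terms) :
    termSum μ (f.filter fun y => y.1 ≠ 0) = termSum μ f := by
  induction f with
  | nil => rfl
  | cons y f ih => by_cases h : y.1 = 0 <;> simp_all

/-- The function `μ` is arbitrary because the same merge serves monomials in several variables and
powers of one variable in Hilbert numerators. The lists need not be sorted. -/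
lemma termSum_mergeAux (μ : ℕ → S) (a c : ℤ) (t : ℕ) (f g acc : Terms) :
    termSum μ (mergeAux a c t f g acc) =
      a * termSum μ f + c * termSum μ (g.map fun y => (y.1, y.2 + t)) + termSum μ acc := by
  induction f generalizing g acc with
  | nil =>
    induction g generalizing acc with
    | nil => simp [mergeAux]
    | cons y g ih =>
      have : mergeAux a c t [] (y :: g) acc =
        push (c * y.1) (y.2 + t) acc (mergeAux a c t [] g) := rfl
      rw [this, push_eq]
      split_ifs with h
      · have h' : (c : S) * y.1 = 0 := by exact_mod_cast congrArg (Int.cast (R := S)) h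
        simp only [ih, List.map_cons, termSum_cons]
        linear_combination (-μ (y.2 + t)) * h'
      · simp only [ih, List.map_cons, termSum_cons]
        push_cast
        ring
  | cons z f ihf =>
    induction g generalizing acc with
    | nil =>
      have : mergeAux a c t (z :: f) [] acc =
        push (a * z.1) z.2 acc (mergeAux a c t f []) := rfl
      rw [this, push_eq]
      split_ifs with h
      · have h' : (a : S) * z.1 = 0 := by exact_mod_cast congrArg (Int.cast (R := S)) h
        simp only [ihf, List.map_nil, termSum_cons, termSum_nil]
        linear_combination (-μ z.2) * h'
      · simp only [ihf, List.map_nil, termSum_cons, termSum_nil]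
        push_cast
        ring
    | cons y g ih =>
      have : mergeAux a c t (z :: f) (y :: g) acc = forceNat (y.2 + t) fun m =>
        Bool.rec
          (Bool.rec (push (a * z.1 + c * y.1) m acc (mergeAux a c t f g))
            (push (c * y.1) m acc (mergeAux a c t (z :: f) g)) (Nat.blt m z.2))
          (push (a * z.1) z.2 acc (mergeAux a c t f (y :: g))) (Nat.blt z.2 m) := rfl
      rw [this, forceNat_eq]
      rcases h1 : Nat.blt z.2 (y.2 + t) with _ | _
      · rcases h2 : Nat.blt (y.2 + t) z.2 with _ | _
        · have hm : z.2 = y.2 + t := by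
            rw [Bool.eq_false_iff, Ne, Nat.blt_eq] at h1 h2
            omega
          simp only [push_eq]
          split_ifs with h
          · have h' : (a : S) * z.1 + c * y.1 = 0 := by
              exact_mod_cast congrArg (Int.cast (R := S)) h
            simp only [ihf, List.map_cons, termSum_cons, hm]
            linear_combination (-μ (y.2 + t)) * h'
          · simp only [ihf, List.map_cons, termSum_cons, hm]
            push_cast
            ring
        · simp only [push_eq]
          split_ifs with h
          · have h' : (c : S) * y.1 = 0 := by exact_mod_cast congrArg (Int.cast (R := S)) h
            simp only [ih, List.map_cons, termSum_cons]
            linear_combination (-μ (y.2 + t)) * h'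
          · simp only [ih, List.map_cons, termSum_cons]
            push_cast
            ring
      · simp only [push_eq]
        split_ifs with h
        · have h' : (a : S) * z.1 = 0 := by exact_mod_cast congrArg (Int.cast (R := S)) h
          simp only [ihf, List.map_cons, termSum_cons]
          linear_combination (-μ z.2) * h'
        · simp only [ihf, List.map_cons, termSum_cons]
          push_cast
          ring

@[simp] lemma value_nil (x : Fin n → S) : value x [] = 0 := rfl

@[simp] lemma value_cons (x : Fin n → S) (y : ℤ × ℕ) (f : Terms) :
    value x (y :: f) = y.1 * monoValue x y.2 + value x f := termSum_cons _ y f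

@[simp] lemma value_reverse (x : Fin n → S) (f : Terms) : value x f.reverse = value x f :=
  termSum_reverse _ f

@[simp] lemma value_filter (x : Fin n → S) (f : Terms) :
    value x (f.filter fun y => y.1 ≠ 0) = value x f := termSum_filter _ f

lemma value_mergeAux (x : Fin n → S) (a c : ℤ) (t : ℕ) (f g acc : Terms) :
    value x (mergeAux a c t f g acc) =
      a * value x f + c * value x (g.map fun y => (y.1, y.2 + t)) + value x acc :=
  termSum_mergeAux _ a c t f g acc

lemma add_div_pow_of_digits {a b i : ℕ}
    (h : ∀ j < i, a / 32 ^ j % 32 + b / 32 ^ j % 32 < 32) :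
    (a + b) / 32 ^ i = a / 32 ^ i + b / 32 ^ i := by
  induction i with
  | zero => simp
  | succ i ih =>
    have h1 := ih fun j hj => h j (hj.trans i.lt_succ_self)
    have h2 := h i i.lt_succ_self
    rw [pow_succ, ← Nat.div_div_eq_div_mul, ← Nat.div_div_eq_div_mul, ← Nat.div_div_eq_div_mul, h1]
    omega

lemma digit_lt_of_isSmall {c : ℕ} (h : isSmall c = true) {i : ℕ} (hi : i < 15) :
    c / 32 ^ i % 32 < 16 := by
  have h0 : c &&& topBits = 0 := by simpa [isSmall] using h
  have h1 := congrArg (fun m => m.testBit (5 * i + 4)) h0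
  have h2 : topBits.testBit (5 * i + 4) = true := by
    interval_cases i <;> decide
  simp only [Nat.testBit_land, h2, Nat.zero_testBit, Bool.and_true] at h1
  rw [Nat.testBit_eq_decide_div_mod_eq, pow_add, pow_mul, ← Nat.div_div_eq_div_mul] at h1
  simp only [decide_eq_false_iff_not] at h1
  norm_num at h1
  omega

lemma digit_add {a b i : ℕ} (ha : isSmall a = true) (hb : isSmall b = true) (hi : i < 15) :
    (a + b) / 32 ^ i % 32 = a / 32 ^ i % 32 + b / 32 ^ i % 32 := by
  rw [add_div_pow_of_digits fun j hj => by
    have := digit_lt_of_isSmall ha (hj.trans hi)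
    have := digit_lt_of_isSmall hb (hj.trans hi)
    omega]
  have := digit_lt_of_isSmall ha hi
  have := digit_lt_of_isSmall hb hi
  omega

/-- Digits below 16 add without a carry in base 32; this is why `combine` tests the top bits. -/
lemma monoValue_add (hn : n ≤ 15) (x : Fin n → S) {a b : ℕ} (ha : isSmall a = true)
    (hb : isSmall b = true) : monoValue x (a + b) = monoValue x a * monoValue x b := by
  simp only [monoValue, ← Finset.prod_mul_distrib, ← pow_add]
  exact Finset.prod_congr rfl fun i _ => by rw [digit_add ha hb (i.2.trans_le hn)]

lemma value_combine (hn : n ≤ 15) (x : Fin n → S) {a c : ℤ} {t : ℕ} {f g h : Terms}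
    (hh : combine a c t f g = some h) :
    value x h = a * value x f + c * monoValue x t * value x g := by
  have key : isSmall t = true ∧ ∀ y ∈ g, isSmall y.2 = true := by
    by_contra hc
    have : (isSmall t && g.all fun y => isSmall y.2) = false := by
      rw [← Bool.not_eq_true]
      simpa using hc
    rw [combine, this] at hh
    simp at hh
  have h1 : (isSmall t && g.all fun y => isSmall y.2) = true := by simpa using key
  rw [combine, h1] at hh
  obtain rfl : (mergeAux a c t f g []).reverse = h := by simpa using hh
  have h2 : value x (g.map fun y => (y.1, y.2 + t)) = monoValue x t * value x g := by
    have := key.2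
    clear h1 hh
    induction g with
    | nil => simp
    | cons y g ih =>
      simp only [List.map_cons, value_cons]
      rw [ih ⟨key.1, fun z hz => key.2 z (by simp [hz])⟩ fun z hz => this z (by simp [hz]),
        monoValue_add hn x (this y (by simp)) key.1]
      ring
  rw [value_reverse, value_mergeAux, h2]
  simp [mul_assoc]

section Ideal

variable (hn : n ≤ 15) (x : Fin n → S) (I : Ideal S)
include hn

lemma combine_mem {a c : ℤ} {t : ℕ} {f g h : Terms} (hf : value x f ∈ I) (hg : value x g ∈ I)
    (hh : combine a c t f g = some h) : value x h ∈ I := by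
  rw [value_combine hn x hh]
  exact I.add_mem (I.mul_mem_left _ hf) (I.mul_mem_left _ hg)

lemma cancelLead_mem {f g h : Terms} (hf : value x f ∈ I) (hg : value x g ∈ I)
    (hh : cancelLead f g = some h) : value x h ∈ I := by
  rcases f with _ | ⟨y, f⟩
  · cases hh
  rcases g with _ | ⟨z, g⟩
  · cases hh
  · have : cancelLead (y :: f) (z :: g) = forceNat (Int.gcd y.1 z.1) fun h =>
      combine (Int.tdiv z.1 h) (-(Int.tdiv y.1 h)) (y.2 - z.2) (y :: f) (z :: g) := rfl
    rw [this, forceNat_eq] at hh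
    exact combine_mem hn x I hf hg hh

omit hn in
lemma entry_mem {G : List Terms} (hG : ∀ g ∈ G, value x g ∈ I) (i : ℕ) :
    value x (entry G i) ∈ I := by
  induction G generalizing i with
  | nil => exact I.zero_mem
  | cons g G ih =>
    rcases i with _ | i
    · exact hG g (by simp)
    · exact ih (fun g hg => hG g (by simp [hg])) i

lemma reduceLead_mem {G : List Terms} (hG : ∀ g ∈ G, value x g ∈ I) (ks : List ℕ) {f h : Terms}
    (hf : value x f ∈ I) (hh : reduceLead G ks f = some h) : value x h ∈ I := by
  induction ks generalizing f with
  | nil => cases hh; exact hf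
  | cons k ks ih =>
    have : reduceLead G (k :: ks) f =
      Option.rec none (fun h => forceTerms h (reduceLead G ks)) (cancelLead f (entry G k)) := rfl
    rw [this] at hh
    rcases hc : cancelLead f (entry G k) with _ | f'
    · rw [hc] at hh; cases hh
    · rw [hc] at hh
      simp only [forceTerms_eq] at hh
      exact ih (by
        rw [value_filter]
        exact cancelLead_mem hn x I hf (entry_mem x I hG k) hc) hh

/-- A recipe only forms monomial multiples and integer combinations of earlier entries. -/
lemma extend_mem {ps : List (List ℕ)} {G G' : List Terms} (hG : ∀ g ∈ G, value x g ∈ I)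
    (h : extend ps G = some G') : ∀ g ∈ G', value x g ∈ I := by
  induction ps generalizing G with
  | nil => rw [extend] at h; cases h; exact hG; simp
  | cons p ps ih =>
    rcases p with _ | ⟨i, ks⟩
    · rw [extend] at h; cases h; exact hG; simp
    · rw [extend] at h
      rcases h1 : liftLead (entry G i) (entry G (ks.headD 0)) with _ | f
      · rw [h1] at h; cases h
      simp only [h1, forceTerms_eq] at h
      rcases h2 : reduceLead G ks (f.filter fun x => x.1 ≠ 0) with _ | f'
      · rw [h2] at h; cases h
      simp only [h2] at h
      have hf : value x f ∈ I := by
        revert h1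
        rcases he : entry G i with _ | ⟨y, g⟩
        · intro h1; simp [liftLead] at h1
        rcases entry G (ks.headD 0) with _ | ⟨z, g'⟩
        · intro h1; simp [liftLead] at h1
        intro h1
        refine combine_mem hn x I (f := []) I.zero_mem ?_ h1
        rw [← he]
        exact entry_mem x I hG i
      refine ih (G := f'.filter (fun x => x.1 ≠ 0) :: G) ?_ h
      intro g hg
      rcases List.mem_cons.1 hg with rfl | hg
      · rw [value_filter]
        exact reduceLead_mem hn x I hG ks (by rwa [value_filter]) h2
      · exact hG g hg

end Ideal

lemma exists_of_allLeads {G : List Terms} {L : List ℕ} (h : allLeads G L = true) :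
    ∀ m ∈ L, ∃ g ∈ G, hasLead g m = true := by
  induction L generalizing G with
  | nil => simp
  | cons m L ih =>
    rcases G with _ | ⟨g, G⟩
    · simp [allLeads] at h
    · simp only [allLeads, Bool.and_eq_true] at h
      intro m' hm'
      rcases List.mem_cons.1 hm' with rfl | hm'
      · exact ⟨g, by simp, h.1⟩
      · obtain ⟨g', hg', h'⟩ := ih h.2 m' hm'
        exact ⟨g', by simp [hg'], h'⟩

/-- The relations that generate the ideal. -/
def relations : List Terms := cubics ++ quartics ++ quintics

/-- The integer computation is transported to an arbitrary commutative ring; it is applied to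
polynomials over ℂ. -/
lemma exists_hasLead (x : Fin 15 → S) (I : Ideal S) (h : ∀ f ∈ relations, value x f ∈ I) {m : ℕ}
    (hm : m ∈ leadCodes) : ∃ g, value x g ∈ I ∧ hasLead g m = true := by
  have key := groebner_leads
  rw [forceAll_eq] at key
  rcases he : extend recipes (relations.map fun l => l.filter fun x => x.1 ≠ 0) with _ | G
  · rw [← relations, he] at key; cases key
  · rw [← relations, he] at key
    obtain ⟨g, hg, hl⟩ := exists_of_allLeads key m hm
    refine ⟨g, extend_mem le_rfl x I ?_ he g hg, hl⟩
    intro g hg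
    obtain ⟨f, hf, rfl⟩ := List.mem_map.1 hg
    rw [value_filter]
    exact h f hf

end TermList

end

noncomputable section

namespace TermList

/-! ### Substitution -/

/-- `f + g`. -/
def addTerms (f g : Terms) : Terms := (mergeAux 1 1 0 f g []).reverse

/-- `f * g`, unless digits could overflow. -/
def mulTerms (f g : Terms) : Option Terms :=
  List.rec (some []) (fun y _ ih => Option.rec none (fun acc =>
    Option.rec none (fun h => forceTerms h some) (combine 1 y.1 y.2 acc g)) ih) f

/-- `f ^ k * g`, unless digits could overflow. -/
def powMulTerms (f : Terms) (k : ℕ) (g : Terms) : Option Terms :=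
  Nat.rec (some g) (fun _ ih => Option.rec none (fun acc => mulTerms f acc) ih) k

/-- Multiply by the value of a monomial at the given polynomials. -/
def substMono (F : List Terms) : ℕ → Terms → Option Terms :=
  List.rec (motive := fun _ => ℕ → Terms → Option Terms) (fun _ => some)
    (fun f _ ih c acc => Option.rec none (fun acc => forceNat (c / 32) fun c => ih c acc)
      (powMulTerms f (c % 32) acc)) F

/-- The value of a polynomial at the given polynomials. -/
def substTerms (F : List Terms) (f : Terms) : Option Terms :=
  List.rec (some []) (fun y _ ih => Option.rec none (fun acc =>
    Option.rec none (fun h => forceTerms (addTerms acc h) some) (substMono F y.2 [(y.1, 0)])) ih) f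

/-- The moments as polynomials in the moments of order one and two. -/
def momentTerms : List Terms := [
  [(-2, 0x41), (2, 0x8020), (1, 0x100001)],
  [(1, 0x100000)],
  [(1, 0x20)],
  [(-2, 0x60), (3, 0x100020)],
  [(1, 0x8000)],
  [(-2, 0x22), (1, 0x420), (2, 0x8001)],
  [(1, 0x1)],
  [(1, 0x400)],
  [(-2, 0x3), (3, 0x401)],
  [(-2, 0x42), (2, 0x10000), (1, 0x100400)],
  [(-2, 0x80), (3, 0x200000)],
  [(-2, 0x4), (3, 0x800)],
  [(-2, 0x61), (3, 0x108000)],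
  [(-2, 0x23), (3, 0x8400)],
  [(1, 0x0)]]

def isNil (f : Terms) : Bool := List.rec true (fun _ _ _ => false) f

/-- The easy inclusion: the relations vanish identically on the parametrization, in which m_00 is 1
(the last entry of `momentTerms`). -/
theorem substTerms_relations : (relations.all fun f =>
    Option.rec false isNil (substTerms momentTerms f)) = true := by decide +kernel

end TermList

end

/-! ### The parametrization, the monomial order and the ideal of the relations. -/

noncomputable section

namespace TermList

section

variable {S : Type*} [CommRing S] {n : ℕ} (hn : n ≤ 15) (x : Fin n → S)

lemma value_addTerms (f g : Terms) : value x (addTerms f g) = value x f + value x g := by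
  simp [addTerms, value_mergeAux]

include hn

lemma value_mulTerms {f g h : Terms} (hh : mulTerms f g = some h) :
    value x h = value x f * value x g := by
  induction f generalizing h with
  | nil => cases hh; simp
  | cons y f ih =>
    have : mulTerms (y :: f) g = Option.rec none (fun acc =>
      Option.rec none (fun h => forceTerms h some) (combine 1 y.1 y.2 acc g)) (mulTerms f g) := rfl
    rw [this] at hh
    rcases h1 : mulTerms f g with _ | acc
    · rw [h1] at hh; cases hh
    rw [h1] at hh
    rcases h2 : combine 1 y.1 y.2 acc g with _ | h'
    · simp [h2] at hh
    simp only [h2, forceTerms_eq, Option.some.injEq] at hh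
    rw [← hh, value_filter, value_combine hn x h2, ih h1, value_cons]
    push_cast
    ring

lemma value_powMulTerms {f g h : Terms} {k : ℕ} (hh : powMulTerms f k g = some h) :
    value x h = value x f ^ k * value x g := by
  induction k generalizing h with
  | zero => cases hh; simp
  | succ k ih =>
    have : powMulTerms f (k + 1) g =
      Option.rec none (fun acc => mulTerms f acc) (powMulTerms f k g) := rfl
    rw [this] at hh
    rcases h1 : powMulTerms f k g with _ | acc
    · rw [h1] at hh; cases hh
    rw [h1] at hh
    rw [value_mulTerms hn x hh, ih h1]
    ring

lemma value_substMono (F : List Terms) {c : ℕ} {f h : Terms} (hh : substMono F c f = some h) :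
    value x h = monoValue (fun i => value x (F.get i)) c * value x f := by
  induction F generalizing c f with
  | nil => cases hh; simp [monoValue]
  | cons g F ih =>
    have : substMono (g :: F) c f = Option.rec none (fun acc => forceNat (c / 32) fun c =>
      substMono F c acc) (powMulTerms g (c % 32) f) := rfl
    rw [this] at hh
    rcases h1 : powMulTerms g (c % 32) f with _ | acc
    · rw [h1] at hh; cases hh
    rw [h1] at hh
    simp only [forceNat_eq] at hh
    rw [ih hh, value_powMulTerms hn x h1]
    simp only [monoValue, List.length_cons, Fin.prod_univ_succ, Fin.val_succ,
      pow_succ', Nat.div_div_eq_div_mul]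
    simp
    ring

lemma value_substTerms (F : List Terms) {f h : Terms} (hh : substTerms F f = some h) :
    value x h = value (fun i => value x (F.get i)) f := by
  induction f generalizing h with
  | nil => cases hh; simp
  | cons y f ih =>
    have : substTerms F (y :: f) = Option.rec none (fun acc =>
      Option.rec none (fun h => forceTerms (addTerms acc h) some) (substMono F y.2 [(y.1, 0)]))
      (substTerms F f) := rfl
    rw [this] at hh
    rcases h1 : substTerms F f with _ | acc
    · rw [h1] at hh; cases hh
    rw [h1] at hh
    rcases h2 : substMono F y.2 [(y.1, 0)] with _ | h'
    · simp [h2] at hh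
    simp only [h2, forceTerms_eq, Option.some.injEq] at hh
    rw [← hh, value_filter, value_addTerms, ih h1, value_substMono hn x F h2, value_cons]
    simp [monoValue]
    ring

end

/-- The monomial with the given code. -/
def expo (n c : ℕ) : Fin n →₀ ℕ := Finsupp.equivFunOnFinite.symm fun i => c / 32 ^ (i : ℕ) % 32

@[simp] lemma expo_apply (n c : ℕ) (i : Fin n) : expo n c i = c / 32 ^ (i : ℕ) % 32 := rfl

lemma codeWeight_eq {n : ℕ} (w : Fin n → ℕ) (c : ℕ) :
    codeWeight (List.ofFn w) c = Finsupp.weight w (expo n c) := by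
  rw [Finsupp.weight_apply, Finsupp.sum_fintype _ _ (by simp)]
  induction n generalizing c with
  | zero => simp [codeWeight]
  | succ n ih =>
    rw [List.ofFn_succ, codeWeight, ih, Fin.sum_univ_succ]
    simp [pow_succ', Nat.div_div_eq_div_mul, mul_comm]

/-- The monomials not divisible by any element of a list. -/
def Avoids (L : List ℕ) (e : Fin 15 →₀ ℕ) : Prop := ∀ m ∈ L, ¬ expo 15 m ≤ e

end TermList

open MvPolynomial TermList

namespace GaussianMoment

/-- Polynomials in the fifteen moments. -/
abbrev MomentRing : Type := MvPolynomial (Fin 15) ℂ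

/-- Polynomials in the five moments of order one and two. -/
abbrev ParamRing : Type := MvPolynomial (Fin 5) ℂ

lemma monoValue_X {n : ℕ} (c : ℕ) :
    monoValue (X : Fin n → MvPolynomial (Fin n) ℂ) c = monomial (expo n c) 1 := by
  rw [monomial_eq, C_1, one_mul, Finsupp.prod_fintype _ _ (by simp)]
  rfl

/-- The polynomial with the given terms. -/
def poly (f : Terms) : MomentRing := value X f

lemma poly_cons (y : ℤ × ℕ) (f : Terms) :
    poly (y :: f) = monomial (expo 15 y.2) (y.1 : ℂ) + poly f := by
  rw [poly, value_cons, monoValue_X, ← map_intCast (C : ℂ →+* MomentRing), C_mul_monomial, mul_one]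
  rfl

/-- The fifteen moments of order at most four, in terms of those of order one and two. -/
def momentImage : Fin 15 → ParamRing := fun i => value X (momentTerms.get i)

/-- The parametrization of the moments of order at most four by those of order one and two. -/
def param : MomentRing →ₐ[ℂ] ParamRing := aeval momentImage

lemma map_value {S T : Type*} [CommRing S] [CommRing T] (φ : S →+* T) {n : ℕ} (x : Fin n → S)
    (f : Terms) : φ (value x f) = value (fun i => φ (x i)) f := by
  induction f with
  | nil => simp
  | cons y f ih => simp [ih, monoValue, map_prod]

lemma param_poly_eq_zero {f : Terms} (hf : f ∈ relations) : param (poly f) = 0 := by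
  have h := List.all_eq_true.1 substTerms_relations f hf
  rcases hs : substTerms momentTerms f with _ | g
  · rw [hs] at h; cases h
  rw [hs] at h
  rcases g with _ | ⟨y, g⟩
  · have h1 := value_substTerms (n := 5) (by norm_num) (X : Fin 5 → ParamRing) momentTerms hs
    have h2 := map_value (param : MomentRing →+* ParamRing) X f
    rw [value_nil] at h1
    refine h2.trans (Eq.trans ?_ h1.symm)
    congr 1
    funext i
    simp [param, momentImage]
  · cases h

/-- The weights of the moments: their orders. -/
def momentWeight : Fin 15 → ℕ := ![3, 2, 1, 3, 2, 3, 1, 2, 3, 4, 4, 4, 4, 4, 0]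

/-- The order on monomials used for the Gröbner basis. -/
def Low (e e' : Fin 15 →₀ ℕ) : Prop := ∃ k, e k < e' k ∧ ∀ j, k < j → e j = e' j

lemma Low.irrefl (e : Fin 15 →₀ ℕ) : ¬ Low e e := fun ⟨_, h, _⟩ => h.false

lemma Low.trans {e e' e'' : Fin 15 →₀ ℕ} (h : Low e e') (h' : Low e' e'') : Low e e'' := by
  obtain ⟨k, hk, h⟩ := h
  obtain ⟨k', hk', h'⟩ := h'
  rcases lt_trichotomy k k' with hlt | rfl | hlt
  · exact ⟨k', by rw [h k' hlt]; exact hk', fun j hj => (h j (hlt.trans hj)).trans (h' j hj)⟩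
  · exact ⟨k, hk.trans hk', fun j hj => (h j hj).trans (h' j hj)⟩
  · exact ⟨k, by rw [← h' k hlt]; exact hk, fun j hj => (h j hj).trans (h' j (hlt.trans hj))⟩

lemma Low.add {e e' : Fin 15 →₀ ℕ} (h : Low e e') (t : Fin 15 →₀ ℕ) : Low (e + t) (e' + t) := by
  obtain ⟨k, hk, h⟩ := h
  exact ⟨k, by simpa using hk, fun j hj => by simp [h j hj]⟩

/-- Numbers in base 32 are compared at the most significant digit in which they differ. Since a lead
has the smallest code, among monomials of one degree the order is the reverse lexicographic one. -/
lemma low_of_lt {c c' : ℕ} (h : c < c') (hc' : c' < 32 ^ 15) : Low (expo 15 c) (expo 15 c') := by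
  -- Peel off the lowest digit: either the higher parts already differ, or they agree and the lowest
  -- digit decides.
  have key : ∀ n c c', c < c' → c' < 32 ^ n → ∃ k < n, c / 32 ^ k % 32 < c' / 32 ^ k % 32 ∧
      ∀ j, k < j → j < n → c / 32 ^ j % 32 = c' / 32 ^ j % 32 := by
    intro n
    induction n with
    | zero => intro c c' h h'; simp at h'; omega
    | succ n ih =>
      intro c c' h h'
      have h2 : ∀ m j, m / 32 ^ (j + 1) = m / 32 / 32 ^ j := fun m j => by
        rw [Nat.div_div_eq_div_mul, pow_succ']
      rcases lt_or_ge (c / 32) (c' / 32) with h1 | h1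
      · obtain ⟨k, hk, h3, h4⟩ := ih _ _ h1 (by rw [pow_succ] at h'; omega)
        refine ⟨k + 1, by omega, by rwa [h2, h2], fun j hj hjn => ?_⟩
        obtain ⟨j, rfl⟩ : ∃ i, j = i + 1 := ⟨j - 1, by omega⟩
        rw [h2, h2]
        exact h4 j (by omega) (by omega)
      · have h3 : c / 32 = c' / 32 := le_antisymm (Nat.div_le_div_right h.le) h1
        refine ⟨0, by omega, by simp; omega, fun j hj hjn => ?_⟩
        obtain ⟨j, rfl⟩ : ∃ i, j = i + 1 := ⟨j - 1, by omega⟩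
        rw [h2, h2, h3]
  obtain ⟨k, hk, h1, h2⟩ := key 15 c c' h hc'
  exact ⟨⟨k, hk⟩, h1, fun j hj => h2 j hj j.2⟩

/-- The ideal generated by the explicit relations. -/
def relationIdeal : Ideal MomentRing := Ideal.span {g | ∃ f ∈ relations, g = poly f}

lemma poly_eq_of_hasLead {g : Terms} {m : ℕ} (h : hasLead g m = true) :
    ∃ (c : ℤ) (g' : Terms), c ≠ 0 ∧ poly g = monomial (expo 15 m) (c : ℂ) + poly g' ∧
      ∀ y ∈ g', Low (expo 15 m) (expo 15 y.2) ∧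
        Finsupp.weight (fun _ => 1) (expo 15 y.2) = Finsupp.weight (fun _ => 1) (expo 15 m) ∧
        Finsupp.weight momentWeight (expo 15 y.2) = Finsupp.weight momentWeight (expo 15 m) := by
  rcases g with _ | ⟨y, g⟩
  · simp [hasLead] at h
  simp only [hasLead, Bool.and_eq_true, forceNat_eq] at h
  obtain ⟨⟨⟨h1, h2⟩, h3⟩, h4⟩ := h
  have h1 : y.2 = m := by simpa using h1
  refine ⟨y.1, g, by simpa using h2, by rw [poly_cons, h1], ?_⟩
  have e1 := codeWeight_eq (n := 15) (fun _ => 1)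
  have e2 := codeWeight_eq momentWeight
  have e1' : List.ofFn (fun _ : Fin 15 => 1) = [1,1,1,1,1,1,1,1,1,1,1,1,1,1,1] := by rfl
  have e2' : List.ofFn momentWeight = [3, 2, 1, 3, 2, 3, 1, 2, 3, 4, 4, 4, 4, 4, 0] := by rfl
  rw [e1'] at e1
  rw [e2'] at e2
  rw [e1, e2] at h4
  clear h1 h2 h3
  induction g with
  | nil => simp
  | cons z g ih =>
    have : allAbove m (Finsupp.weight (fun _ => 1) (expo 15 m))
      (Finsupp.weight momentWeight (expo 15 m)) (z :: g) =
        and (Nat.blt m z.2) (and (Nat.blt z.2 (32 ^ 15))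
          (and (Nat.beq (codeWeight [1,1,1,1,1,1,1,1,1,1,1,1,1,1,1] z.2)
            (Finsupp.weight (fun _ => 1) (expo 15 m)))
          (and (Nat.beq (codeWeight [3, 2, 1, 3, 2, 3, 1, 2, 3, 4, 4, 4, 4, 4, 0] z.2)
            (Finsupp.weight momentWeight (expo 15 m)))
            (allAbove m (Finsupp.weight (fun _ => 1) (expo 15 m))
              (Finsupp.weight momentWeight (expo 15 m)) g)))) := rfl
    rw [this] at h4
    simp only [Bool.and_eq_true, e1, e2, Nat.blt_eq, Nat.beq_eq] at h4
    obtain ⟨h5, h6, h7, h8, h9⟩ := h4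
    intro y' hy'
    rcases List.mem_cons.1 hy' with rfl | hy'
    · exact ⟨low_of_lt h5 h6, h7, h8⟩
    · exact ih h9 y' hy'

end GaussianMoment

end

/-! ### Division with remainder by the Gröbner basis. -/

noncomputable section

open MvPolynomial TermList

namespace GaussianMoment

/-- The monomials that are not divisible by a leading monomial. -/
def IsStd (e : Fin 15 →₀ ℕ) : Prop := Avoids leadCodes e

/-- Two monomials of the same degree and weight. -/
def SameGrade (e e' : Fin 15 →₀ ℕ) : Prop :=
  Finsupp.weight (fun _ => 1) e = Finsupp.weight (fun _ => 1) e' ∧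
    Finsupp.weight momentWeight e = Finsupp.weight momentWeight e'

/-- Division replaces a monomial by ones that are larger for `Low`; it terminates because each
degree has finitely many monomials. -/
lemma wellFounded_low (d : ℕ) : WellFounded
    fun a b : {e : Fin 15 →₀ ℕ // Finsupp.weight (fun _ => 1) e = d} => Low b.1 a.1 := by
  have : Finite {e : Fin 15 →₀ ℕ // Finsupp.weight (fun _ => 1) e = d} := by
    refine Set.Finite.to_subtype ((Finsupp.finite_of_degree_le d).subset ?_)
    intro e he
    rw [Set.mem_ofPred_eq, Finsupp.degree_eq_weight_one]
    exact he.le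
  have : IsTrans {e : Fin 15 →₀ ℕ // Finsupp.weight (fun _ => 1) e = d}
    fun a b => Low b.1 a.1 := ⟨fun a b c h h' => h'.trans h⟩
  have : Std.Irrefl
    fun a b : {e : Fin 15 →₀ ℕ // Finsupp.weight (fun _ => 1) e = d} => Low b.1 a.1 :=
      ⟨fun a => Low.irrefl a.1⟩
  exact Finite.wellFounded_of_trans_of_irrefl _

lemma poly_mem_relationIdeal {f : Terms} (hf : f ∈ relations) : poly f ∈ relationIdeal :=
  Ideal.subset_span ⟨f, hf, rfl⟩

/-- Gröbner division of a single monomial. The divisors are homogeneous for degree and weight, so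
the remainder inherits both. -/
lemma exists_std_of_monomial (e : Fin 15 →₀ ℕ) : ∃ p : MomentRing,
    monomial e 1 - p ∈ relationIdeal ∧ ∀ e' ∈ p.support, IsStd e' ∧ SameGrade e' e := by
  obtain ⟨d, hd⟩ : ∃ d, Finsupp.weight (fun _ => 1) e = d := ⟨_, rfl⟩
  suffices h : ∀ e : {e : Fin 15 →₀ ℕ // Finsupp.weight (fun _ => 1) e = d}, ∃ p : MomentRing,
      monomial e.1 1 - p ∈ relationIdeal ∧ ∀ e' ∈ p.support, IsStd e' ∧ SameGrade e' e.1 from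
    h ⟨e, hd⟩
  clear hd e
  intro e
  induction e using (wellFounded_low d).induction with
  | _ e ih =>
  by_cases hs : IsStd e.1
  · exact ⟨monomial e.1 1, by simp, fun e' he' => by
      obtain rfl : e' = e.1 := by simpa [eq_comm] using support_monomial_subset he'
      exact ⟨hs, rfl, rfl⟩⟩
  · simp only [IsStd, Avoids, not_forall, not_not] at hs
    obtain ⟨m, hm, hle⟩ := hs
    obtain ⟨t, ht⟩ := exists_add_of_le hle
    obtain ⟨g, hg, hl⟩ := exists_hasLead X relationIdeal (fun f => poly_mem_relationIdeal) hm
    obtain ⟨c, g', hc, hg', hlow⟩ := poly_eq_of_hasLead hl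
    -- Each monomial of the tail of `g`, multiplied by `t`, lies beyond `e` for `Low`, so the
    -- induction hypothesis reduces it.
    have key : ∃ p : MomentRing, monomial t 1 * poly g' - p ∈ relationIdeal ∧
        ∀ e' ∈ p.support, IsStd e' ∧ SameGrade e' e.1 := by
      clear hl hg' hg
      induction g' with
      | nil => exact ⟨0, by simp [poly], by simp⟩
      | cons y g' ihg =>
        obtain ⟨p, hp, hp'⟩ := ihg fun z hz => hlow z (by simp [hz])
        obtain ⟨h1, h2, h3⟩ := hlow y (by simp)
        have h4 : SameGrade (t + expo 15 y.2) e.1 := by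
          rw [SameGrade, ht, map_add, map_add, map_add, map_add, h2, h3]
          exact ⟨add_comm _ _, add_comm _ _⟩
        obtain ⟨q, hq, hq'⟩ := ih ⟨t + expo 15 y.2, h4.1.trans e.2⟩ (by
          have := h1.add t
          rwa [add_comm _ t, add_comm _ t, add_comm t (expo 15 m), ← ht] at this)
        refine ⟨C (y.1 : ℂ) * q + p, ?_, ?_⟩
        · have := relationIdeal.add_mem (relationIdeal.mul_mem_left (C (y.1 : ℂ)) hq) hp
          convert this using 1
          rw [poly_cons, mul_add, monomial_mul, one_mul, mul_sub, C_mul_monomial, mul_one]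
          ring
        · intro e' he'
          rcases Finset.mem_union.1 (support_add he') with h | h
          · rw [C_mul'] at h
            obtain ⟨h5, h6, h7⟩ := hq' e' (support_smul h)
            exact ⟨h5, h6.trans h4.1, h7.trans h4.2⟩
          · exact hp' e' h
    obtain ⟨p, hp, hp'⟩ := key
    have hc' : (c : ℂ) ≠ 0 := by exact_mod_cast hc
    -- Modulo the ideal, `c` times the monomial `e = t + m` is minus `t` times the tail of `g`,
    -- hence minus `p`.
    refine ⟨C (-(c : ℂ)⁻¹) * p, ?_, fun e' he' => ?_⟩
    · have h1 := relationIdeal.mul_mem_left (C (c : ℂ)⁻¹) (relationIdeal.sub_mem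
        (relationIdeal.mul_mem_left (monomial t 1) (show poly g ∈ relationIdeal from hg)) hp)
      convert h1 using 1
      have h2 : (monomial e.1 1 : MomentRing) =
          C (c : ℂ)⁻¹ * (monomial t 1 * monomial (expo 15 m) (c : ℂ)) := by
        rw [monomial_mul, C_mul_monomial, one_mul, inv_mul_cancel₀ hc', add_comm t, ← ht]
      rw [hg', h2, map_neg]
      ring
    · rw [C_mul'] at he'
      exact hp' e' (support_smul he')

lemma exists_std (f : MomentRing) : ∃ p : MomentRing, f - p ∈ relationIdeal ∧
    ∀ e' ∈ p.support, IsStd e' ∧ ∃ e ∈ f.support, SameGrade e' e := by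
  choose p hp hp' using exists_std_of_monomial
  refine ⟨∑ e ∈ f.support, C (coeff e f) * p e, ?_, ?_⟩
  · have h : f - ∑ e ∈ f.support, C (coeff e f) * p e =
        ∑ e ∈ f.support, (monomial e (coeff e f) - C (coeff e f) * p e) := by
      rw [Finset.sum_sub_distrib, ← f.as_sum]
    rw [h]
    refine Ideal.sum_mem _ fun e _ => ?_
    have := relationIdeal.mul_mem_left (C (coeff e f)) (hp e)
    rwa [mul_sub, C_mul_monomial, mul_one] at this
  · intro e' he'
    classical
    obtain ⟨e, he, h⟩ := Finset.mem_biUnion.1 (support_sum he')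
    rw [C_mul'] at h
    have := hp' e e' (support_smul h)
    exact ⟨this.1, e, he, this.2⟩

end GaussianMoment

end

noncomputable section

/-! ### Hilbert series of monomial ideals -/

namespace TermList

/-- The digitwise truncated difference of two codes with `n` digits. -/
def codeSub (n : ℕ) : ℕ → ℕ → ℕ :=
  Nat.rec (fun _ _ => 0) (fun _ ih a b =>
    Nat.add (Nat.sub (Nat.mod a 32) (Nat.mod b 32)) (Nat.mul 32 (ih (Nat.div a 32) (Nat.div b 32)))) n

/-- Whether the monomial with code `a` divides the one with code `b`. -/
def codeDvd (a b : ℕ) : Bool := cond (isSmall a) (cond (Nat.ble a b) (isSmall (Nat.sub b a)) false) false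

/-- Whether some element of the list divides the monomial with code `c`. -/
def anyDvd (c : ℕ) (L : List ℕ) : Bool :=
  List.rec false (fun b _ ih => cond (codeDvd b c) true ih) L

/-- `f (L' ++ acc)`, where `L'` is a reversed sublist of `L` that generates the same monomial ideal
together with `acc`. -/
def pruneAux {α : Type} (f : List ℕ → α) (L : List ℕ) : List ℕ → α :=
  List.rec (motive := fun _ => List ℕ → α) f
    (fun c _ ih acc => cond (anyDvd c acc) (ih acc) (forceNat c fun c => ih (c :: acc))) L

/-- `f` applied to the quotients of the elements of `L` by the monomial `m`, and `acc`. -/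
def colonAux {α : Type} (m : ℕ) (f : List ℕ → α) (L : List ℕ) : List ℕ → α :=
  List.rec (motive := fun _ => List ℕ → α) f
    (fun c _ ih acc => forceNat (codeSub 15 c m) fun c => ih (c :: acc)) L

/-- Equality of lists of numbers. -/
def listBeq (L : List ℕ) : List ℕ → Bool :=
  List.rec (motive := fun _ => List ℕ → Bool)
    (fun L' => List.rec true (fun _ _ _ => false) L')
    (fun a _ ih L' => List.rec false (fun b L' _ => cond (Nat.beq a b) (ih L') false) L') L

/-- The difference of `f` and a shift of `g` by the weight of the monomial `m`. -/
def subShift (w : List ℕ) (m : ℕ) (f : Terms) (g : Option Terms) : Option Terms :=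
  Option.rec none (fun g => forceTerms g fun g => forceNat (codeWeight w m) fun k =>
    some (mergeAux 1 (-1) k f g []).reverse) g

/-- The numerator of the Hilbert series of a monomial ideal, for the given weights of the variables;
the second argument bounds the depth of the recursion. The codes of its terms are their exponents. -/
def hilbertNumerator (w : List ℕ) (n : ℕ) : List ℕ → Option Terms :=
  Nat.rec (motive := fun _ => List ℕ → Option Terms) (fun _ => none) (fun _ rec L =>
    List.rec (some [(1, 0)]) (fun m L ih =>
      Option.rec none (fun f =>
        forceTerms f fun f => colonAux m (pruneAux (pruneAux (fun L' =>
          -- The numerator for `m :: L` is that for `L` minus the one for the colon ideal `L : m`,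
          -- shifted by the weight of `m`. The colon ideal is pruned in both directions to reach
          -- minimal generators; if this returns `L` itself, the numerator is already known.
          subShift w m f (cond (listBeq L L') (some f) (rec L'))) · []) · []) L []) ih) L) n

/-- The leading monomials, those of large degree first. -/
def sortedLeadCodes : List ℕ := leadCodes.take 107 ++ (leadCodes.drop 107).reverse

/-- The numerator of the Hilbert series of the ideal generated by the leading monomials. -/
def leadNumerator (w : List ℕ) : Option Terms :=
  pruneAux (hilbertNumerator w 40) sortedLeadCodes.reverse []

/-- This is (1 - t)^9 times the numerator of the final Hilbert series. -/
theorem leadNumerator_degree : leadNumerator [1, 1, 1, 1, 1, 1, 1, 1, 1, 1, 1, 1, 1, 1, 1] =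
    some [(1, 0), (-99, 3), (369, 4), (-140, 5), (-2021, 6), (6178, 7), (-9670, 8), (9869, 9),
      (-7266, 10), (4209, 11), (-2079, 12), (894, 13), (-313, 14), (80, 15), (-13, 16), (1, 17)] := by
  decide +kernel

/-- This is (1 - t^3)^4 (1 - t^4)^5, with one factor for each moment of order three or four, the
moments that are polynomials in the lower ones. The constant moment has weight 1 instead of 0 so
that each weight has finitely many monomials. -/
theorem leadNumerator_weight : leadNumerator [3, 2, 1, 3, 2, 3, 1, 2, 3, 4, 4, 4, 4, 4, 1] =
    some [(1, 0), (-4, 3), (-5, 4), (6, 6), (20, 7), (10, 8), (-4, 9), (-30, 10), (-40, 11), (-9, 12), (20, 13),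
      (60, 14), (40, 15), (-40, 17), (-60, 18), (-20, 19), (9, 20), (40, 21), (30, 22), (4, 23), (-10, 24),
      (-20, 25), (-6, 26), (5, 28), (4, 29), (-1, 32)] := by
  decide +kernel

end TermList

end

/-! ### Counting monomials outside a monomial ideal. -/

noncomputable section

open PowerSeries TermList

/-- The number of monomials of each weight that have the property `A`, as a power series. -/
def countingSeries {n : ℕ} (v : Fin n → ℕ) (A : (Fin n →₀ ℕ) → Prop) : ℤ⟦X⟧ :=
  PowerSeries.mk fun d => (Nat.card {e // A e ∧ Finsupp.weight v e = d} : ℤ)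

section

variable {n : ℕ} {v : Fin n → ℕ} (hv : ∀ i, v i ≠ 0)
include hv

lemma finite_weight_eq (A : (Fin n →₀ ℕ) → Prop) (d : ℕ) :
    Finite {e : Fin n →₀ ℕ // A e ∧ Finsupp.weight v e = d} :=
  ((Finsupp.finite_of_nat_weight_eq v hv d).subset fun _ he => he.2).to_subtype

/-- A monomial divisible by `m` is uniquely `m` times another one. For monomial ideals this is the
exact sequence of multiplication by `m`. -/
lemma countingSeries_split (A : (Fin n →₀ ℕ) → Prop) (m : Fin n →₀ ℕ) :
    countingSeries v A = countingSeries v (fun e => A e ∧ ¬ m ≤ e) +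
      X ^ Finsupp.weight v m * countingSeries v (fun e => A (e + m)) := by
  ext d
  have := fun A => finite_weight_eq hv A d
  simp only [countingSeries, coeff_mk, map_add, coeff_X_pow_mul']
  have h1 : Nat.card {e // A e ∧ Finsupp.weight v e = d} =
      Nat.card {e // (A e ∧ ¬ m ≤ e) ∧ Finsupp.weight v e = d} +
      Nat.card {e // (A e ∧ m ≤ e) ∧ Finsupp.weight v e = d} := by
    classical
    rw [← Nat.card_sum]
    refine Nat.card_congr (Equiv.trans ?_ (Equiv.sumComm _ _))
    refine ((Equiv.sumCompl fun e : {e // A e ∧ Finsupp.weight v e = d} => m ≤ e.1).symm.trans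
      (Equiv.sumCongr ?_ ?_))
    · exact (Equiv.subtypeSubtypeEquivSubtypeInter _ fun e => m ≤ e).trans
        (Equiv.subtypeEquivRight fun e => by tauto)
    · exact (Equiv.subtypeSubtypeEquivSubtypeInter _ fun e => ¬ m ≤ e).trans
        (Equiv.subtypeEquivRight fun e => by tauto)
  rw [h1]
  push_cast
  congr 1
  split_ifs with hd
  · norm_cast
    refine Nat.card_congr ⟨fun e => ⟨e.1 - m, ?_, ?_⟩, fun e => ⟨e.1 + m, ⟨e.2.1, ?_⟩, ?_⟩, ?_, ?_⟩
    · rw [tsub_add_cancel_of_le e.2.1.2]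
      exact e.2.1.1
    · have := e.2.2
      rw [← tsub_add_cancel_of_le e.2.1.2, map_add] at this
      omega
    · exact le_add_self
    · rw [map_add, e.2.2]
      omega
    · intro e
      exact Subtype.ext (tsub_add_cancel_of_le e.2.1.2)
    · intro e
      exact Subtype.ext (add_tsub_cancel_right e.1 m)
  · norm_cast
    have : IsEmpty {e // (A e ∧ m ≤ e) ∧ Finsupp.weight v e = d} := by
      refine ⟨fun e => hd ?_⟩
      have := e.2.2
      rw [← tsub_add_cancel_of_le e.2.1.2, map_add] at this
      omega
    simp

/-- The Hilbert series of a polynomial ring. -/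
lemma countingSeries_true : countingSeries v (fun _ => True) * ∏ i, (1 - X ^ v i) = 1 := by
  -- Forbid the variables one at a time. Each costs a factor `1 - X ^ v i`, and in the end only the
  -- monomial 1 is left.
  have key : ∀ s : Finset (Fin n), countingSeries v (fun e => ∀ i ∈ s, e i = 0) =
      countingSeries v (fun _ => True) * ∏ i ∈ s, (1 - X ^ v i) := by
    intro s
    induction s using Finset.induction_on with
    | empty => simp
    | insert i s hi ih =>
      have h := countingSeries_split hv (fun e => ∀ i ∈ s, e i = 0) (Finsupp.single i 1)
      have h1 : (fun e : Fin n →₀ ℕ => ∀ j ∈ s, (e + Finsupp.single i 1 : Fin n →₀ ℕ) j = 0) =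
          fun e => ∀ j ∈ s, e j = 0 := by
        funext e
        refine propext (forall₂_congr fun j hj => ?_)
        have : i ≠ j := fun h => hi (h ▸ hj)
        simp [this]
      have h2 : (fun e : Fin n →₀ ℕ => (∀ j ∈ s, e j = 0) ∧ ¬ Finsupp.single i 1 ≤ e) =
          fun e => ∀ j ∈ insert i s, e j = 0 := by
        funext e
        simp [Finsupp.single_le_iff, and_comm, Nat.one_le_iff_ne_zero]
      rw [h1, h2, ih] at h
      rw [Finset.prod_insert hi]
      have h3 : Finsupp.weight v (Finsupp.single i 1) = v i := by simp [Finsupp.weight_single]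
      rw [h3] at h
      linear_combination -h
  rw [← key]
  ext d
  simp only [countingSeries, coeff_mk, Finset.mem_univ, true_implies, coeff_one]
  split_ifs with hd
  · subst hd
    norm_cast
    rw [Nat.card_eq_one_iff_unique]
    exact ⟨⟨fun a b => Subtype.ext (Finsupp.ext fun i => by rw [a.2.1, b.2.1])⟩, ⟨⟨0, by simp⟩⟩⟩
  · norm_cast
    have : IsEmpty {e : Fin n →₀ ℕ // (∀ i, e i = 0) ∧ Finsupp.weight v e = d} := by
      refine ⟨fun e => hd ?_⟩
      have : e.1 = 0 := Finsupp.ext e.2.1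
      rw [← e.2.2, this, map_zero]
    simp

end

namespace TermList

lemma codeSub_digit {n i : ℕ} (hi : i < n) (a b : ℕ) :
    codeSub n a b / 32 ^ i % 32 = a / 32 ^ i % 32 - b / 32 ^ i % 32 := by
  induction n generalizing i a b with
  | zero => omega
  | succ n ih =>
    have h : codeSub (n + 1) a b = (a % 32 - b % 32) + 32 * codeSub n (a / 32) (b / 32) := rfl
    have h1 : a % 32 - b % 32 < 32 := by omega
    rcases i with _ | i
    · rw [h]
      simp only [pow_zero, Nat.div_one]
      omega
    · rw [pow_succ', ← Nat.div_div_eq_div_mul, ← Nat.div_div_eq_div_mul, ← Nat.div_div_eq_div_mul,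
        h, show (a % 32 - b % 32 + 32 * codeSub n (a / 32) (b / 32)) / 32 =
          codeSub n (a / 32) (b / 32) by omega]
      exact ih (by omega) _ _

lemma expo_codeSub (a b : ℕ) : expo 15 (codeSub 15 a b) = expo 15 a - expo 15 b := by
  ext i
  simpa using codeSub_digit i.2 a b

lemma expo_le_of_codeDvd {a b : ℕ} (h : codeDvd a b = true) : expo 15 a ≤ expo 15 b := by
  rw [codeDvd] at h
  rcases h1 : isSmall a with _ | _
  · simp [h1] at h
  rcases h2 : Nat.ble a b with _ | _
  · simp [h2] at h
  have h3 : isSmall (b - a) = true := by simpa [h1, h2] using h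
  intro i
  have h4 := digit_add h1 h3 i.2
  rw [Nat.add_sub_cancel' (Nat.le_of_ble_eq_true h2)] at h4
  simp [h4]

lemma exists_of_anyDvd {c : ℕ} {L : List ℕ} (h : anyDvd c L = true) :
    ∃ b ∈ L, expo 15 b ≤ expo 15 c := by
  induction L with
  | nil => cases h
  | cons b L ih =>
    have : anyDvd c (b :: L) = cond (codeDvd b c) true (anyDvd c L) := rfl
    rw [this] at h
    rcases h1 : codeDvd b c with _ | _
    · rw [h1] at h
      obtain ⟨b', hb', h'⟩ := ih h
      exact ⟨b', by simp [hb'], h'⟩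
    · exact ⟨b, by simp, expo_le_of_codeDvd h1⟩

/-- A discarded code is a multiple of one already kept, so the monomial ideal does not change. -/
lemma exists_pruneAux {α : Type} (f : List ℕ → α) (L acc : List ℕ) :
    ∃ L', pruneAux f L acc = f L' ∧ ∀ e, Avoids L' e ↔ Avoids L e ∧ Avoids acc e := by
  induction L generalizing acc with
  | nil => exact ⟨acc, rfl, fun e => by simp [Avoids]⟩
  | cons c L ih =>
    have h : pruneAux f (c :: L) acc =
      cond (anyDvd c acc) (pruneAux f L acc) (forceNat c fun c => pruneAux f L (c :: acc)) := rfl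
    rcases h1 : anyDvd c acc with _ | _
    · obtain ⟨L', h2, h3⟩ := ih (c :: acc)
      refine ⟨L', by rw [h, h1, forceNat_eq]; exact h2, fun e => ?_⟩
      rw [h3]
      simp only [Avoids, List.forall_mem_cons]
      tauto
    · obtain ⟨L', h2, h3⟩ := ih acc
      refine ⟨L', by rw [h, h1]; exact h2, fun e => ?_⟩
      rw [h3]
      obtain ⟨b, hb, hbc⟩ := exists_of_anyDvd h1
      simp only [Avoids, List.forall_mem_cons]
      exact ⟨fun h => ⟨⟨fun hc => h.2 b hb (hbc.trans hc), h.1⟩, h.2⟩, fun h => ⟨h.1.2, h.2⟩⟩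

lemma colonAux_eq {α : Type} (m : ℕ) (f : List ℕ → α) (L acc : List ℕ) :
    colonAux m f L acc = f ((L.map fun c => codeSub 15 c m).reverse ++ acc) := by
  induction L generalizing acc with
  | nil => rfl
  | cons c L ih =>
    have h : colonAux m f (c :: L) acc =
      forceNat (codeSub 15 c m) fun c => colonAux m f L (c :: acc) := rfl
    rw [h, forceNat_eq, ih]
    simp

lemma eq_of_listBeq {L L' : List ℕ} (h : listBeq L L' = true) : L = L' := by
  induction L generalizing L' with
  | nil =>
    rcases L' with _ | ⟨b, L'⟩
    · rfl
    · cases h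
  | cons a L ih =>
    rcases L' with _ | ⟨b, L'⟩
    · cases h
    · have h1 : listBeq (a :: L) (b :: L') = cond (Nat.beq a b) (listBeq L L') false := rfl
      rw [h1] at h
      rcases h2 : Nat.beq a b with _ | _
      · rw [h2] at h; cases h
      · rw [h2] at h
        rw [ih h, Nat.eq_of_beq_eq_true h2]

/-- The truncated difference of `c` and `m` divides `e` exactly when `c` divides `e + m`; this
describes the colon ideal. -/
lemma avoids_add (L : List ℕ) (m : ℕ) (e : Fin 15 →₀ ℕ) :
    Avoids (L.map fun c => codeSub 15 c m) e ↔ Avoids L (e + expo 15 m) := by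
  simp [Avoids, expo_codeSub, tsub_le_iff_right]

lemma countingSeries_congr {n : ℕ} (v : Fin n → ℕ) {A B : (Fin n →₀ ℕ) → Prop}
    (h : ∀ e, A e ↔ B e) : countingSeries v A = countingSeries v B := by
  rw [show A = B from funext fun e => propext (h e)]

/-- Each step of the recursion is `countingSeries_split` at the first generator `m`; the multiples
of `m` are counted by the colon ideal. -/
lemma countingSeries_avoids {v : Fin 15 → ℕ} (hv : ∀ i, v i ≠ 0) {k : ℕ} {L : List ℕ} {f : Terms}
    (hf : hilbertNumerator (List.ofFn v) k L = some f) :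
    countingSeries v (Avoids L) * ∏ i, (1 - X ^ v i) = termSum (fun i => X ^ i) f := by
  induction k generalizing L f with
  | zero => cases hf
  | succ k ihk =>
    induction L generalizing f with
    | nil =>
      cases hf
      rw [countingSeries_congr v (B := fun _ => True) (by simp [Avoids]), countingSeries_true hv]
      simp
    | cons m L ihL =>
      have h : hilbertNumerator (List.ofFn v) (k + 1) (m :: L) = Option.rec none (fun f =>
        forceTerms f fun f => colonAux m (pruneAux (pruneAux (fun L' =>
          subShift (List.ofFn v) m f
            (cond (listBeq L L') (some f) (hilbertNumerator (List.ofFn v) k L'))) · []) · []) L [])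
        (hilbertNumerator (List.ofFn v) (k + 1) L) := rfl
      rw [h] at hf
      clear h
      rcases h1 : hilbertNumerator (List.ofFn v) (k + 1) L with _ | f1
      · rw [h1] at hf; cases hf
      rw [h1] at hf
      have hf1 := ihL h1
      simp only [forceTerms_eq, colonAux_eq] at hf
      obtain ⟨L1, h2, h3⟩ := exists_pruneAux (pruneAux (fun L' =>
          subShift (List.ofFn v) m (f1.filter fun x => x.1 ≠ 0)
            (cond (listBeq L L') (some (f1.filter fun x => x.1 ≠ 0))
              (hilbertNumerator (List.ofFn v) k L'))) · [])
        ((L.map fun c => codeSub 15 c m).reverse ++ []) []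
      obtain ⟨L2, h4, h5⟩ := exists_pruneAux (fun L' =>
          subShift (List.ofFn v) m (f1.filter fun x => x.1 ≠ 0)
            (cond (listBeq L L') (some (f1.filter fun x => x.1 ≠ 0))
              (hilbertNumerator (List.ofFn v) k L'))) L1 []
      rw [h2, h4] at hf
      have h6 : ∀ e, Avoids L2 e ↔ Avoids L (e + expo 15 m) := fun e => by
        rw [h5, h3, ← avoids_add]
        simp [Avoids]
      rcases h7 : cond (listBeq L L2) (some (f1.filter fun x => x.1 ≠ 0))
        (hilbertNumerator (List.ofFn v) k L2) with _ | g
      · rw [h7] at hf; cases hf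
      rw [h7] at hf
      simp only [subShift, forceTerms_eq, forceNat_eq, Option.some.injEq] at hf
      have hg : countingSeries v (Avoids L2) * ∏ i, (1 - X ^ v i) =
          termSum (fun i => X ^ i) g := by
        rcases h8 : listBeq L L2 with _ | _
        · rw [h8] at h7
          exact ihk h7
        · rw [h8] at h7
          simp only [cond_true, Option.some.injEq] at h7
          rw [← h7, termSum_filter, ← eq_of_listBeq h8, hf1]
      have h9 := countingSeries_split hv (Avoids L) (expo 15 m)
      rw [countingSeries_congr v (fun e => (h6 e).symm),
        countingSeries_congr v (A := fun e => Avoids L e ∧ ¬ expo 15 m ≤ e)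
          (B := Avoids (m :: L)) (fun e => by
          simp only [Avoids, List.forall_mem_cons]; tauto)] at h9
      have h10 : termSum (fun i => X ^ i)
          ((g.filter fun x => x.1 ≠ 0).map fun y => (y.1, y.2 + Finsupp.weight v (expo 15 m))) =
          X ^ Finsupp.weight v (expo 15 m) * termSum (fun i => (X : ℤ⟦X⟧) ^ i) g := by
        rw [← termSum_filter (fun i => (X : ℤ⟦X⟧) ^ i) g]
        generalize g.filter (fun x => x.1 ≠ 0) = g
        induction g with
        | nil => simp
        | cons y g ih =>
          rw [List.map_cons, termSum_cons, termSum_cons, ih]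
          ring
      rw [← hf, termSum_reverse, termSum_mergeAux, codeWeight_eq, h10, termSum_filter, ← hf1, ← hg]
      push_cast
      rw [h9, termSum_nil]
      ring

lemma avoids_of_leadNumerator {v : Fin 15 → ℕ} (hv : ∀ i, v i ≠ 0) {f : Terms}
    (h : leadNumerator (List.ofFn v) = some f) :
    countingSeries v (Avoids leadCodes) * ∏ i, (1 - X ^ v i) = termSum (fun i => X ^ i) f := by
  obtain ⟨L, h1, h2⟩ :=
    exists_pruneAux (hilbertNumerator (List.ofFn v) 40) sortedLeadCodes.reverse []
  rw [leadNumerator, h1] at h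
  rw [← countingSeries_avoids hv h]
  refine congrArg (· * ∏ i, (1 - X ^ v i)) (countingSeries_congr v fun e => ?_)
  have key : ∀ L : List ℕ,
      Avoids L e ↔ Avoids (L.take 107 ++ (L.drop 107).reverse).reverse e := fun L => by
    have h : ∀ m, m ∈ L ↔ m ∈ L.take 107 ∨ m ∈ L.drop 107 := fun m => by
      rw [← List.mem_append, List.take_append_drop]
    simp [Avoids, h, or_comm]
  rw [h2, key leadCodes, sortedLeadCodes]
  generalize (leadCodes.take 107 ++ (leadCodes.drop 107).reverse).reverse = L
  simp [Avoids]

end TermList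

end

/-! ### The standard monomials counted by weight and by degree. -/

noncomputable section

open PowerSeries TermList

namespace GaussianMoment

/-- The weights of the moments of order one and two. -/
def paramWeight : Fin 5 → ℕ := ![1, 1, 2, 2, 2]

lemma leadCodes_digit : ∀ m ∈ leadCodes, m / 32 ^ 14 % 32 = 0 := by decide +kernel

/-- No leading monomial involves the constant moment, so its exponent is free. -/
lemma isStd_add_single (e : Fin 15 →₀ ℕ) (k : ℕ) :
    IsStd (e + Finsupp.single 14 k) ↔ IsStd e := by
  refine forall₂_congr fun m hm => not_congr ?_
  refine forall_congr' fun i => ?_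
  by_cases hi : i = 14
  · subst hi
    rw [expo_apply, show m / 32 ^ ((14 : Fin 15) : ℕ) % 32 = 0 from leadCodes_digit m hm]
    simp
  · simp [Ne.symm hi]

/-- The weights of the moments, except that the constant moment has weight one. -/
def positiveWeight : Fin 15 → ℕ := ![3, 2, 1, 3, 2, 3, 1, 2, 3, 4, 4, 4, 4, 4, 1]

lemma positiveWeight_ne_zero (i : Fin 15) : positiveWeight i ≠ 0 := by
  revert i; decide

lemma paramWeight_ne_zero (i : Fin 5) : paramWeight i ≠ 0 := by
  revert i; decide

lemma one_sub_X_pow_ne_zero {k : ℕ} (hk : k ≠ 0) : (1 - X ^ k : ℤ⟦X⟧) ≠ 0 := fun h => by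
  simpa [hk] using congrArg (PowerSeries.constantCoeff (R := ℤ)) h

/-- The numerical coincidence on which the proof rests. The factors for the moments of order three
and four cancel against the numerator, and a free constant moment accounts for one factor 1/(1 - X);
what remains is the series of a polynomial ring with two generators of weight 1 and three of weight
2. -/
lemma countingSeries_isStd_eq :
    countingSeries positiveWeight (fun e => IsStd e ∧ e 14 = 0) =
      countingSeries paramWeight fun _ => True := by
  have h1 := countingSeries_split positiveWeight_ne_zero IsStd (Finsupp.single 14 1)
  have h2 : Finsupp.weight positiveWeight (Finsupp.single 14 1) = 1 := by
    simp [Finsupp.weight_single, positiveWeight]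
  rw [h2, countingSeries_congr positiveWeight (A := fun e => IsStd (e + Finsupp.single 14 1))
    (fun e => isStd_add_single e 1), countingSeries_congr positiveWeight
    (A := fun e => IsStd e ∧ ¬ Finsupp.single 14 1 ≤ e) (B := fun e => IsStd e ∧ e 14 = 0)
    (fun e => by simp [Finsupp.single_le_iff, Nat.one_le_iff_ne_zero])] at h1
  have h3 := avoids_of_leadNumerator positiveWeight_ne_zero leadNumerator_weight
  have h4 := countingSeries_true paramWeight_ne_zero
  have h5 : ∏ i, (1 - (X : ℤ⟦X⟧) ^ positiveWeight i) =
      (1 - X) ^ 3 * (1 - X ^ 2) ^ 3 * (1 - X ^ 3) ^ 4 * (1 - X ^ 4) ^ 5 := by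
    simp [Fin.prod_univ_succ, positiveWeight]
    ring
  have h6 : ∏ i, (1 - (X : ℤ⟦X⟧) ^ paramWeight i) = (1 - X) ^ 2 * (1 - X ^ 2) ^ 3 := by
    simp [Fin.prod_univ_succ, paramWeight]
    ring
  have h7 : termSum (fun i => X ^ i) [(1, 0), (-4, 3), (-5, 4), (6, 6), (20, 7), (10, 8), (-4, 9), (-30, 10), (-40, 11), (-9, 12), (20, 13),
      (60, 14), (40, 15), (-40, 17), (-60, 18), (-20, 19), (9, 20), (40, 21), (30, 22), (4, 23), (-10, 24),
      (-20, 25), (-6, 26), (5, 28), (4, 29), (-1, 32)] =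
      ((1 - X ^ 3) ^ 4 * (1 - X ^ 4) ^ 5 : ℤ⟦X⟧) := by
    simp only [termSum_cons, termSum_nil]
    push_cast
    ring
  rw [h5, h7] at h3
  rw [h6] at h4
  change countingSeries positiveWeight IsStd * _ = _ at h3
  have h8 : ((1 - X) ^ 2 * (1 - X ^ 2) ^ 3 * ((1 - X ^ 3) ^ 4 * (1 - X ^ 4) ^ 5) : ℤ⟦X⟧) ≠ 0 := by
    have a1 := one_sub_X_pow_ne_zero one_ne_zero
    have a2 := one_sub_X_pow_ne_zero two_ne_zero
    have a3 := one_sub_X_pow_ne_zero three_ne_zero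
    have a4 := one_sub_X_pow_ne_zero four_ne_zero
    rw [pow_one] at a1
    exact mul_ne_zero (mul_ne_zero (pow_ne_zero _ a1) (pow_ne_zero _ a2))
      (mul_ne_zero (pow_ne_zero _ a3) (pow_ne_zero _ a4))
  refine mul_right_cancel₀ h8 ?_
  linear_combination h3 - (1 - X ^ 3) ^ 4 * (1 - X ^ 4) ^ 5 * h4 -
    ((1 - X) ^ 2 * (1 - X ^ 2) ^ 3 * ((1 - X ^ 3) ^ 4 * (1 - X ^ 4) ^ 5)) * h1

lemma countingSeries_isStd_degree :
    countingSeries (fun _ => 1) IsStd * (1 - X) ^ 6 =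
      (1 + 9 * X + 45 * X ^ 2 + 66 * X ^ 3 - 27 * X ^ 4 + 13 * X ^ 5 - 8 * X ^ 6 + 4 * X ^ 7
        - X ^ 8 : ℤ⟦X⟧) := by
  have h3 := avoids_of_leadNumerator (v := fun _ => 1) (by simp) leadNumerator_degree
  simp only [Finset.prod_const, Finset.card_univ, Fintype.card_fin, pow_one, termSum_cons,
    termSum_nil] at h3
  have a1 := one_sub_X_pow_ne_zero one_ne_zero
  rw [pow_one] at a1
  -- The fifteen variables give fifteen factors `1 - X`; nine of them cancel.
  refine mul_right_cancel₀ (pow_ne_zero 9 a1) ?_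
  change countingSeries _ IsStd * _ = _ at h3
  rw [mul_assoc, ← pow_add, h3]
  push_cast
  ring

/-- The standard monomials that do not involve the constant moment. -/
abbrev AffineStd : Type := {e : Fin 15 →₀ ℕ // IsStd e ∧ e 14 = 0}

lemma weight_eq_of_apply_eq_zero {e : Fin 15 →₀ ℕ} (he : e 14 = 0) :
    Finsupp.weight positiveWeight e = Finsupp.weight momentWeight e := by
  rw [Finsupp.weight_apply, Finsupp.weight_apply, Finsupp.sum_fintype _ _ (by simp),
    Finsupp.sum_fintype _ _ (by simp)]
  refine Finset.sum_congr rfl fun i _ => ?_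
  by_cases h : i = 14
  · simp [h, he]
  · have : positiveWeight i = momentWeight i := by
      revert i; decide
    rw [this]

/-- Equal finite counts give a bijection in each weight; these are glued over all weights. -/
lemma exists_equiv_affineStd : ∃ Φ : AffineStd ≃ (Fin 5 →₀ ℕ), ∀ e,
    Finsupp.weight paramWeight (Φ e) = Finsupp.weight momentWeight e.1 := by
  have h : ∀ w, Nonempty ({e : AffineStd // Finsupp.weight momentWeight e.1 = w} ≃
      {e : Fin 5 →₀ ℕ // Finsupp.weight paramWeight e = w}) := by
    intro w
    have h1 := congrArg (PowerSeries.coeff w) countingSeries_isStd_eq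
    simp only [countingSeries, PowerSeries.coeff_mk, Nat.cast_inj, true_and] at h1
    have h2 := finite_weight_eq positiveWeight_ne_zero (fun e => IsStd e ∧ e 14 = 0) w
    have h3 := finite_weight_eq paramWeight_ne_zero (fun _ => True) w
    simp only [true_and] at h3
    refine ⟨Equiv.trans ?_ (Finite.card_eq.1 h1).some⟩
    refine (Equiv.subtypeSubtypeEquivSubtypeInter _
      fun e => Finsupp.weight momentWeight e = w).trans (Equiv.subtypeEquivRight fun e => ?_)
    constructor
    · rintro ⟨h4, h5⟩
      exact ⟨h4, by rw [weight_eq_of_apply_eq_zero h4.2, h5]⟩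
    · rintro ⟨h4, h5⟩
      exact ⟨h4, by rw [← weight_eq_of_apply_eq_zero h4.2, h5]⟩
  have Φ := fun w => (h w).some
  refine ⟨((Equiv.sigmaFiberEquiv fun e : AffineStd => Finsupp.weight momentWeight e.1).symm.trans
    (Equiv.sigmaCongrRight Φ)).trans (Equiv.sigmaFiberEquiv (Finsupp.weight paramWeight)), ?_⟩
  intro e
  exact (Φ (Finsupp.weight momentWeight e.1) ⟨e, rfl⟩).2

end GaussianMoment

end

/-! ### Independence of the standard monomials on the moment variety. -/

noncomputable section

open MvPolynomial TermList

namespace GaussianMoment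

/-- The moments of order one and two among all moments. -/
def lowMoment : Fin 5 → Fin 15 := ![6, 2, 7, 4, 1]

lemma param_lowMoment (i : Fin 5) : param (X (lowMoment i)) = X i := by
  fin_cases i <;>
  simp [param, momentImage, lowMoment, momentTerms, monoValue, Fin.prod_univ_five]

lemma momentWeight_lowMoment (i : Fin 5) : momentWeight (lowMoment i) = paramWeight i := by
  revert i; decide

lemma relationIdeal_le_ker {f : MomentRing} (hf : f ∈ relationIdeal) : param f = 0 := by
  have : relationIdeal ≤ RingHom.ker param := by
    refine Ideal.span_le.2 ?_
    rintro _ ⟨g, hg, rfl⟩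
    exact param_poly_eq_zero hg
  exact this hf

lemma param_X_last : param (X 14) = 1 := by
  simp [param, momentImage, momentTerms, monoValue]

/-- Remove the constant moment from a monomial. -/
def dehom (e : Fin 15 →₀ ℕ) : Fin 15 →₀ ℕ := e.erase 14

lemma dehom_add (e : Fin 15 →₀ ℕ) : dehom e + Finsupp.single 14 (e 14) = e :=
  Finsupp.erase_add_single 14 e

lemma IsStd.dehom {e : Fin 15 →₀ ℕ} (h : IsStd e) : IsStd (dehom e) := by
  rwa [← isStd_add_single _ (e 14), dehom_add]

lemma dehom_last (e : Fin 15 →₀ ℕ) : dehom e 14 = 0 := Finsupp.erase_same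

lemma weight_dehom (e : Fin 15 →₀ ℕ) :
    Finsupp.weight momentWeight (dehom e) = Finsupp.weight momentWeight e := by
  conv_rhs => rw [← dehom_add e, map_add, Finsupp.weight_single]
  simp [momentWeight]

lemma param_monomial_dehom (e : Fin 15 →₀ ℕ) :
    param (monomial (dehom e) 1) = param (monomial e 1) := by
  have h : (monomial e 1 : MomentRing) = monomial (dehom e) 1 * X 14 ^ e 14 := by
    rw [X_pow_eq_monomial, monomial_mul, dehom_add, one_mul]
  rw [h, map_mul, map_pow, param_X_last, one_pow, mul_one]

lemma dehom_injOn {e e' : Fin 15 →₀ ℕ}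
    (h : Finsupp.weight (fun _ => 1) e = Finsupp.weight (fun _ => 1) e')
    (h' : dehom e = dehom e') : e = e' := by
  rw [← dehom_add e, ← dehom_add e', h'] at h ⊢
  simp only [map_add, Finsupp.weight_single, smul_eq_mul, mul_one] at h
  rw [show e 14 = e' 14 by omega]

/-- The images of the standard monomials under the parametrization. -/
def stdImage (e : AffineStd) : ParamRing := param (monomial e.1 1)

/-- A parameter monomial is the image of a monomial of the same weight in the low moments. Division
turns this into standard monomials, and removing powers of m_00 changes neither images nor weights.
-/
lemma monomial_mem_span (W : ℕ) (u : Fin 5 →₀ ℕ) (hu : Finsupp.weight paramWeight u ≤ W) :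
    (monomial u 1 : ParamRing) ∈ Submodule.span ℂ
      (Set.range fun e : {e : AffineStd // Finsupp.weight momentWeight e.1 ≤ W} =>
        stdImage e.1) := by
  set e := u.mapDomain lowMoment with he
  have h1 : (monomial u 1 : ParamRing) = param (monomial e 1) := by
    rw [monomial_eq, monomial_eq, C_1, one_mul, C_1, one_mul, he, Finsupp.prod_mapDomain_index
      (by simp) (by intros; rw [pow_add]), Finsupp.prod, Finsupp.prod, map_prod]
    simp [param_lowMoment]
  have h2 : Finsupp.weight momentWeight e = Finsupp.weight paramWeight u := by
    rw [he, Finsupp.weight_apply, Finsupp.weight_apply, Finsupp.sum_mapDomain_index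
      (by simp) (by intros; rw [add_smul])]
    simp [momentWeight_lowMoment]
  obtain ⟨p, hp, hp'⟩ := exists_std_of_monomial e
  have h3 := relationIdeal_le_ker hp
  rw [map_sub, sub_eq_zero] at h3
  rw [h1, h3, p.as_sum, map_sum]
  refine Submodule.sum_mem _ fun e' he' => ?_
  have h4 := hp' e' he'
  rw [show monomial e' (coeff e' p) = coeff e' p • (monomial e' 1 : MomentRing) by
    rw [smul_monomial, smul_eq_mul, mul_one], map_smul, ← param_monomial_dehom]
  refine Submodule.smul_mem _ _ (Submodule.subset_span
    ⟨⟨⟨dehom e', h4.1.dehom, dehom_last e'⟩, ?_⟩, rfl⟩)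
  rw [weight_dehom, h4.2.2, h2]
  exact hu

/-- The span contains the parameter monomials of weight at most `W`, which are as numerous as the
vectors. Only this containment is needed, so homogeneity of the parametrization plays no role. -/
lemma linearIndependent_stdImage_of_le (W : ℕ) : LinearIndependent ℂ
    fun e : {e : AffineStd // Finsupp.weight momentWeight e.1 ≤ W} => stdImage e.1 := by
  obtain ⟨Φ, hΦ⟩ := exists_equiv_affineStd
  have hfin : Finite {u : Fin 5 →₀ ℕ // Finsupp.weight paramWeight u ≤ W} :=
    (Finsupp.finite_of_nat_weight_le paramWeight paramWeight_ne_zero W).to_subtype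
  have Ψ : {e : AffineStd // Finsupp.weight momentWeight e.1 ≤ W} ≃
      {u : Fin 5 →₀ ℕ // Finsupp.weight paramWeight u ≤ W} :=
    Φ.subtypeEquiv fun e => by rw [hΦ]
  have hfin' := Finite.of_equiv _ Ψ.symm
  have := Fintype.ofFinite {u : Fin 5 →₀ ℕ // Finsupp.weight paramWeight u ≤ W}
  have := Fintype.ofFinite {e : AffineStd // Finsupp.weight momentWeight e.1 ≤ W}
  rw [linearIndependent_iff_card_le_finrank_span, Fintype.card_congr Ψ]
  have h1 : LinearIndependent ℂ
      fun u : {u : Fin 5 →₀ ℕ // Finsupp.weight paramWeight u ≤ W} => (monomial u.1 1 : ParamRing) := by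
    have := (basisMonomials (Fin 5) ℂ).linearIndependent.comp
      (fun u : {u : Fin 5 →₀ ℕ // Finsupp.weight paramWeight u ≤ W} => u.1)
      Subtype.val_injective
    simpa [Function.comp_def] using this
  rw [← finrank_span_eq_card h1]
  have h2 : Module.Finite ℂ (Submodule.span ℂ (Set.range fun
      e : {e : AffineStd // Finsupp.weight momentWeight e.1 ≤ W} => stdImage e.1)) :=
    FiniteDimensional.span_of_finite ℂ (Set.finite_range _)
  refine Submodule.finrank_mono (Submodule.span_le.2 ?_)
  rintro _ ⟨u, rfl⟩
  exact monomial_mem_span W u.1 u.2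

lemma linearIndependent_stdImage : LinearIndependent ℂ stdImage := by
  rw [linearIndependent_iff_finset_linearIndependent]
  intro s
  obtain ⟨W, hW⟩ : ∃ W, ∀ e ∈ s, Finsupp.weight momentWeight e.1 ≤ W :=
    ⟨s.sup fun e => Finsupp.weight momentWeight e.1, fun e he =>
      Finset.le_sup (f := fun e : AffineStd => Finsupp.weight momentWeight e.1) he⟩
  exact (linearIndependent_stdImage_of_le W).comp
    (fun e : s => ⟨e.1, hW e.1 e.2⟩) fun e e' h => Subtype.ext (Subtype.mk.inj h)

/-- Within one degree the exponent of m_00 is determined by the others, so the monomials of `p` stay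
distinct when m_00 is removed and their images are independent. -/
lemma eq_zero_of_isStd {p : MomentRing} {d : ℕ}
    (hp : ∀ e ∈ p.support, IsStd e ∧ Finsupp.weight (fun _ => 1) e = d) (h : param p = 0) :
    p = 0 := by
  let F : p.support → AffineStd := fun e => ⟨dehom e.1, (hp e.1 e.2).1.dehom, dehom_last _⟩
  have hF : Function.Injective F := fun e e' hee => Subtype.ext
    (dehom_injOn ((hp e.1 e.2).2.trans (hp e'.1 e'.2).2.symm) (Subtype.mk.inj hee))
  have h1 := Fintype.linearIndependent_iff.1 (linearIndependent_stdImage.comp F hF)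
    (fun e => coeff e.1 p) (by
      rw [p.as_sum, map_sum, ← Finset.sum_coe_sort] at h
      rw [← h]
      refine Finset.sum_congr rfl fun e _ => ?_
      rw [show monomial e.1 (coeff e.1 p) = coeff e.1 p • (monomial e.1 1 : MomentRing) by
        rw [smul_monomial, smul_eq_mul, mul_one], map_smul, ← param_monomial_dehom]
      rfl)
  by_contra h2
  obtain ⟨e, he⟩ := support_nonempty.2 h2
  exact mem_support_iff.1 he (h1 ⟨e, he⟩)

/-- A homogeneous relation between the moments is in the ideal generated by the explicit ones. -/
lemma mem_relationIdeal {f : MomentRing} {d : ℕ} (hd : f.IsHomogeneous d) (hf : param f = 0) :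
    f ∈ relationIdeal := by
  obtain ⟨p, hp, hp'⟩ := exists_std f
  have h1 := relationIdeal_le_ker hp
  rw [map_sub, hf, zero_sub, neg_eq_zero] at h1
  have h2 : p = 0 := eq_zero_of_isStd (d := d) (fun e he => by
    obtain ⟨h3, e', h4, h5⟩ := hp' e he
    exact ⟨h3, h5.1.trans (hd (mem_support_iff.1 h4))⟩) h1
  rwa [h2, sub_zero] at hp

end GaussianMoment

end

/-! ### Primality and the Hilbert function. -/

noncomputable section

open MvPolynomial

namespace TermList

/-- Whether all terms have the given weight. -/
def allWeight (w : List ℕ) (n : ℕ) (f : Terms) : Bool :=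
  f.all fun y => Nat.beq (codeWeight w y.2) n

theorem relations_degree :
    cubics.all (allWeight [1, 1, 1, 1, 1, 1, 1, 1, 1, 1, 1, 1, 1, 1, 1] 3) &&
    quartics.all (allWeight [1, 1, 1, 1, 1, 1, 1, 1, 1, 1, 1, 1, 1, 1, 1] 4) &&
    quintics.all (allWeight [1, 1, 1, 1, 1, 1, 1, 1, 1, 1, 1, 1, 1, 1, 1] 5) := by decide +kernel

end TermList

namespace GaussianMoment

open TermList

lemma isWeightedHomogeneous_poly {w : Fin 15 → ℕ} {n : ℕ} {f : Terms}
    (h : allWeight (List.ofFn w) n f = true) : IsWeightedHomogeneous w (poly f) n := by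
  induction f with
  | nil => exact isWeightedHomogeneous_zero ℂ w n
  | cons y f ih =>
    simp only [allWeight, List.all_cons, Bool.and_eq_true, Nat.beq_eq] at h
    rw [poly_cons]
    refine IsWeightedHomogeneous.add ?_ (ih (by simpa [allWeight] using h.2))
    exact isWeightedHomogeneous_monomial w _ _ (by rw [← h.1, codeWeight_eq])

lemma isHomogeneous_poly {n : ℕ} {f : Terms}
    (h : allWeight [1, 1, 1, 1, 1, 1, 1, 1, 1, 1, 1, 1, 1, 1, 1] n f = true) :
    (poly f).IsHomogeneous n :=
  isWeightedHomogeneous_poly (w := 1) h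

lemma isHomogeneous_of_mem_cubics {f : Terms} (hf : f ∈ cubics) : (poly f).IsHomogeneous 3 := by
  have h := relations_degree
  simp only [Bool.and_eq_true, List.all_eq_true] at h
  exact isHomogeneous_poly (h.1.1 f hf)

lemma isHomogeneous_of_mem_quartics {f : Terms} (hf : f ∈ quartics) :
    (poly f).IsHomogeneous 4 := by
  have h := relations_degree
  simp only [Bool.and_eq_true, List.all_eq_true] at h
  exact isHomogeneous_poly (h.1.2 f hf)

lemma isHomogeneous_of_mem_quintics {f : Terms} (hf : f ∈ quintics) :
    (poly f).IsHomogeneous 5 := by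
  have h := relations_degree
  simp only [Bool.and_eq_true, List.all_eq_true] at h
  exact isHomogeneous_poly (h.2 f hf)

lemma exists_isHomogeneous {f : Terms} (hf : f ∈ relations) : ∃ d, (poly f).IsHomogeneous d := by
  rcases List.mem_append.1 hf with hf | hf
  · rcases List.mem_append.1 hf with hf | hf
    · exact ⟨3, isHomogeneous_of_mem_cubics hf⟩
    · exact ⟨4, isHomogeneous_of_mem_quartics hf⟩
  · exact ⟨5, isHomogeneous_of_mem_quintics hf⟩

lemma relationIdeal_eq_span :
    relationIdeal = Ideal.span {f | (∃ d : ℕ, f.IsHomogeneous d) ∧ param f = 0} := by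
  refine le_antisymm (Ideal.span_mono ?_) (Ideal.span_le.2 ?_)
  · rintro _ ⟨f, hf, rfl⟩
    exact ⟨exists_isHomogeneous hf, param_poly_eq_zero hf⟩
  · rintro f ⟨⟨d, hd⟩, hf⟩
    exact mem_relationIdeal hd hf

/-- The parametrization of the affine cone. -/
def coneParam : MomentRing →ₐ[ℂ] Polynomial ParamRing :=
  aeval fun i => Polynomial.C (momentImage i) * Polynomial.X

lemma coneParam_monomial (e : Fin 15 →₀ ℕ) (c : ℂ) : coneParam (monomial e c) =
    Polynomial.C (param (monomial e c)) * Polynomial.X ^ e.degree := by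
  rw [coneParam, param, aeval_monomial, aeval_monomial, Finsupp.prod, Finsupp.prod,
    Finsupp.degree_apply]
  simp only [mul_pow, Finset.prod_mul_distrib, Finset.prod_pow_eq_pow_sum, map_mul, map_prod,
    map_pow]
  rw [mul_assoc]
  rfl

lemma coneParam_of_isHomogeneous {f : MomentRing} {d : ℕ} (hf : f.IsHomogeneous d) :
    coneParam f = Polynomial.C (param f) * Polynomial.X ^ d := by
  rw [f.as_sum, map_sum, map_sum, map_sum, Finset.sum_mul]
  refine Finset.sum_congr rfl fun e he => ?_
  rw [coneParam_monomial, Finsupp.degree_eq_weight_one]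
  congr 2
  exact hf (mem_support_iff.1 he)

/-- The powers of the extra variable separate the degrees, so the homogeneous components of a kernel
element are killed by `param` one by one and `mem_relationIdeal` applies to each. -/
lemma relationIdeal_eq_ker : relationIdeal = RingHom.ker coneParam := by
  refine le_antisymm ?_ fun f hf => ?_
  · rw [relationIdeal_eq_span, Ideal.span_le]
    rintro f ⟨⟨d, hd⟩, hf⟩
    change coneParam f = 0
    rw [coneParam_of_isHomogeneous hd, hf, map_zero, zero_mul]
  · rw [← f.sum_homogeneousComponent]
    refine Ideal.sum_mem _ fun d hd => mem_relationIdeal (homogeneousComponent_isHomogeneous d f) ?_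
    have h : coneParam f = 0 := hf
    rw [← f.sum_homogeneousComponent, map_sum] at h
    have h1 := congrArg (fun q => Polynomial.coeff q d) h
    simp only [coneParam_of_isHomogeneous (homogeneousComponent_isHomogeneous _ f),
      Polynomial.finsetSum_coeff, Polynomial.coeff_C_mul_X_pow, Polynomial.coeff_zero] at h1
    rwa [Finset.sum_ite_eq, if_pos hd] at h1

lemma relationIdeal_isPrime : relationIdeal.IsPrime := by
  rw [relationIdeal_eq_ker]
  exact RingHom.ker_isPrime _

/-- The standard monomials of degree `d` are a basis: division shows that they span, and
`eq_zero_of_isStd` that they are independent. -/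
lemma hilbertFunction_relationIdeal (d : ℕ) : ProjVar.hilbertFunction relationIdeal d =
    Nat.card {e // IsStd e ∧ Finsupp.weight (fun _ => 1) e = d} := by
  have hfin := finite_weight_eq (v := fun _ => 1) (by simp) IsStd d
  have := Fintype.ofFinite {e // IsStd e ∧ Finsupp.weight (fun _ => 1) e = d}
  let mk := (Ideal.Quotient.mkₐ ℂ relationIdeal).toLinearMap
  let b : {e // IsStd e ∧ Finsupp.weight (fun _ => 1) e = d} → MomentRing ⧸ relationIdeal :=
    fun e => mk (monomial e.1 1)
  have hb : LinearIndependent ℂ b := by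
    rw [Fintype.linearIndependent_iff]
    intro c hc
    let p : MomentRing := ∑ e : {e // IsStd e ∧ Finsupp.weight (fun _ => 1) e = d},
      monomial e.1 (c e)
    have h0 : mk p = 0 := by
      rw [← hc, map_sum]
      refine Finset.sum_congr rfl fun e _ => ?_
      rw [← map_smul, smul_monomial, smul_eq_mul, mul_one]
    have h1 : param p = 0 := relationIdeal_le_ker (Ideal.Quotient.eq_zero_iff_mem.1 h0)
    have h2 : ∀ e, coeff e.1 p = c e := by
      intro e
      rw [coeff_sum, Finset.sum_eq_single e]
      · simp
      · intro e' _ h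
        rw [coeff_monomial, if_neg fun h' => h (Subtype.ext h')]
      · simp
    have h3 : p = 0 := eq_zero_of_isStd (d := d) (fun e he => by
      classical
      obtain ⟨e', -, h⟩ := Finset.mem_biUnion.1 (support_sum he)
      obtain rfl : e = e'.1 := by simpa [eq_comm] using support_monomial_subset h
      exact e'.2) h1
    intro e
    rw [← h2 e, h3, coeff_zero]
  rw [ProjVar.hilbertFunction, Nat.card_eq_fintype_card, ← finrank_span_eq_card hb]
  suffices h : (homogeneousSubmodule (Fin 15) ℂ d).map mk = Submodule.span ℂ (Set.range b) from
    congrArg (fun V : Submodule ℂ (MomentRing ⧸ relationIdeal) => Module.finrank ℂ V) h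
  refine le_antisymm ?_ (Submodule.span_le.2 ?_)
  · rintro _ ⟨f, hf, rfl⟩
    obtain ⟨p, hp, hp'⟩ := exists_std f
    have h1 : mk f = mk p := Ideal.Quotient.eq.2 hp
    rw [h1, p.as_sum, map_sum]
    refine Submodule.sum_mem _ fun e he => ?_
    obtain ⟨h3, e', h4, h5⟩ := hp' e he
    rw [show monomial e (coeff e p) = coeff e p • (monomial e 1 : MomentRing) by
      rw [smul_monomial, smul_eq_mul, mul_one], map_smul]
    exact Submodule.smul_mem _ _ (Submodule.subset_span
      ⟨⟨e, h3, h5.1.trans (hf (mem_support_iff.1 h4))⟩, rfl⟩)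
  · rintro _ ⟨e, rfl⟩
    exact ⟨monomial e.1 1, isWeightedHomogeneous_monomial _ _ _ e.2.2, rfl⟩

end GaussianMoment

end

/-! ### Finite data for minimality. -/

noncomputable section

open MvPolynomial

namespace TermList

/-- One hundred times the degree plus the weight of each relation. -/
def relationGrades : List ℕ := [
  303, 304, 305, 306, 303, 304, 304, 305, 305, 305, 306, 306, 306, 307, 307, 308, 303, 304, 304,
  305, 305, 305, 305, 306, 306, 306, 306, 306, 307, 307, 307, 307, 308, 308, 303, 304, 304, 305,
  305, 305, 305, 306, 306, 306, 306, 306, 306, 307, 307, 307, 307, 307, 307, 308, 308, 308, 308,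
  309, 304, 305, 305, 305, 306, 306, 306, 306, 306, 307, 307, 307, 307, 307, 307, 308, 308, 308,
  308, 308, 309, 305, 306, 306, 306, 307, 307, 307, 307, 308, 308, 308, 308, 309, 306, 307, 307,
  308, 308, 309, 308, 412, 412, 413, 412, 412, 412, 413, 413, 412, 412, 412, 413, 413, 413, 412,
  412, 412, 412, 412, 413, 413, 413, 413, 412, 412, 412, 413, 413, 413, 413, 412, 412, 412, 413,
  413, 413, 412, 412, 413, 413, 413, 518]

/-- One hundred times the degree plus the weight of a monomial. -/
def grade (c : ℕ) : ℕ :=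
  codeWeight [103, 102, 101, 103, 102, 103, 101, 102, 103, 104, 104, 104, 104, 104, 100] c

/-- The codes of the monomials of degree at most one. -/
def multipliers : List ℕ := 0 :: (List.range 15).map (32 ^ ·)

/-- The multiples of relations of the given grade by monomials of degree at most one, each given by
the code of the monomial and the number of the relation. -/
def multiplesOfGrade (n : ℕ) : List (ℕ × ℕ) :=
  ((List.range 141).flatMap fun j => multipliers.map (·, j)).filter fun q =>
    Nat.beq (grade q.1 + relationGrades.getD q.2 0) n

/-- Add an element to a list, unless it is present. -/
def insertCode (c : ℕ) (L : List ℕ) : List ℕ :=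
  cond (L.any (Nat.beq c)) L (forceNat c fun c => c :: L)

/-- Multiples of the leading monomials of the given grade. -/
def leadsOfGrade (n : ℕ) : List ℕ :=
  (((leadCodes.flatMap fun m => multipliers.map (· + m)).filter fun c => Nat.beq (grade c) n).foldr
    insertCode [])

theorem relations_grade : (List.range 141).all (fun j =>
    allWeight [103, 102, 101, 103, 102, 103, 101, 102, 103, 104, 104, 104, 104, 104, 100]
      (relationGrades.getD j 0) (entry relations j)) = true := by decide +kernel

theorem length_relations : relations.length = 141 := by decide +kernel

theorem length_relationGrades : relationGrades.length = 141 := by decide +kernel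

/-- On the left is the size of a spanning set of the graded part of the ideal, on the right a lower
bound for its dimension; so no multiple can be spared. -/
theorem length_multiplesOfGrade : [303, 304, 305, 306, 307, 308, 309, 413, 518].all (fun n =>
    Nat.ble (multiplesOfGrade n).length (leadsOfGrade n).length) = true := by decide +kernel

/-- In degree 4 and weight 12 there is one multiple too many, which the syzygy `linear_relation`
removes. -/
theorem length_multiplesOfGrade_quartic :
    (multiplesOfGrade 412).length = (leadsOfGrade 412).length + 1 := by decide +kernel

/-- The margin `32 ^ 14`, the code of the last variable, leaves room for multiplication by any
single variable. -/
theorem leadCodes_isSmall : leadCodes.all (fun m => isSmall m && Nat.blt m (32 ^ 15 - 32 ^ 14)) = true := by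
  decide +kernel

/-- The linear relation between multiples of the cubics. -/
theorem linear_relation : Option.rec false isNil (do
    let f ← combine 0 1 (32 ^ 3) [] (entry relations 97)
    let f ← combine 1 1 (32 ^ 8) f (entry relations 57)
    let f ← combine 1 (-1) (32 ^ 0) f (entry relations 91)
    combine 1 (-1) (32 ^ 5) f (entry relations 78)) = true := by decide +kernel

end TermList

end

/-! ### No relation is superfluous. -/

noncomputable section

open MvPolynomial TermList

/-- Turns membership in an ideal into membership in a linear span, to which dimension counts apply.
-/
lemma MvPolynomial.mem_span_monomial_mul {σ K : Type*} [Field K] {T : Set (MvPolynomial σ K)}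
    {f : MvPolynomial σ K} (hf : f ∈ Ideal.span T) :
    f ∈ Submodule.span K {q | ∃ e, ∃ g ∈ T, q = monomial e 1 * g} := by
  refine Submodule.span_induction (p := fun f _ => f ∈ Submodule.span K
    {q | ∃ e, ∃ g ∈ T, q = monomial e 1 * g}) ?_ (Submodule.zero_mem _)
    (fun _ _ _ _ => Submodule.add_mem _) ?_ hf
  · intro g hg
    exact Submodule.subset_span ⟨0, g, hg, by simp⟩
  · intro a f _ hf
    refine Submodule.span_induction (p := fun f _ => a • f ∈ Submodule.span K
      {q | ∃ e, ∃ g ∈ T, q = monomial e 1 * g}) ?_ (by simp) ?_ ?_ hf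
    · rintro _ ⟨e, g, hg, rfl⟩
      rw [smul_eq_mul, a.as_sum, Finset.sum_mul]
      refine Submodule.sum_mem _ fun e' _ => ?_
      have : monomial e' (coeff e' a) * (monomial e 1 * g) =
          coeff e' a • (monomial (e' + e) 1 * g) := by
        rw [← mul_assoc, monomial_mul, mul_one, ← smul_mul_assoc, smul_monomial, smul_eq_mul,
          mul_one]
      rw [this]
      exact Submodule.smul_mem _ _ (Submodule.subset_span ⟨_, g, hg, rfl⟩)
    · intro f g _ _ hf hg
      rw [smul_add]
      exact Submodule.add_mem _ hf hg
    · intro c f _ hf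
      rw [smul_comm]
      exact Submodule.smul_mem _ _ hf

namespace GaussianMoment

/-- One hundred times the degree plus the weight. -/
def gradeWeight : Fin 15 → ℕ :=
  ![103, 102, 101, 103, 102, 103, 101, 102, 103, 104, 104, 104, 104, 104, 100]

lemma grade_eq (c : ℕ) : grade c = Finsupp.weight gradeWeight (expo 15 c) :=
  codeWeight_eq gradeWeight c

/-- The relation with the given number. -/
def rel (j : ℕ) : MomentRing := poly (entry relations j)

lemma entry_eq (L : List Terms) (j : ℕ) : entry L j = L.getD j [] := by
  induction L generalizing j with
  | nil => rfl
  | cons f L ih =>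
    rcases j with _ | j
    · rfl
    · exact ih j

lemma mem_relations_iff {f : Terms} : f ∈ relations ↔ ∃ j < 141, entry relations j = f := by
  rw [List.mem_iff_getElem]
  constructor
  · rintro ⟨j, hj, h⟩
    exact ⟨j, by rwa [length_relations] at hj, by rw [entry_eq, List.getD_eq_getElem _ _ hj, h]⟩
  · rintro ⟨j, hj, h⟩
    rw [← length_relations] at hj
    exact ⟨j, hj, by rw [← h, entry_eq, List.getD_eq_getElem _ _ hj]⟩

lemma isWeightedHomogeneous_rel {j : ℕ} (hj : j < 141) :
    IsWeightedHomogeneous gradeWeight (rel j) (relationGrades.getD j 0) :=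
  isWeightedHomogeneous_poly (List.all_eq_true.1 relations_grade j (List.mem_range.2 hj))

lemma relationGrades_mem {j : ℕ} (hj : j < 141) : relationGrades.getD j 0 ∈
    [303, 304, 305, 306, 307, 308, 309, 412, 413, 518] := by
  have h : ∀ n ∈ relationGrades, n ∈ [303, 304, 305, 306, 307, 308, 309, 412, 413, 518] := by
    decide +kernel
  rw [← length_relationGrades] at hj
  rw [List.getD_eq_getElem _ _ hj]
  exact h _ (List.getElem_mem hj)

lemma gradeWeight_bounds (e : Fin 15 →₀ ℕ) : 100 * e.degree ≤ Finsupp.weight gradeWeight e ∧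
    Finsupp.weight gradeWeight e ≤ 104 * e.degree := by
  rw [Finsupp.degree_eq_weight_one, Finsupp.weight_apply, Finsupp.weight_apply,
    Finsupp.sum_fintype _ _ (by simp), Finsupp.sum_fintype _ _ (by simp), Finset.mul_sum,
    Finset.mul_sum]
  constructor <;> refine Finset.sum_le_sum fun i _ => ?_ <;>
    simp only [smul_eq_mul, mul_one]
  · rw [mul_comm]
    exact Nat.mul_le_mul_left _ (by revert i; decide)
  · rw [mul_comm 104]
    exact Nat.mul_le_mul_left _ (by revert i; decide)

lemma gradeWeight_apply (e : Fin 15 →₀ ℕ) : Finsupp.weight gradeWeight e =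
    100 * Finsupp.weight (fun _ => 1) e + Finsupp.weight momentWeight e := by
  rw [Finsupp.weight_apply, Finsupp.weight_apply, Finsupp.weight_apply,
    Finsupp.sum_fintype _ _ (by simp), Finsupp.sum_fintype _ _ (by simp),
    Finsupp.sum_fintype _ _ (by simp), Finset.mul_sum, ← Finset.sum_add_distrib]
  refine Finset.sum_congr rfl fun i _ => ?_
  have : gradeWeight i = 100 + momentWeight i := by revert i; decide
  rw [this]
  simp only [smul_eq_mul]
  ring

lemma expo_pow (k : Fin 15) : expo 15 (32 ^ (k : ℕ)) = Finsupp.single k 1 := by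
  ext i
  rw [expo_apply]
  revert i k
  have : ∀ k i : Fin 15, 32 ^ (k : ℕ) / 32 ^ (i : ℕ) % 32 = if k = i then 1 else 0 := by
    decide +kernel
  intro k i
  rw [this, Finsupp.single_apply]

lemma expo_zero : expo 15 0 = 0 := by
  ext i
  simp

lemma exists_multiplier {e : Fin 15 →₀ ℕ} (he : e.degree ≤ 1) :
    ∃ c ∈ multipliers, e = expo 15 c := by
  rcases Nat.le_one_iff_eq_zero_or_eq_one.1 he with h | h
  · refine ⟨0, by simp [multipliers], ?_⟩
    rw [expo_zero]
    exact (Finsupp.degree_eq_zero_iff e).1 h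
  · obtain ⟨k, rfl⟩ : e ∈ Set.range fun a : Fin 15 => Finsupp.single a 1 := by
      rw [Finsupp.range_single_one]
      exact h
    exact ⟨32 ^ (k : ℕ), List.mem_cons_of_mem _ (List.mem_map.2 ⟨k, List.mem_range.2 k.2, rfl⟩),
      (expo_pow k).symm⟩

/-- The multiple of a relation by the monomial with the given code. -/
def multiple (q : ℕ × ℕ) : MomentRing := monomial (expo 15 q.1) 1 * rel q.2

/-- The part of grade `n` of an ideal generated by relations. -/
lemma mem_span_multiple {P : ℕ → Prop} {n : ℕ}
    (hn : n ∈ [303, 304, 305, 306, 307, 308, 309, 412, 413, 518]) {f : MomentRing}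
    (hf : f ∈ Ideal.span {g | ∃ j < 141, P j ∧ g = rel j})
    (hfn : IsWeightedHomogeneous gradeWeight f n) :
    f ∈ Submodule.span ℂ {g | ∃ q ∈ multiplesOfGrade n, P q.2 ∧ g = multiple q} := by
  have h := Submodule.mem_map_of_mem (f := weightedHomogeneousComponent gradeWeight n)
    (mem_span_monomial_mul hf)
  rw [weightedHomogeneousComponent_of_mem hfn, if_pos rfl, Submodule.map_span] at h
  refine Submodule.span_le.2 ?_ h
  rintro _ ⟨_, ⟨e, _, ⟨j, hj, hP, rfl⟩, rfl⟩, rfl⟩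
  have h1 : IsWeightedHomogeneous gradeWeight (monomial e 1 * rel j)
    (Finsupp.weight gradeWeight e + relationGrades.getD j 0) :=
    (isWeightedHomogeneous_monomial _ _ _ rfl).mul (isWeightedHomogeneous_rel hj)
  rw [weightedHomogeneousComponent_of_mem h1]
  split_ifs with h2
  -- A monomial of degree k has grade between 100k and 104k, and no difference of two grades in the
  -- list allows k ≥ 2. For example, cubics have weight at most 9, so their multiples by quadratic
  -- monomials have weight at most 17, short of the 18 of the quintic.
  · have h3 : e.degree ≤ 1 := by
      have h4 := relationGrades_mem hj
      have h5 := gradeWeight_bounds e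
      simp only [List.mem_cons, List.not_mem_nil, or_false] at h4 hn
      omega
    obtain ⟨c, hc, rfl⟩ := exists_multiplier h3
    refine Submodule.subset_span ⟨(c, j), ?_, hP, rfl⟩
    rw [multiplesOfGrade, List.mem_filter]
    refine ⟨List.mem_flatMap.2 ⟨j, List.mem_range.2 hj, List.mem_map.2 ⟨c, hc, rfl⟩⟩, ?_⟩
    rw [Nat.beq_eq, grade_eq, h2]
  · exact Submodule.zero_mem _

lemma mem_insertCode {c d : ℕ} {L : List ℕ} : d ∈ insertCode c L ↔ d = c ∨ d ∈ L := by
  rw [insertCode]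
  rcases h : L.any (Nat.beq c) with _ | _
  · simp [forceNat_eq]
  · obtain ⟨b, hb, h⟩ := List.any_eq_true.1 h
    have : c = b := Nat.eq_of_beq_eq_true h
    simp only [cond_true]
    constructor
    · exact Or.inr
    · rintro (rfl | h)
      · rwa [this]
      · exact h

lemma nodup_insertCode {c : ℕ} {L : List ℕ} (hL : L.Nodup) : (insertCode c L).Nodup := by
  rw [insertCode]
  rcases h : L.any (Nat.beq c) with _ | _
  · simp only [cond_false, forceNat_eq, List.nodup_cons]
    refine ⟨fun hc => ?_, hL⟩
    have : L.any (Nat.beq c) = true := List.any_eq_true.2 ⟨c, hc, by simp⟩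
    rw [h] at this
    cases this
  · exact hL

lemma nodup_leadsOfGrade (n : ℕ) : (leadsOfGrade n).Nodup := by
  rw [leadsOfGrade]
  generalize (leadCodes.flatMap fun m => multipliers.map (· + m)).filter
    (fun c => Nat.beq (grade c) n) = L
  induction L with
  | nil => exact List.nodup_nil
  | cons c L ih => exact nodup_insertCode ih

lemma mem_leadsOfGrade {n c : ℕ} (hc : c ∈ leadsOfGrade n) :
    grade c = n ∧ ∃ m ∈ leadCodes, ∃ t ∈ multipliers, c = t + m := by
  rw [leadsOfGrade] at hc
  have key : ∀ L : List ℕ, c ∈ L.foldr insertCode [] → c ∈ L := by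
    intro L
    induction L with
    | nil => exact id
    | cons d L ih =>
      intro h
      rcases mem_insertCode.1 h with rfl | h
      · exact List.mem_cons_self
      · exact List.mem_cons_of_mem _ (ih h)
  have h := List.mem_filter.1 (key _ hc)
  obtain ⟨m, hm, h1⟩ := List.mem_flatMap.1 h.1
  obtain ⟨t, ht, h2⟩ := List.mem_map.1 h1
  exact ⟨Nat.eq_of_beq_eq_true h.2, m, hm, t, ht, h2.symm⟩

lemma multipliers_isSmall : ∀ t ∈ multipliers, isSmall t = true ∧ t ≤ 32 ^ 14 := by
  decide +kernel

lemma not_isStd_of_mem_leadsOfGrade {n c : ℕ} (hc : c ∈ leadsOfGrade n) :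
    ¬ IsStd (expo 15 c) ∧ c < 32 ^ 15 := by
  obtain ⟨-, m, hm, t, ht, rfl⟩ := mem_leadsOfGrade hc
  have h1 := List.all_eq_true.1 leadCodes_isSmall m hm
  rw [Bool.and_eq_true, Nat.blt_eq] at h1
  obtain ⟨h2, h3⟩ := multipliers_isSmall t ht
  refine ⟨fun h => h m hm fun i => ?_, ?_⟩
  · rw [expo_apply, expo_apply, digit_add h2 h1.1 i.2]
    exact Nat.le_add_left _ _
  · have := h1.2
    omega

lemma expo_injOn {c c' : ℕ} (hc : c < 32 ^ 15) (hc' : c' < 32 ^ 15)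
    (h : expo 15 c = expo 15 c') : c = c' := by
  rcases lt_trichotomy c c' with hlt | rfl | hlt
  · exact absurd (h ▸ low_of_lt hlt hc') (Low.irrefl _)
  · rfl
  · exact absurd (h ▸ low_of_lt hlt hc) (Low.irrefl _)

/-- A lower bound for the number of generators of the part of grade `n` of the ideal. -/
lemma length_leadsOfGrade_le {n : ℕ} {L : List MomentRing}
    (h : ∀ f ∈ relationIdeal, IsWeightedHomogeneous gradeWeight f n →
      f ∈ Submodule.span ℂ {g | g ∈ L}) : (leadsOfGrade n).length ≤ L.length := by
  classical
  choose p hp hp' using exists_std_of_monomial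
  -- Each nonstandard monomial minus its standard remainder lies in the ideal. A given nonstandard
  -- monomial occurs only in its own difference, so these are independent.
  let F : {c // c ∈ leadsOfGrade n} → MomentRing := fun c =>
    monomial (expo 15 c.1) 1 - p (expo 15 c.1)
  have hli : LinearIndependent ℂ F := by
    rw [Fintype.linearIndependent_iff]
    intro a ha c
    have h1 := congrArg (coeff (expo 15 c.1)) ha
    rw [coeff_sum, Finset.sum_eq_single c] at h1
    · have h2 : coeff (expo 15 c.1) (p (expo 15 c.1)) = 0 := by
        by_contra h2
        exact (not_isStd_of_mem_leadsOfGrade c.2).1 (hp' _ _ (mem_support_iff.2 h2)).1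
      simpa [F, h2] using h1
    · intro b _ hb
      have h2 : coeff (expo 15 c.1) (p (expo 15 b.1)) = 0 := by
        by_contra h2
        exact (not_isStd_of_mem_leadsOfGrade c.2).1 (hp' _ _ (mem_support_iff.2 h2)).1
      have h3 : expo 15 b.1 ≠ expo 15 c.1 := fun h3 => hb (Subtype.ext (expo_injOn
        (not_isStd_of_mem_leadsOfGrade b.2).2 (not_isStd_of_mem_leadsOfGrade c.2).2 h3))
      simp [F, h2, h3]
    · simp
  have hF : ∀ c, F c ∈ Submodule.span ℂ ((L.toFinset : Finset MomentRing) : Set MomentRing) := by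
    intro c
    rw [List.coe_toFinset]
    refine h _ (hp _) ?_
    refine Submodule.sub_mem (weightedHomogeneousSubmodule ℂ gradeWeight n) ?_ ?_
    · exact isWeightedHomogeneous_monomial _ _ _
        (by rw [← grade_eq, (mem_leadsOfGrade c.2).1])
    · intro e he
      have h4 := (hp' _ _ (mem_support_iff.2 he)).2
      rw [← (mem_leadsOfGrade c.2).1, grade_eq, gradeWeight_apply, gradeWeight_apply, h4.1, h4.2]
  have h5 : Fintype.card {c // c ∈ leadsOfGrade n} = (leadsOfGrade n).length := by
    rw [Fintype.card_of_subtype (leadsOfGrade n).toFinset (by simp),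
      List.toFinset_card_of_nodup (nodup_leadsOfGrade n)]
  rw [← h5, ← finrank_span_eq_card hli]
  calc _ ≤ Module.finrank ℂ (Submodule.span ℂ ((L.toFinset : Finset MomentRing) : Set MomentRing)) := by
        have := FiniteDimensional.span_finset ℂ L.toFinset
        exact Submodule.finrank_mono (Submodule.span_le.2 (by rintro _ ⟨c, rfl⟩; exact hF c))
    _ ≤ L.toFinset.card := finrank_span_finset_le_card _
    _ ≤ L.length := L.toFinset_card_le

lemma multiple_relation : multiple (32 ^ 3, 97) =
    multiple (32 ^ 0, 91) + multiple (32 ^ 5, 78) - multiple (32 ^ 8, 57) := by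
  have h := linear_relation
  rcases h1 : combine 0 1 (32 ^ 3) [] (entry relations 97) with _ | f1
  · rw [h1] at h; cases h
  change Option.rec false isNil (Option.bind (combine 0 1 (32 ^ 3) [] (entry relations 97)) fun f =>
    Option.bind (combine 1 1 (32 ^ 8) f (entry relations 57)) fun f =>
    Option.bind (combine 1 (-1) (32 ^ 0) f (entry relations 91)) fun f =>
    combine 1 (-1) (32 ^ 5) f (entry relations 78)) = true at h
  rw [h1, Option.bind_some] at h
  rcases h2 : combine 1 1 (32 ^ 8) f1 (entry relations 57) with _ | f2
  · rw [h2] at h; cases h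
  rw [h2, Option.bind_some] at h
  rcases h3 : combine 1 (-1) (32 ^ 0) f2 (entry relations 91) with _ | f3
  · rw [h3] at h; cases h
  rw [h3, Option.bind_some] at h
  rcases h4 : combine 1 (-1) (32 ^ 5) f3 (entry relations 78) with _ | f4
  · rw [h4] at h; cases h
  rw [h4] at h
  rcases f4 with _ | ⟨y, f4⟩
  swap
  · cases h
  have e1 := value_combine le_rfl (X : Fin 15 → MomentRing) h1
  have e2 := value_combine le_rfl (X : Fin 15 → MomentRing) h2
  have e3 := value_combine le_rfl (X : Fin 15 → MomentRing) h3
  have e4 := value_combine le_rfl (X : Fin 15 → MomentRing) h4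
  rw [value_nil] at e1 e4
  rw [e3, e2, e1, monoValue_X, monoValue_X, monoValue_X, monoValue_X] at e4
  simp only [multiple, rel, poly]
  push_cast at e4
  linear_combination -e4

lemma exists_multiplesOfGrade {n j : ℕ} (hj : j < 141)
    (hjn : relationGrades.getD j 0 = n) : (0, j) ∈ multiplesOfGrade n := by
  rw [multiplesOfGrade, List.mem_filter]
  refine ⟨List.mem_flatMap.2 ⟨j, List.mem_range.2 hj, List.mem_map.2
    ⟨0, by simp [multipliers], rfl⟩⟩, ?_⟩
  rw [Nat.beq_eq, grade_eq, expo_zero, map_zero, zero_add]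
  exact hjn

/-- No relation is in the ideal generated by the others. -/
theorem span_rel_ne {i : ℕ} (hi : i < 141) :
    Ideal.span {g | ∃ j < 141, j ≠ i ∧ g = rel j} ≠ relationIdeal := by
  intro h
  have hn := relationGrades_mem hi
  obtain ⟨n, hin⟩ : ∃ n, relationGrades.getD i 0 = n := ⟨_, rfl⟩
  rw [hin] at hn
  have h0 := exists_multiplesOfGrade hi hin
  let L := (multiplesOfGrade n).filter fun q => q.2 ≠ i
  have hL : L.length < (multiplesOfGrade n).length :=
    List.length_filter_lt_length_iff_exists.2 ⟨_, h0, by simp⟩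
  have hspan : ∀ f ∈ relationIdeal, IsWeightedHomogeneous gradeWeight f n →
      f ∈ Submodule.span ℂ {g | g ∈ L.map multiple} := by
    intro f hf hfn
    rw [← h] at hf
    refine Submodule.span_mono ?_ (mem_span_multiple (P := fun j => j ≠ i) hn hf hfn)
    rintro _ ⟨q, hq, hqi, rfl⟩
    exact List.mem_map.2 ⟨q, List.mem_filter.2 ⟨hq, by simpa using hqi⟩, rfl⟩
  -- Deleting the multiples of relation `i` leaves fewer elements than the dimension requires. In
  -- grade 412 one more must be dropped: the syzygy expresses one multiple by three others, and all
  -- four involve cubics, so they survive the deletion of a quartic.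
  by_cases h412 : n = 412
  · subst h412
    have hmem : ∀ q ∈ [(32 ^ 3, 97), (32 ^ 0, 91), (32 ^ 5, 78), (32 ^ 8, 57)],
        q ∈ multiplesOfGrade 412 := by decide +kernel
    have hne : ∀ q ∈ [(32 ^ 3, 97), (32 ^ 0, 91), (32 ^ 5, 78), (32 ^ 8, 57)],
        relationGrades.getD q.2 0 ≠ 412 := by decide +kernel
    have hmem' : ∀ q ∈ [(32 ^ 3, 97), (32 ^ 0, 91), (32 ^ 5, 78), (32 ^ 8, 57)], q ∈ L :=
      fun q hq => List.mem_filter.2 ⟨hmem q hq, by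
        simpa using fun hqi : q.2 = i => hne q hq (hqi ▸ hin)⟩
    let L' := L.filter fun q => q ≠ (32 ^ 3, 97)
    have hL' : L'.length < L.length :=
      List.length_filter_lt_length_iff_exists.2 ⟨_, hmem' (32 ^ 3, 97) (by simp), by simp⟩
    have hL'' : ∀ q ∈ L, q ≠ (32 ^ 3, 97) →
        multiple q ∈ Submodule.span ℂ {g | g ∈ L'.map multiple} := fun q hq hq' =>
      Submodule.subset_span (List.mem_map.2 ⟨q, List.mem_filter.2 ⟨hq, by simpa using hq'⟩, rfl⟩)
    have h1 := length_leadsOfGrade_le (L := L'.map multiple) fun f hf hfn => by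
      refine Submodule.span_le.2 ?_ (hspan f hf hfn)
      intro g hg
      obtain ⟨q, hq, rfl⟩ := List.mem_map.1 hg
      by_cases hq' : q = (32 ^ 3, 97)
      · rw [hq', multiple_relation]
        exact Submodule.sub_mem _ (Submodule.add_mem _
          (hL'' _ (hmem' (32 ^ 0, 91) (by simp)) (by decide))
          (hL'' _ (hmem' (32 ^ 5, 78) (by simp)) (by decide)))
          (hL'' _ (hmem' (32 ^ 8, 57) (by simp)) (by decide))
      · exact hL'' q hq hq'
    rw [List.length_map] at h1
    have := length_multiplesOfGrade_quartic
    omega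
  · have h1 := length_leadsOfGrade_le hspan
    have h2 := List.all_eq_true.1 length_multiplesOfGrade n (by
      simp only [List.mem_cons, List.not_mem_nil, or_false] at hn ⊢
      omega)
    rw [List.length_map] at h1
    have := Nat.le_of_ble_eq_true h2
    omega

end GaussianMoment

end

/-! ### The Gaussian moments of order at most four. -/

noncomputable section

namespace GaussianMoment

open MvPowerSeries

/-- The exponent vector `(i, j)`. -/
def pairIndex (i j : ℕ) : Fin 2 →₀ ℕ := Finsupp.single 0 i + Finsupp.single 1 j

lemma pairIndex_inj {i j k l : ℕ} : pairIndex i j = pairIndex k l ↔ i = k ∧ j = l := by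
  constructor
  · intro h
    have h0 := DFunLike.congr_fun h 0
    have h1 := DFunLike.congr_fun h 1
    simp [pairIndex] at h0 h1
    exact ⟨h0, h1⟩
  · rintro ⟨rfl, rfl⟩
    rfl

lemma degree_pairIndex (i j : ℕ) : (pairIndex i j).degree = i + j := by
  simp [pairIndex, map_add]

lemma coeff_pairIndex (c : ℂ) (i j k l : ℕ) :
    coeff (pairIndex i j) (C c * X 0 ^ k * X 1 ^ l : MvPowerSeries (Fin 2) ℂ) =
      if i = k ∧ j = l then c else 0 := by
  classical
  rw [mul_assoc, coeff_C_mul, X_pow_eq, X_pow_eq, monomial_mul_monomial, coeff_monomial, one_mul]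
  change c * (if pairIndex i j = pairIndex k l then 1 else 0) = _
  simp [pairIndex_inj]

lemma le_order_pow_of_le {n r d : ℕ} {a : MvPowerSeries (Fin n) ℂ} (ha : (r : ℕ∞) ≤ a.order) :
    ((d * r : ℕ) : ℕ∞) ≤ (a ^ d).order := by
  refine le_trans ?_ (le_order_pow d)
  rw [nsmul_eq_mul]
  push_cast
  gcongr

/-- The terms of the exponential series that matter in low degrees. -/
lemma le_order_exp_sub {n r N : ℕ} (hr : 0 < r) {a : MvPowerSeries (Fin n) ℂ}
    (ha : (r : ℕ∞) ≤ a.order) :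
    ((N * r : ℕ) : ℕ∞) ≤ ((PowerSeries.exp ℂ).subst a -
      ∑ d ∈ Finset.range N, C ((d.factorial : ℂ)⁻¹) * a ^ d).order := by
  have h0 : constantCoeff a = 0 := by
    rw [← one_le_order_iff_constCoeff_eq_zero]
    exact le_trans (by exact_mod_cast hr) ha
  refine le_order fun e he => ?_
  rw [map_sub, sub_eq_zero, PowerSeries.coeff_subst
    (PowerSeries.HasSubst.of_constantCoeff_zero h0), map_sum,
    finsum_eq_sum_of_support_subset (s := Finset.range N)]
  · refine Finset.sum_congr rfl fun d _ => ?_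
    rw [coeff_C_mul, PowerSeries.coeff_exp]
    simp
  · intro d hd
    by_contra hdN
    refine hd ?_
    have h1 : coeff e (a ^ d) = 0 := by
      refine coeff_of_lt_order (lt_of_lt_of_le he (le_trans ?_ (le_order_pow_of_le ha)))
      have : N ≤ d := by simpa using hdN
      exact_mod_cast Nat.mul_le_mul_right r this
    simp [h1]

lemma one_le_order_linearPart {n : ℕ} (μ : Fin n → ℂ) : ((1 : ℕ) : ℕ∞) ≤ (linearPart μ).order := by
  rw [Nat.cast_one, one_le_order_iff_constCoeff_eq_zero]
  simp [linearPart]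

lemma two_le_order_quadraticPart {n : ℕ} (S : Matrix (Fin n) (Fin n) ℂ) :
    ((2 : ℕ) : ℕ∞) ≤ (quadraticPart S).order := by
  refine nat_le_order fun e he => ?_
  have hX : ∀ i, (1 : ℕ∞) ≤ (X i : MvPowerSeries (Fin n) ℂ).order := fun i => by
    rw [one_le_order_iff_constCoeff_eq_zero]
    simp
  rw [quadraticPart, coeff_C_mul, map_sum, Finset.sum_eq_zero, mul_zero]
  intro i _
  rw [map_sum, Finset.sum_eq_zero]
  intro j _
  rw [coeff_C_mul, coeff_of_lt_order, mul_zero]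
  refine lt_of_lt_of_le ?_ ((add_le_add (hX i) (hX j)).trans le_order_mul)
  rw [one_add_one_eq_two]
  exact_mod_cast he

lemma coeff_eq_zero_of_le_order {n k : ℕ} {a : MvPowerSeries (Fin n) ℂ} (ha : (k : ℕ∞) ≤ a.order)
    {e : Fin n →₀ ℕ} (he : e.degree < k) : coeff e a = 0 :=
  coeff_of_lt_order (lt_of_lt_of_le (by exact_mod_cast he) ha)

lemma le_order_mul_of_le {n k l : ℕ} {a b : MvPowerSeries (Fin n) ℂ} (ha : (k : ℕ∞) ≤ a.order)
    (hb : (l : ℕ∞) ≤ b.order) : ((k + l : ℕ) : ℕ∞) ≤ (a * b).order := by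
  push_cast
  exact (add_le_add ha hb).trans le_order_mul

/-- The linear part has order at least 1 and the quadratic part at least 2, so the a-th power of the
first times the b-th power of the second matters only if a + 2b ≤ 4. The rest is collected into four
terms of order at least 5. -/
lemma coeff_mgf (μ : Fin 2 → ℂ) (S : Matrix (Fin 2) (Fin 2) ℂ) {e : Fin 2 →₀ ℕ}
    (he : e.degree ≤ 4) :
    coeff e (mgf μ S) = coeff e (
      1 + linearPart μ + (C (1 / 2) * linearPart μ ^ 2 + quadraticPart S) +
      (C (1 / 6) * linearPart μ ^ 3 + linearPart μ * quadraticPart S) +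
      (C (1 / 24) * linearPart μ ^ 4 + C (1 / 2) * linearPart μ ^ 2 * quadraticPart S +
        C (1 / 2) * quadraticPart S ^ 2)) := by
  have hl := one_le_order_linearPart μ
  have hq := two_le_order_quadraticPart S
  have h1 := le_order_exp_sub (N := 5) one_pos hl
  have h2 := le_order_exp_sub (N := 3) two_pos hq
  rw [mgf]
  set l := linearPart μ
  set q := quadraticPart S
  set F := (PowerSeries.exp ℂ).subst l
  set G := (PowerSeries.exp ℂ).subst q
  set F' := ∑ d ∈ Finset.range 5, C ((d.factorial : ℂ)⁻¹) * l ^ d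
  set G' := ∑ d ∈ Finset.range 3, C ((d.factorial : ℂ)⁻¹) * q ^ d
  have hF : F' = 1 + l + C (1 / 2) * l ^ 2 + C (1 / 6) * l ^ 3 + C (1 / 24) * l ^ 4 := by
    simp [F', Finset.sum_range_succ, Nat.factorial]
  have hG : G' = 1 + q + C (1 / 2) * q ^ 2 := by
    simp [G', Finset.sum_range_succ, Nat.factorial]
  have e1 : coeff e ((F - F') * G) = 0 :=
    coeff_eq_zero_of_le_order (le_order_mul_of_le h1 (l := 0) (by simp)) (by omega)
  have e2 : coeff e (F' * (G - G')) = 0 :=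
    coeff_eq_zero_of_le_order (le_order_mul_of_le (k := 0) (by simp) h2) (by omega)
  have e3 : coeff e (l ^ 3 * q * (C (1 / 6) + C (1 / 24) * l)) = 0 :=
    coeff_eq_zero_of_le_order (le_order_mul_of_le
      (le_order_mul_of_le (le_order_pow_of_le (d := 3) hl) hq) (l := 0) (by simp)) (by omega)
  have e4 : coeff e (q ^ 2 * l * (C (1 / 2) * (1 + C (1 / 2) * l + C (1 / 6) * l ^ 2 +
      C (1 / 24) * l ^ 3))) = 0 :=
    coeff_eq_zero_of_le_order (le_order_mul_of_le
      (le_order_mul_of_le (le_order_pow_of_le (d := 2) hq) hl) (l := 0) (by simp)) (by omega)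
  have key : F * G = (1 + l + (C (1 / 2) * l ^ 2 + q) + (C (1 / 6) * l ^ 3 + l * q) +
      (C (1 / 24) * l ^ 4 + C (1 / 2) * l ^ 2 * q + C (1 / 2) * q ^ 2)) +
      ((F - F') * G + F' * (G - G') + l ^ 3 * q * (C (1 / 6) + C (1 / 24) * l) +
      q ^ 2 * l * (C (1 / 2) * (1 + C (1 / 2) * l + C (1 / 6) * l ^ 2 + C (1 / 24) * l ^ 3))) := by
    have : F * G = F' * G' + ((F - F') * G + F' * (G - G')) := by ring
    rw [this, hF, hG]
    ring
  have e5 : coeff e ((F - F') * G + F' * (G - G') + l ^ 3 * q * (C (1 / 6) + C (1 / 24) * l) +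
      q ^ 2 * l * (C (1 / 2) * (1 + C (1 / 2) * l + C (1 / 6) * l ^ 2 + C (1 / 24) * l ^ 3))) = 0 := by
    rw [map_add, map_add, map_add, e1, e2, e3, e4]
    simp
  rw [key, map_add, e5, add_zero]

lemma coeff_mgf_pairIndex (μ : Fin 2 → ℂ) (S : Matrix (Fin 2) (Fin 2) ℂ) (hS : S.IsSymm) {i j : ℕ}
    (h : i + j ≤ 4) : coeff (pairIndex i j) (mgf μ S) = coeff (pairIndex i j) (
      C 1 * X 0 ^ 0 * X 1 ^ 0 + C (μ 0) * X 0 ^ 1 * X 1 ^ 0 + C (μ 1) * X 0 ^ 0 * X 1 ^ 1 +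
      C ((μ 0 ^ 2 + S 0 0) / 2) * X 0 ^ 2 * X 1 ^ 0 + C (μ 0 * μ 1 + S 0 1) * X 0 ^ 1 * X 1 ^ 1 +
      C ((μ 1 ^ 2 + S 1 1) / 2) * X 0 ^ 0 * X 1 ^ 2 +
      C ((μ 0 ^ 3 + 3 * μ 0 * S 0 0) / 6) * X 0 ^ 3 * X 1 ^ 0 +
      C ((μ 0 ^ 2 * μ 1 + μ 1 * S 0 0 + 2 * μ 0 * S 0 1) / 2) * X 0 ^ 2 * X 1 ^ 1 +
      C ((μ 0 * μ 1 ^ 2 + μ 0 * S 1 1 + 2 * μ 1 * S 0 1) / 2) * X 0 ^ 1 * X 1 ^ 2 +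
      C ((μ 1 ^ 3 + 3 * μ 1 * S 1 1) / 6) * X 0 ^ 0 * X 1 ^ 3 +
      C ((μ 0 ^ 4 + 6 * μ 0 ^ 2 * S 0 0 + 3 * S 0 0 ^ 2) / 24) * X 0 ^ 4 * X 1 ^ 0 +
      C ((μ 0 ^ 3 * μ 1 + 3 * μ 0 * μ 1 * S 0 0 + 3 * μ 0 ^ 2 * S 0 1 + 3 * S 0 0 * S 0 1) / 6) *
        X 0 ^ 3 * X 1 ^ 1 +
      C ((μ 0 ^ 2 * μ 1 ^ 2 + μ 1 ^ 2 * S 0 0 + μ 0 ^ 2 * S 1 1 + 4 * μ 0 * μ 1 * S 0 1 +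
        S 0 0 * S 1 1 + 2 * S 0 1 ^ 2) / 4) * X 0 ^ 2 * X 1 ^ 2 +
      C ((μ 0 * μ 1 ^ 3 + 3 * μ 0 * μ 1 * S 1 1 + 3 * μ 1 ^ 2 * S 0 1 + 3 * S 1 1 * S 0 1) / 6) *
        X 0 ^ 1 * X 1 ^ 3 +
      C ((μ 1 ^ 4 + 6 * μ 1 ^ 2 * S 1 1 + 3 * S 1 1 ^ 2) / 24) * X 0 ^ 0 * X 1 ^ 4) := by
  rw [coeff_mgf μ S (by rw [degree_pairIndex]; exact h)]
  congr 1
  have h10 : S 1 0 = S 0 1 := hS.apply 0 1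
  -- Halving the diagonal entries absorbs the factor 1/2 of the quadratic form.
  obtain ⟨a, ha⟩ : ∃ a, S 0 0 = 2 * a := ⟨S 0 0 / 2, by ring⟩
  obtain ⟨b, hb⟩ : ∃ b, S 1 1 = 2 * b := ⟨S 1 1 / 2, by ring⟩
  have hl : linearPart μ = C (μ 0) * X 0 + C (μ 1) * X 1 := by simp [linearPart]
  have hq : quadraticPart S = C a * X 0 ^ 2 + C (S 0 1) * X 0 * X 1 + C b * X 1 ^ 2 := by
    have h2 : (C (1 / 2) * 2 : MvPowerSeries (Fin 2) ℂ) = 1 := by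
      rw [← map_ofNat C 2, ← map_mul]
      norm_num
    simp only [quadraticPart, Fin.sum_univ_two, h10, ha, hb, map_mul, map_ofNat]
    linear_combination (C a * X 0 ^ 2 + C (S 0 1) * X 0 * X 1 + C b * X 1 ^ 2) * h2
  -- All inverses are expressed through that of 24, so that `h1` is the only relation between
  -- constants that is needed.
  have h6 : (C (6 : ℂ)⁻¹ : MvPowerSeries (Fin 2) ℂ) = 4 * C (24 : ℂ)⁻¹ := by
    rw [← map_ofNat C 4, ← map_mul]; norm_num
  have h4 : (C (4 : ℂ)⁻¹ : MvPowerSeries (Fin 2) ℂ) = 6 * C (24 : ℂ)⁻¹ := by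
    rw [← map_ofNat C 6, ← map_mul]; norm_num
  have h2 : (C (2 : ℂ)⁻¹ : MvPowerSeries (Fin 2) ℂ) = 12 * C (24 : ℂ)⁻¹ := by
    rw [← map_ofNat C 12, ← map_mul]; norm_num
  have h1 : (24 * C (24 : ℂ)⁻¹ : MvPowerSeries (Fin 2) ℂ) = 1 := by
    rw [← map_ofNat C 24, ← map_mul]; norm_num
  rw [hl, hq]
  simp only [div_eq_mul_inv, map_mul, map_add, map_pow, map_ofNat, one_mul, map_one, ha, hb, h6, h4,
    h2]
  linear_combination ((C (μ 0) * C (μ 1) + C (S 0 1)) * X 0 * X 1 -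
    (1 + C (μ 0) * X 0 + C (μ 1) * X 1) *
      (C a * X 0 ^ 2 + C (S 0 1) * X 0 * X 1 + C b * X 1 ^ 2)) * h1

/-- The moments of order one and two. -/
def lowMoments (μ : Fin 2 → ℂ) (S : Matrix (Fin 2) (Fin 2) ℂ) : Fin 5 → ℂ :=
  ![μ 0, μ 1, μ 0 ^ 2 + S 0 0, μ 0 * μ 1 + S 0 1, μ 1 ^ 2 + S 1 1]

/-- The exponents of the moments. -/
def momentExponents : Fin 15 → ℕ × ℕ :=
  ![(1, 2), (0, 2), (0, 1), (0, 3), (1, 1), (2, 1), (1, 0), (2, 0), (3, 0), (2, 2), (0, 4), (4, 0),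
    (1, 3), (3, 1), (0, 0)]

/-- Ties the table `momentTerms` to the moments defined by the generating function. -/
lemma moment_eq (μ : Fin 2 → ℂ) (S : Matrix (Fin 2) (Fin 2) ℂ) (hS : S.IsSymm) (k : Fin 15) :
    moment μ S (pairIndex (momentExponents k).1 (momentExponents k).2) =
      MvPolynomial.eval (lowMoments μ S) (momentImage k) := by
  have hk : (momentExponents k).1 + (momentExponents k).2 ≤ 4 := by revert k; decide
  rw [moment, coeff_mgf_pairIndex μ S hS hk]
  have h0 : ∀ i j, pairIndex i j 0 = i := fun i j => by simp [pairIndex]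
  have h1 : ∀ i j, pairIndex i j 1 = j := fun i j => by simp [pairIndex]
  simp only [LinearMap.map_add, coeff_pairIndex, Fin.prod_univ_two, h0, h1]
  fin_cases k <;>
  simp [momentExponents, momentImage, TermList.momentTerms, TermList.monoValue,
    Fin.prod_univ_five, lowMoments, Nat.factorial] <;>
  ring

/-- The indices of the fifteen moments. -/
def momentIndex (k : Fin 15) : Index 2 4 :=
  ⟨pairIndex (momentExponents k).1 (momentExponents k).2, by
    rw [degree_pairIndex]; revert k; decide⟩

lemma momentIndex_bijective : Function.Bijective momentIndex := by
  constructor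
  · intro k l h
    have h1 := pairIndex_inj.1 (Subtype.mk.inj h)
    revert k l
    have : ∀ k l : Fin 15, (momentExponents k).1 = (momentExponents l).1 ∧
      (momentExponents k).2 = (momentExponents l).2 → k = l := by decide
    intro k l _ h1
    exact this k l h1
  · rintro ⟨e, he⟩
    have h1 : e = pairIndex (e 0) (e 1) := by
      ext i
      fin_cases i <;> simp [pairIndex]
    have key : ∀ i < 5, ∀ j < 5, i + j ≤ 4 → ∃ k, momentExponents k = (i, j) := by decide
    have h2 : e 0 + e 1 ≤ 4 := by
      rw [h1, degree_pairIndex] at he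
      exact he
    obtain ⟨k, hk⟩ := key (e 0) (by omega) (e 1) (by omega) h2
    refine ⟨k, Subtype.ext ?_⟩
    change pairIndex _ _ = e
    rw [hk, ← h1]

/-- The moments of order at most four, numbered. -/
def momentEquiv : Fin 15 ≃ Index 2 4 := Equiv.ofBijective momentIndex momentIndex_bijective

end GaussianMoment

end

/-! ### The vanishing ideal of the moment variety. -/

noncomputable section

open MvPolynomial
open scoped LinearAlgebra.Projectivization

namespace ProjVar

variable {K : Type*} [Field K] {ι κ : Type*}

/-- Changing the representative multiplies the value of a form of degree `d` by the `d`-th power of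
a unit. -/
lemma eval_rep_mk_eq_zero_iff {v : ι → K} (hv : v ≠ 0) {f : MvPolynomial ι K} {d : ℕ}
    (hf : f.IsHomogeneous d) :
    eval (Projectivization.mk K v hv).rep f = 0 ↔ eval v f = 0 := by
  obtain ⟨a, ha⟩ := Projectivization.exists_smul_eq_mk_rep K v hv
  have h : eval (Projectivization.mk K v hv).rep f = (a : K) ^ d * eval v f := by
    rw [← ha, eval_eq, eval_eq, Finset.mul_sum]
    refine Finset.sum_congr rfl fun e he => ?_
    have h1 : e.degree = d := by
      rw [Finsupp.degree_eq_weight_one]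
      exact hf (mem_support_iff.1 he)
    simp only [Units.smul_def, Pi.smul_apply, smul_eq_mul, mul_pow, Finset.prod_mul_distrib,
      Finset.prod_pow_eq_pow_sum]
    rw [← h1, Finsupp.degree_apply]
    ring
  rw [h, mul_eq_zero, or_iff_right (pow_ne_zero _ a.ne_zero)]

lemma isClosed_iff {C : Set (ℙ K (ι → K))} : @IsClosed _ (zariskiTopology K ι) C ↔
    ∃ T : Set (MvPolynomial ι K), IsHomogeneousSet T ∧ C = zeroLocus T := by
  let := zariskiTopology K ι
  rw [← isOpen_compl_iff]
  change Cᶜᶜ ∈ _ ↔ _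
  rw [compl_compl]
  rfl

lemma isClosed_zeroLocus_singleton {f : MvPolynomial ι K} {d : ℕ} (hf : f.IsHomogeneous d) :
    @IsClosed _ (zariskiTopology K ι) (zeroLocus {f}) :=
  isClosed_iff.2 ⟨{f}, fun g hg => ⟨d, by rwa [Set.mem_singleton_iff.1 hg]⟩, rfl⟩

lemma eval_eq_zero_on_closure {X : Set (ℙ K (ι → K))} {f : MvPolynomial ι K} {d : ℕ}
    (hf : f.IsHomogeneous d) (h : ∀ p ∈ X, eval p.rep f = 0) :
    ∀ p ∈ zariskiClosure X, eval p.rep f = 0 := by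
  let := zariskiTopology K ι
  have h2 : closure X ⊆ zeroLocus {f} := closure_minimal (fun p hp g hg => by
    rw [Set.mem_singleton_iff.1 hg]
    exact h p hp) (isClosed_zeroLocus_singleton hf)
  intro p hp
  exact h2 hp f rfl

lemma vanishingIdeal_zariskiClosure (X : Set (ℙ K (ι → K))) :
    vanishingIdeal (zariskiClosure X) = vanishingIdeal X := by
  refine le_antisymm (Ideal.span_mono ?_) (Ideal.span_mono ?_)
  · rintro f ⟨hd, hf⟩
    let := zariskiTopology K ι
    exact ⟨hd, fun p hp => hf p (subset_closure hp)⟩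
  · rintro f ⟨⟨d, hd⟩, hf⟩
    exact ⟨⟨d, hd⟩, eval_eq_zero_on_closure hd hf⟩

lemma hilbertFunction_map_rename (e : ι ≃ κ) (I : Ideal (MvPolynomial ι K)) (d : ℕ) :
    hilbertFunction (I.map (renameEquiv K e : MvPolynomial ι K →+* MvPolynomial κ K)) d =
      hilbertFunction I d := by
  set J := I.map (renameEquiv K e : MvPolynomial ι K →+* MvPolynomial κ K) with hJ
  let Q := Ideal.quotientEquivAlg I J (renameEquiv K e) hJ
  rw [hilbertFunction, hilbertFunction, ← Q.toLinearEquiv.finrank_map_eq]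
  refine congrArg (fun V : Submodule K (MvPolynomial κ K ⧸ J) => Module.finrank K V) ?_
  ext x
  simp only [Submodule.mem_map]
  constructor
  · rintro ⟨f, hf, rfl⟩
    refine ⟨_, ⟨(renameEquiv K e).symm f, ?_, rfl⟩, ?_⟩
    · exact IsHomogeneous.rename_isHomogeneous (f := e.symm) hf
    · change Q (Ideal.Quotient.mk I _) = Ideal.Quotient.mk J f
      exact congrArg (Ideal.Quotient.mk J) ((renameEquiv K e).apply_symm_apply f)
  · rintro ⟨_, ⟨f, hf, rfl⟩, rfl⟩
    exact ⟨renameEquiv K e f, IsHomogeneous.rename_isHomogeneous (f := e) hf, rfl⟩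

end ProjVar

namespace GaussianMoment

open TermList

/-- The relation between numbered and indexed moments. -/
abbrev numbering : MomentRing ≃ₐ[ℂ] MvPolynomial (Index 2 4) ℂ := renameEquiv ℂ momentEquiv

/-- Subtracting products of the means from the second moments recovers the covariances, so the low
moments fill all of ℂ^5. -/
lemma exists_lowMoments (x : Fin 5 → ℂ) :
    ∃ (μ : Fin 2 → ℂ) (S : Matrix (Fin 2) (Fin 2) ℂ), S.IsSymm ∧ lowMoments μ S = x := by
  refine ⟨![x 0, x 1], !![x 2 - x 0 ^ 2, x 3 - x 0 * x 1; x 3 - x 0 * x 1, x 4 - x 1 ^ 2], ?_, ?_⟩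
  · ext i j
    fin_cases i <;> fin_cases j <;> rfl
  · ext i
    fin_cases i <;> simp [lowMoments]

lemma eval_momentVector {μ : Fin 2 → ℂ} {S : Matrix (Fin 2) (Fin 2) ℂ} (hS : S.IsSymm)
    (f : MomentRing) :
    eval (momentVector 4 μ S) (numbering f) = eval (lowMoments μ S) (param f) := by
  rw [renameEquiv_apply, eval_rename, param]
  have h : eval (lowMoments μ S) (aeval momentImage f) =
      eval (fun k => eval (lowMoments μ S) (momentImage k)) f := by
    induction f using MvPolynomial.induction_on with
    | C a => simp
    | add p q hp hq => simp only [map_add, hp, hq]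
    | mul_X p n hp => simp only [map_mul, hp, aeval_X, eval_X]
  rw [h]
  congr 2
  funext k
  exact moment_eq μ S hS k

/-- As the low moments fill ℂ^5 and ℂ is infinite, vanishing at all moment points is a polynomial
identity. -/
lemma vanishes_iff {f : MomentRing} {d : ℕ} (hf : f.IsHomogeneous d) :
    (∀ p ∈ momentPoints 2 4, eval p.rep (numbering f) = 0) ↔ param f = 0 := by
  have hd : (numbering f).IsHomogeneous d := IsHomogeneous.rename_isHomogeneous hf
  constructor
  · intro h
    refine MvPolynomial.funext fun x => ?_
    obtain ⟨μ, S, hS, rfl⟩ := exists_lowMoments x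
    rw [map_zero, ← eval_momentVector hS,
      ← ProjVar.eval_rep_mk_eq_zero_iff (momentVector_ne_zero 4 μ S) hd]
    exact h _ ⟨μ, S, hS, rfl⟩
  · rintro h _ ⟨μ, S, hS, rfl⟩
    rw [ProjVar.eval_rep_mk_eq_zero_iff _ hd, eval_momentVector hS, h, map_zero]

lemma vanishingIdeal_eq : ProjVar.vanishingIdeal (gaussianMomentVariety 2 4) =
    relationIdeal.map (numbering : MomentRing →+* MvPolynomial (Index 2 4) ℂ) := by
  rw [gaussianMomentVariety, ProjVar.vanishingIdeal_zariskiClosure, relationIdeal_eq_span,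
    Ideal.map_span, ProjVar.vanishingIdeal]
  congr 1
  ext f
  constructor
  · rintro ⟨⟨d, hd⟩, hf⟩
    have h1 : (numbering.symm f).IsHomogeneous d :=
      IsHomogeneous.rename_isHomogeneous (f := momentEquiv.symm) hd
    refine ⟨numbering.symm f, ⟨⟨d, h1⟩, (vanishes_iff h1).1 ?_⟩, numbering.apply_symm_apply f⟩
    rwa [numbering.apply_symm_apply]
  · rintro ⟨f, ⟨⟨d, hd⟩, hf⟩, rfl⟩
    exact ⟨⟨d, IsHomogeneous.rename_isHomogeneous hd⟩, (vanishes_iff hd).2 hf⟩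

lemma vanishingIdeal_isPrime :
    (ProjVar.vanishingIdeal (gaussianMomentVariety 2 4)).IsPrime := by
  rw [vanishingIdeal_eq]
  have := relationIdeal_isPrime
  exact Ideal.map_isPrime_of_equiv numbering

lemma hilbertFunction_eq (d : ℕ) :
    ProjVar.hilbertFunction (ProjVar.vanishingIdeal (gaussianMomentVariety 2 4)) d =
      Nat.card {e // IsStd e ∧ Finsupp.weight (fun _ => 1) e = d} := by
  rw [vanishingIdeal_eq, ProjVar.hilbertFunction_map_rename, hilbertFunction_relationIdeal]

section HilbertSeries

open PowerSeries

lemma hilbertSeries_mul :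
    ProjVar.hilbertSeries (ProjVar.vanishingIdeal (gaussianMomentVariety 2 4)) *
      (1 - PowerSeries.X) ^ 6 =
      1 + 9 * PowerSeries.X + 45 * PowerSeries.X ^ 2 + 66 * PowerSeries.X ^ 3
        - 27 * PowerSeries.X ^ 4 + 13 * PowerSeries.X ^ 5 - 8 * PowerSeries.X ^ 6
        + 4 * PowerSeries.X ^ 7 - PowerSeries.X ^ 8 := by
  have h := congrArg (PowerSeries.map (Int.castRingHom ℚ)) countingSeries_isStd_degree
  have h1 : ProjVar.hilbertSeries (ProjVar.vanishingIdeal (gaussianMomentVariety 2 4)) =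
      PowerSeries.map (Int.castRingHom ℚ) (countingSeries (fun _ => 1) IsStd) := by
    ext d
    simp [ProjVar.hilbertSeries, countingSeries, hilbertFunction_eq]
  rw [h1]
  simp only [map_mul, map_add, map_sub, map_pow, map_one, PowerSeries.map_X, map_ofNat] at h
  exact h

/-- The numerator of the Hilbert series. -/
def seriesNumerator : Polynomial ℚ :=
  1 + 9 * Polynomial.X + 45 * Polynomial.X ^ 2 + 66 * Polynomial.X ^ 3 - 27 * Polynomial.X ^ 4 +
    13 * Polynomial.X ^ 5 - 8 * Polynomial.X ^ 6 + 4 * Polynomial.X ^ 7 - Polynomial.X ^ 8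

lemma hilbertSeries_eq :
    ProjVar.hilbertSeries (ProjVar.vanishingIdeal (gaussianMomentVariety 2 4)) =
      (1 + 9 * PowerSeries.X + 45 * PowerSeries.X ^ 2 + 66 * PowerSeries.X ^ 3
        - 27 * PowerSeries.X ^ 4 + 13 * PowerSeries.X ^ 5 - 8 * PowerSeries.X ^ 6
        + 4 * PowerSeries.X ^ 7 - PowerSeries.X ^ 8) * ((1 - PowerSeries.X) ^ 6)⁻¹ := by
  rw [PowerSeries.eq_mul_inv_iff_mul_eq (by simp), hilbertSeries_mul]

end HilbertSeries

end GaussianMoment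

end

/-! ### The degree and the minimal generators. -/

noncomputable section

open MvPolynomial
open scoped LinearAlgebra.Projectivization

namespace GaussianMoment

open TermList

lemma coe_seriesNumerator : (seriesNumerator : PowerSeries ℚ) =
    1 + 9 * PowerSeries.X + 45 * PowerSeries.X ^ 2 + 66 * PowerSeries.X ^ 3
      - 27 * PowerSeries.X ^ 4 + 13 * PowerSeries.X ^ 5 - 8 * PowerSeries.X ^ 6
      + 4 * PowerSeries.X ^ 7 - PowerSeries.X ^ 8 := by
  have h : ∀ n : ℕ, [n.AtLeastTwo] → ((OfNat.ofNat n : Polynomial ℚ) : PowerSeries ℚ) = OfNat.ofNat n :=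
    fun n _ => map_ofNat (Polynomial.coeToPowerSeries.ringHom (R := ℚ)) n
  rw [seriesNumerator]
  simp only [Polynomial.coe_add, Polynomial.coe_sub, Polynomial.coe_mul, Polynomial.coe_pow,
    Polynomial.coe_X, Polynomial.coe_one, h]

/-- The Hilbert polynomial of the Gaussian moment variety. -/
def hilbertPolynomial : Polynomial ℚ := seriesNumerator.hilbertPoly 6

lemma isHilbertPolynomial : ProjVar.IsHilbertPolynomial
    (ProjVar.vanishingIdeal (gaussianMomentVariety 2 4)) hilbertPolynomial := by
  refine Filter.eventually_atTop.2 ⟨seriesNumerator.natDegree + 1, fun d hd => ?_⟩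
  rw [hilbertPolynomial, ← Polynomial.coeff_mul_invOneSubPow_eq_hilbertPoly_eval 6 hd,
    coe_seriesNumerator, ← hilbertSeries_mul, ← PowerSeries.invOneSubPow_inv_eq_one_sub_pow,
    mul_assoc, Units.inv_eq_val_inv, Units.inv_mul, mul_one, ProjVar.hilbertSeries,
    PowerSeries.coeff_mk]

/-- Every monomial of the numerator contributes its coefficient over 5!, so the sum is the value of
the numerator at 1 over 5!. -/
lemma coeff_hilbertPolynomial : hilbertPolynomial.coeff 5 = 102 / 120 := by
  have h : seriesNumerator.eval 1 = 102 := by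
    simp [seriesNumerator]
    norm_num
  rw [Polynomial.eval_eq_sum, Polynomial.sum] at h
  rw [hilbertPolynomial, Polynomial.hilbertPoly_succ, Polynomial.finsetSum_coeff]
  simp only [Polynomial.coeff_smul, Polynomial.coeff_preHilbertPoly_self, smul_eq_mul]
  rw [← Finset.sum_mul, div_eq_mul_inv, ← h]
  simp [Nat.factorial]

lemma natDegree_hilbertPolynomial : hilbertPolynomial.natDegree = 5 := by
  refine le_antisymm ?_ (Polynomial.le_natDegree_of_ne_zero (by
    rw [coeff_hilbertPolynomial]; norm_num))
  rw [hilbertPolynomial, Polynomial.hilbertPoly_succ]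
  refine Polynomial.natDegree_sum_le_of_forall_le _ _ fun i _ => ?_
  exact (Polynomial.natDegree_smul_le _ _).trans (Polynomial.natDegree_preHilbertPoly ℚ 5 i).le

lemma hasDegree : ProjVar.HasDegree (gaussianMomentVariety 2 4) 102 := by
  refine ⟨hilbertPolynomial, isHilbertPolynomial, ?_⟩
  rw [Polynomial.leadingCoeff, natDegree_hilbertPolynomial, coeff_hilbertPolynomial]
  norm_num [Nat.factorial]

/-- The generators of the vanishing ideal. -/
def generator (j : ℕ) : MvPolynomial (Index 2 4) ℂ := numbering (rel j)

lemma relationIdeal_eq_span_rel : relationIdeal = Ideal.span {g | ∃ j < 141, g = rel j} := by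
  rw [relationIdeal]
  congr 1
  ext g
  constructor
  · rintro ⟨f, hf, rfl⟩
    obtain ⟨j, hj, rfl⟩ := mem_relations_iff.1 hf
    exact ⟨j, hj, rfl⟩
  · rintro ⟨j, hj, rfl⟩
    exact ⟨_, mem_relations_iff.2 ⟨j, hj, rfl⟩, rfl⟩

/-- A repeated relation could be omitted, against `span_rel_ne`. -/
lemma rel_injOn {i j : ℕ} (hi : i < 141) (hj : j < 141) (h : rel i = rel j) : i = j := by
  by_contra hij
  refine span_rel_ne hi ?_
  rw [relationIdeal_eq_span_rel]
  congr 1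
  ext g
  constructor
  · rintro ⟨k, hk, -, rfl⟩
    exact ⟨k, hk, rfl⟩
  · rintro ⟨k, hk, rfl⟩
    by_cases hki : k = i
    · exact ⟨j, hj, Ne.symm hij, by rw [hki, h]⟩
    · exact ⟨k, hk, hki, rfl⟩

lemma generator_injOn {s : Finset ℕ} (hs : ∀ j ∈ s, j < 141) : Set.InjOn generator s :=
  fun i hi j hj h => rel_injOn (hs i hi) (hs j hj) (numbering.injective h)

lemma span_generator {T : Set ℕ} : Ideal.span (generator '' T) =
    (Ideal.span (rel '' T)).map (numbering : MomentRing →+* MvPolynomial (Index 2 4) ℂ) := by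
  rw [Ideal.map_span, ← Set.image_comp]
  rfl

lemma map_numbering_injective {I J : Ideal MomentRing}
    (h : I.map (numbering : MomentRing →+* MvPolynomial (Index 2 4) ℂ) =
      J.map (numbering : MomentRing →+* MvPolynomial (Index 2 4) ℂ)) : I = J := by
  have h1 := congrArg (Ideal.comap (numbering : MomentRing →+* MvPolynomial (Index 2 4) ℂ)) h
  have h2 : ∀ I : Ideal MomentRing, (I.map (numbering : MomentRing →+* MvPolynomial (Index 2 4) ℂ)).comap
      (numbering : MomentRing →+* MvPolynomial (Index 2 4) ℂ) = I := fun I =>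
    Ideal.comap_map_of_bijective _ numbering.bijective
  rwa [h2, h2] at h1

lemma isMinimalGeneratingSet : ProjVar.IsMinimalGeneratingSet
    (ProjVar.vanishingIdeal (gaussianMomentVariety 2 4)) (generator '' {j | j < 141}) := by
  rw [vanishingIdeal_eq]
  constructor
  · rw [span_generator, relationIdeal_eq_span_rel]
    congr 2
    ext g
    simp [eq_comm]
  · intro T hT h
    obtain ⟨hsub, hne⟩ := Set.ssubset_iff_subset_ne.1 hT
    -- A proper subset misses some generator, and then the remaining 140 would already generate.
    obtain ⟨_, ⟨i, hi, rfl⟩, hiT⟩ := Set.exists_of_ssubset hT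
    refine span_rel_ne hi (map_numbering_injective (le_antisymm ?_ ?_))
    · refine Ideal.map_mono (Ideal.span_le.2 ?_)
      rintro _ ⟨j, hj, -, rfl⟩
      rw [relationIdeal_eq_span_rel]
      exact Ideal.subset_span ⟨j, hj, rfl⟩
    · rw [← h, Ideal.map_span]
      refine Ideal.span_mono fun g hg => ?_
      obtain ⟨j, hj, rfl⟩ := hsub hg
      exact ⟨rel j, ⟨j, hj, fun hji => hiT (hji ▸ hg), rfl⟩, rfl⟩

theorem length_cubics : cubics.length = 99 := by decide +kernel

theorem length_quartics : quartics.length = 41 := by decide +kernel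

theorem length_quintics : quintics.length = 1 := by decide +kernel

lemma isHomogeneous_generator {j d : ℕ} (h : (rel j).IsHomogeneous d) :
    (generator j).IsHomogeneous d := IsHomogeneous.rename_isHomogeneous h

lemma rel_cubic {j : ℕ} (hj : j < 99) : (rel j).IsHomogeneous 3 := by
  have h1 : j < cubics.length := by rwa [length_cubics]
  rw [rel, entry_eq, relations, List.append_assoc, List.getD_append _ _ _ _ h1,
    List.getD_eq_getElem _ _ h1]
  exact isHomogeneous_of_mem_cubics (List.getElem_mem h1)

lemma rel_quartic {j : ℕ} (hj : 99 ≤ j) (hj' : j < 140) : (rel j).IsHomogeneous 4 := by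
  have h1 : j - 99 < quartics.length := by rw [length_quartics]; omega
  rw [rel, entry_eq, relations, List.append_assoc,
    List.getD_append_right _ _ _ _ (by rwa [length_cubics]), length_cubics,
    List.getD_append _ _ _ _ h1, List.getD_eq_getElem _ _ h1]
  exact isHomogeneous_of_mem_quartics (List.getElem_mem h1)

lemma rel_quintic : (rel 140).IsHomogeneous 5 := by
  have h1 : 140 - 99 - 41 < quintics.length := by rw [length_quintics]; omega
  rw [rel, entry_eq, relations, List.append_assoc,
    List.getD_append_right _ _ _ _ (by rw [length_cubics]; omega), length_cubics,
    List.getD_append_right _ _ _ _ (by rw [length_quartics]), length_quartics,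
    List.getD_eq_getElem _ _ h1]
  exact isHomogeneous_of_mem_quintics (List.getElem_mem h1)

lemma exists_generators : ∃ A B C : Finset (MvPolynomial (Index 2 4) ℂ),
    A.card = 99 ∧ (∀ f ∈ A, f.IsHomogeneous 3) ∧
    B.card = 41 ∧ (∀ f ∈ B, f.IsHomogeneous 4) ∧
    C.card = 1 ∧ (∀ f ∈ C, f.IsHomogeneous 5) ∧
    ProjVar.IsMinimalGeneratingSet
      (ProjVar.vanishingIdeal (gaussianMomentVariety 2 4))
      ((A : Set (MvPolynomial (Index 2 4) ℂ)) ∪ B ∪ C) := by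
  classical
  have hA : ∀ j ∈ Finset.range 99, j < 141 := fun j hj => by
    have := Finset.mem_range.1 hj
    omega
  have hB : ∀ j ∈ Finset.Ico 99 140, j < 141 := fun j hj => by
    have := Finset.mem_Ico.1 hj
    omega
  refine ⟨(Finset.range 99).image generator, (Finset.Ico 99 140).image generator, {generator 140},
    ?_, ?_, ?_, ?_, Finset.card_singleton _, ?_, ?_⟩
  · rw [Finset.card_image_of_injOn (generator_injOn hA), Finset.card_range]
  · intro f hf
    obtain ⟨j, hj, rfl⟩ := Finset.mem_image.1 hf
    exact isHomogeneous_generator (rel_cubic (Finset.mem_range.1 hj))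
  · rw [Finset.card_image_of_injOn (generator_injOn hB), Nat.card_Ico]
  · intro f hf
    obtain ⟨j, hj, rfl⟩ := Finset.mem_image.1 hf
    obtain ⟨h1, h2⟩ := Finset.mem_Ico.1 hj
    exact isHomogeneous_generator (rel_quartic h1 h2)
  · intro f hf
    rw [Finset.mem_singleton.1 hf]
    exact isHomogeneous_generator rel_quintic
  · convert isMinimalGeneratingSet using 1
    rw [Finset.coe_image, Finset.coe_image, Finset.coe_singleton, ← Set.image_singleton,
      ← Set.image_union, ← Set.image_union]
    congr 1
    ext j
    simp only [Finset.coe_range, Finset.coe_Ico, Set.mem_union, Set.mem_Iio, Set.mem_Ico,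
      Set.mem_singleton_iff, Set.mem_ofPred_eq]
    omega

end GaussianMoment

end

/-! ### Growth of Hilbert functions along chains of irreducible closed sets. -/

noncomputable section

open MvPolynomial
open scoped LinearAlgebra.Projectivization

lemma Submodule.finrank_add_finrank_map_le {K V W : Type*} [Field K] [AddCommGroup V] [Module K V]
    [AddCommGroup W] [Module K W] (r : V →ₗ[K] W) {A U : Submodule K V} [FiniteDimensional K U]
    (hAU : A ≤ U) (hA : A ≤ LinearMap.ker r) :
    Module.finrank K A + Module.finrank K (U.map r) ≤ Module.finrank K U := by
  rw [← LinearMap.finrank_range_add_finrank_ker (r.domRestrict U), LinearMap.range_domRestrict,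
    add_comm, ← (Submodule.comapSubtypeEquivOfLe hAU).finrank_eq]
  refine Nat.add_le_add_left (Submodule.finrank_mono ?_) _
  intro u hu
  exact hA hu

namespace ProjVar

variable {K : Type*} [Field K] {ι : Type*} [Finite ι]

instance finiteDimensional_homogeneousSubmodule (d : ℕ) :
    FiniteDimensional K (homogeneousSubmodule ι K d) := by
  have h : homogeneousSubmodule ι K d ≤ restrictTotalDegree ι K d := fun f hf => by
    rw [mem_restrictTotalDegree]
    exact IsHomogeneous.totalDegree_le hf
  exact Submodule.finiteDimensional_of_le h

/-- Evaluation of polynomials at (representatives of) the points of a set. -/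
def evalOn (Z : Set (ℙ K (ι → K))) : MvPolynomial ι K →ₗ[K] (Z → K) where
  toFun f p := eval p.1.rep f
  map_add' f g := by ext p; simp
  map_smul' c f := by ext p; simp [smul_eval]

/-- The Hilbert function of a set of points. -/
def pointsHilbertFunction (Z : Set (ℙ K (ι → K))) (d : ℕ) : ℕ :=
  Module.finrank K ((homogeneousSubmodule ι K d).map (evalOn Z))

/-- Evaluation on `Z` factors through the quotient by the vanishing ideal of `X`. -/
lemma pointsHilbertFunction_le {X Z : Set (ℙ K (ι → K))} (h : Z ⊆ X) (d : ℕ) :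
    pointsHilbertFunction Z d ≤ hilbertFunction (vanishingIdeal X) d := by
  set I := vanishingIdeal X
  have hI : ∀ f ∈ I, ∀ p ∈ X, eval p.rep f = 0 := by
    intro f hf p hp
    have : I ≤ RingHom.ker (eval p.rep) := Ideal.span_le.2 fun g hg => hg.2 p hp
    exact this hf
  let q : (MvPolynomial ι K ⧸ I) →ₗ[K] (Z → K) :=
    LinearMap.pi fun p => (Ideal.Quotient.liftₐ I (aeval p.1.rep) fun f hf => by
      rw [aeval_eq_eval]
      exact hI f hf _ (h p.2)).toLinearMap
  have hq : evalOn Z = q ∘ₗ (Ideal.Quotient.mkₐ K I).toLinearMap := by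
    refine LinearMap.ext fun f => funext fun p => ?_
    change eval p.1.rep f = aeval p.1.rep f
    rw [aeval_eq_eval]
  rw [pointsHilbertFunction, hilbertFunction, hq, Submodule.map_comp]
  exact Submodule.finrank_map_le _ _

/-- The Hilbert function grows at least like a polynomial of degree `k`. -/
def Grows (Z : Set (ℙ K (ι → K))) (k : ℕ) : Prop :=
  ∃ E, 0 < E ∧ ∀ n d, n * E ≤ d → n.choose k ≤ pointsHilbertFunction Z d

omit [Finite ι] in
lemma exists_rep_ne_zero (p : ℙ K (ι → K)) : ∃ i, p.rep i ≠ 0 := by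
  by_contra h
  push Not at h
  exact p.rep_nonzero (funext h)

lemma grows_zero {Z : Set (ℙ K (ι → K))} (hZ : Z.Nonempty) : Grows Z 0 := by
  obtain ⟨p, hp⟩ := hZ
  obtain ⟨i, hi⟩ := exists_rep_ne_zero p
  refine ⟨1, one_pos, fun n d _ => ?_⟩
  rw [Nat.choose_zero_right, Nat.one_le_iff_ne_zero, pointsHilbertFunction, ← Nat.pos_iff_ne_zero,
    Module.finrank_pos_iff_exists_ne_zero]
  refine ⟨⟨evalOn Z (X i ^ d), Submodule.mem_map_of_mem (isHomogeneous_X_pow i d)⟩, fun h => ?_⟩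
  have h1 : eval p.rep (X i ^ d) = 0 := congrFun (Subtype.mk.inj h) ⟨p, hp⟩
  rw [map_pow, eval_X] at h1
  exact pow_ne_zero d hi h1

/-- Irreducibility makes multiplication by `g` injective on forms restricted to `Z`, and the
products vanish on `Z'`; rank-nullity for restriction from `Z` to `Z'` gives the inequality. -/
lemma pointsHilbertFunction_add_le {Z' Z : Set (ℙ K (ι → K))} (hsub : Z' ⊆ Z)
    (hZ : @IsPreirreducible _ (zariskiTopology K ι) Z) {g : MvPolynomial ι K} {e : ℕ}
    (hg : g.IsHomogeneous e) (hg' : ∀ p ∈ Z', eval p.rep g = 0)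
    (hgZ : ∃ p ∈ Z, eval p.rep g ≠ 0) (d : ℕ) :
    pointsHilbertFunction Z d + pointsHilbertFunction Z' (e + d) ≤
      pointsHilbertFunction Z (e + d) := by
  let := zariskiTopology K ι
  let r : (Z → K) →ₗ[K] (Z' → K) := LinearMap.funLeft K K fun p => ⟨p.1, hsub p.2⟩
  let m : (Z → K) →ₗ[K] (Z → K) := LinearMap.mulLeft K (evalOn Z g)
  have h1 : (homogeneousSubmodule ι K (e + d)).map (evalOn Z') =
      ((homogeneousSubmodule ι K (e + d)).map (evalOn Z)).map r := by
    rw [← Submodule.map_comp]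
    rfl
  have hm : ∀ f, m (evalOn Z f) = evalOn Z (g * f) := fun f => funext fun p => by
    simp [m, evalOn]
  have h2 : Function.Injective (m.domRestrict ((homogeneousSubmodule ι K d).map (evalOn Z))) := by
    rw [injective_iff_map_eq_zero]
    rintro ⟨_, f, hf, rfl⟩ h
    have h3 : evalOn Z (g * f) = 0 := by rw [← hm]; exact h
    have h4 := isPreirreducible_iff_isClosed_union_isClosed.1 hZ (zeroLocus {g}) (zeroLocus {f})
      (isClosed_zeroLocus_singleton hg) (isClosed_zeroLocus_singleton hf) (fun p hp => by
        have h5 : eval p.rep (g * f) = 0 := congrFun h3 ⟨p, hp⟩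
        rw [map_mul, mul_eq_zero] at h5
        simpa [zeroLocus] using h5)
    rcases h4 with h4 | h4
    · obtain ⟨p, hp, hgp⟩ := hgZ
      exact absurd (h4 hp g rfl) hgp
    · exact Subtype.ext (funext fun p => h4 p.2 f rfl)
  rw [pointsHilbertFunction, pointsHilbertFunction, pointsHilbertFunction, h1,
    ← LinearMap.finrank_range_of_inj h2, LinearMap.range_domRestrict]
  refine Submodule.finrank_add_finrank_map_le r ?_ ?_
  · rintro _ ⟨_, ⟨f, hf, rfl⟩, rfl⟩
    rw [hm]
    exact Submodule.mem_map_of_mem (hg.mul hf)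
  · rintro _ ⟨_, ⟨f, hf, rfl⟩, rfl⟩
    rw [hm]
    refine funext fun p => ?_
    change eval p.1.rep (g * f) = 0
    rw [map_mul, hg' _ p.2, zero_mul]

/-- Iterating `pointsHilbertFunction_add_le` adds up the lower bounds on `Z'`; Pascal's rule sums
the binomial coefficients. -/
lemma Grows.succ {Z' Z : Set (ℙ K (ι → K))} {k : ℕ} (h : Grows Z' k) (hne : Z'.Nonempty)
    (hsub : Z' ⊆ Z) (hZ : @IsPreirreducible _ (zariskiTopology K ι) Z) {g : MvPolynomial ι K} {e : ℕ}
    (hg : g.IsHomogeneous e) (hg' : ∀ p ∈ Z', eval p.rep g = 0)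
    (hgZ : ∃ p ∈ Z, eval p.rep g ≠ 0) : Grows Z (k + 1) := by
  obtain ⟨E, hE, h⟩ := h
  -- A constant form cannot vanish at a point of `Z'` and be nonzero at a point of `Z`.
  have he : 0 < e := by
    rw [Nat.pos_iff_ne_zero]
    rintro rfl
    obtain ⟨p, -, hp⟩ := hgZ
    obtain ⟨p', hp'⟩ := hne
    have h1 := hg' p' hp'
    rw [totalDegree_eq_zero_iff_eq_C.1 (Nat.le_zero.1 hg.totalDegree_le), eval_C] at hp h1
    exact hp h1
  -- Each unit of `n` pays the degree `e` of `g` and leaves `E` for the bound on `Z'`.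
  refine ⟨E + e, by omega, fun n => ?_⟩
  induction n with
  | zero => simp
  | succ n ih =>
    intro d hd
    obtain ⟨d, rfl⟩ : ∃ d', d = e + d' := ⟨d - e, by
      have : e ≤ (n + 1) * (E + e) := by nlinarith
      omega⟩
    have h1 := pointsHilbertFunction_add_le hsub hZ hg hg' hgZ d
    have h2 := ih d (by nlinarith)
    have h3 := h n (e + d) (by nlinarith)
    rw [Nat.choose_succ_succ']
    omega

/-- A chain of irreducible closed subsets of `X` makes the Hilbert function grow. -/
lemma grows_of_ltSeries {X : Set (ℙ K (ι → K))}
    (p : @LTSeries (@TopologicalSpace.IrreducibleCloseds X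
      (TopologicalSpace.induced Subtype.val (zariskiTopology K ι))) _) (i : ℕ) (hi : i < p.length + 1) :
    Grows (Subtype.val '' (p ⟨i, hi⟩ : Set X)) i := by
  let := zariskiTopology K ι
  induction i with
  | zero => exact grows_zero ((p ⟨0, hi⟩).isIrreducible.nonempty.image _)
  | succ i ih =>
    have h0 := ih (by omega)
    have hlt : p ⟨i, by omega⟩ < p ⟨i + 1, hi⟩ := p.strictMono (by simp [Fin.lt_def])
    have hss : (p ⟨i, by omega⟩ : Set X) ⊂ (p ⟨i + 1, hi⟩ : Set X) := hlt
    obtain ⟨x, hx, hx'⟩ := Set.exists_of_ssubset hss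
    obtain ⟨C, hC, hCp⟩ := isClosed_induced_iff.1 (p ⟨i, by omega⟩).isClosed
    obtain ⟨T, hT, rfl⟩ := isClosed_iff.1 hC
    have hx1 : x.1 ∉ zeroLocus T := fun h => hx' (by rw [← hCp]; exact h)
    simp only [zeroLocus, Set.mem_ofPred_eq, not_forall] at hx1
    obtain ⟨g, hg, hgx⟩ := hx1
    obtain ⟨e, he⟩ := hT g hg
    refine h0.succ ((p ⟨i, by omega⟩).isIrreducible.nonempty.image _) (Set.image_mono hss.1)
      ((p ⟨i + 1, hi⟩).isIrreducible.image _ continuous_subtype_val.continuousOn).isPreirreducible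
      he ?_ ⟨x.1, ⟨x, hx, rfl⟩, hgx⟩
    rintro _ ⟨y, hy, rfl⟩
    rw [← hCp] at hy
    exact hy g hg

end ProjVar

end

/-! ### The dimension. -/

noncomputable section

open MvPolynomial
open scoped LinearAlgebra.Projectivization

namespace ProjVar

variable {K : Type*} [Field K] {ι : Type*} [Finite ι]

/-- The Hilbert function of a subset of `X` grows at most like the Hilbert polynomial of `X`. -/
lemma Grows.le_natDegree {X Z : Set (ℙ K (ι → K))} {k : ℕ} (h : Grows Z k) (hZ : Z ⊆ X)
    {P : Polynomial ℚ} (hP : IsHilbertPolynomial (vanishingIdeal X) P) : k ≤ P.natDegree := by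
  by_contra! hk
  obtain ⟨E, hE, h⟩ := h
  -- At `m`, `Q` is the binomial coefficient of `m + k` over `k`, the lower bound for the Hilbert
  -- function in degree `(m + k) * E`, and `R` is the value of `P` there. If `k` exceeded the degree
  -- of `P`, then `Q` would eventually exceed `R`.
  set Q := Polynomial.preHilbertPoly ℚ k 0
  set R := P.comp (Polynomial.C (E : ℚ) * (Polynomial.X + Polynomial.C (k : ℚ)))
  have hQ : Q.natDegree = k := Polynomial.natDegree_preHilbertPoly ℚ k 0
  have hR : R.natDegree < Q.natDegree := by
    refine lt_of_le_of_lt (Polynomial.natDegree_comp_le.trans ?_) (hQ ▸ hk)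
    have h1 : (Polynomial.C (E : ℚ) * (Polynomial.X + Polynomial.C (k : ℚ))).natDegree ≤ 1 :=
      (Polynomial.natDegree_C_mul_le _ _).trans (Polynomial.natDegree_X_add_C _).le
    exact (Nat.mul_le_mul_left _ h1).trans_eq (mul_one _)
  have hRQ : R.degree < Q.degree := Polynomial.degree_lt_degree hR
  have hlim : Filter.Tendsto (fun x => (Q - R).eval x) Filter.atTop Filter.atTop := by
    refine Polynomial.tendsto_atTop_of_leadingCoeff_nonneg _ ?_ ?_
    · rw [Polynomial.degree_sub_eq_left_of_degree_lt hRQ]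
      exact Polynomial.natDegree_pos_iff_degree_pos.1 (by omega)
    · rw [Polynomial.leadingCoeff_sub_of_degree_lt hRQ, Polynomial.leadingCoeff_preHilbertPoly]
      positivity
  have h1 := (hlim.comp tendsto_natCast_atTop_atTop).eventually (Filter.eventually_gt_atTop 0)
  have h2 : Filter.Tendsto (fun m : ℕ => (m + k) * E) Filter.atTop Filter.atTop :=
    Filter.tendsto_atTop_mono (fun m =>
      (Nat.le_add_right m k).trans (Nat.le_mul_of_pos_right _ hE)) Filter.tendsto_id
  obtain ⟨m, hm1, hm2⟩ := (h1.and (h2.eventually hP)).exists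
  have h3 : Q.eval (m : ℚ) = ((m + k).choose k : ℕ) :=
    Polynomial.preHilbertPoly_eq_choose_sub_add ℚ k (Nat.zero_le m)
  have h4 : R.eval (m : ℚ) = hilbertFunction (vanishingIdeal X) ((m + k) * E) := by
    rw [← hm2, Polynomial.eval_comp]
    congr 1
    push_cast
    simp [mul_comm]
  have h5 := (h (m + k) _ le_rfl).trans (pointsHilbertFunction_le hZ _)
  simp only [Function.comp_apply, Polynomial.eval_sub, h3, h4, sub_pos, Nat.cast_lt] at hm1
  omega

lemma dimension_le_natDegree {X : Set (ℙ K (ι → K))} {P : Polynomial ℚ}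
    (hP : IsHilbertPolynomial (vanishingIdeal X) P) : dimension X ≤ P.natDegree := by
  refine iSup_le fun p => ?_
  have h := (grows_of_ltSeries p p.length (by omega)).le_natDegree
    (by rintro _ ⟨x, -, rfl⟩; exact x.2) hP
  exact_mod_cast h

end ProjVar

namespace GaussianMoment

open TermList

lemma exists_point (x : Fin 5 → ℂ) : ∃ p : gaussianMomentVariety 2 4, ∀ f d, f.IsHomogeneous d →
    (eval p.1.rep f = 0 ↔ eval x (param (numbering.symm f)) = 0) := by
  obtain ⟨μ, S, hS, rfl⟩ := exists_lowMoments x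
  let := ProjVar.zariskiTopology ℂ (Index 2 4)
  refine ⟨⟨_, subset_closure ⟨μ, S, hS, rfl⟩⟩, fun f d hf => ?_⟩
  rw [ProjVar.eval_rep_mk_eq_zero_iff _ hf, ← eval_momentVector hS, numbering.apply_symm_apply]

/-- A point of the moment variety with given moments of orders one and two. -/
def point (x : Fin 5 → ℂ) : gaussianMomentVariety 2 4 := (exists_point x).choose

lemma eval_point {x : Fin 5 → ℂ} {f : MvPolynomial (Index 2 4) ℂ} {d : ℕ} (hf : f.IsHomogeneous d) :
    eval (point x).1.rep f = 0 ↔ eval x (param (numbering.symm f)) = 0 :=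
  (exists_point x).choose_spec f d hf

/-- Replace all but the first `k` coordinates by zero. -/
def truncate (k : ℕ) (x : Fin 5 → ℂ) : Fin 5 → ℂ := fun i => if (i : ℕ) < k then x i else 0

lemma exists_eval_truncate (k : ℕ) (f : MvPolynomial (Fin 5) ℂ) :
    ∃ g : MvPolynomial (Fin 5) ℂ, ∀ x, eval x g = eval (truncate k x) f := by
  refine ⟨aeval (fun i : Fin 5 => if (i : ℕ) < k then X i else 0) f, fun x => ?_⟩
  induction f using MvPolynomial.induction_on with
  | C a => simp
  | add p q hp hq => simp only [map_add, hp, hq]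
  | mul_X p n hp =>
    simp only [map_mul, hp, aeval_X, eval_X, truncate]
    split_ifs <;> simp

/-- The points whose moments of orders one and two vanish except for the first `k`. -/
def coordinatePoints (k : ℕ) : Set (gaussianMomentVariety 2 4) :=
  Set.range fun x => point (truncate k x)

instance : TopologicalSpace (gaussianMomentVariety 2 4) :=
  TopologicalSpace.induced Subtype.val (ProjVar.zariskiTopology ℂ (Index 2 4))

/-- Two forms that do not vanish on the whole set pull back to nonzero polynomials in the
parameters, and their product is nonzero because the polynomial ring is a domain. -/
lemma isPreirreducible_coordinatePoints (k : ℕ) : IsPreirreducible (coordinatePoints k) := by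
  rw [isPreirreducible_iff_isClosed_union_isClosed]
  let := ProjVar.zariskiTopology ℂ (Index 2 4)
  intro C D hC hD hCD
  obtain ⟨C', hC', rfl⟩ := isClosed_induced_iff.1 hC
  obtain ⟨D', hD', rfl⟩ := isClosed_induced_iff.1 hD
  obtain ⟨S, hS, rfl⟩ := ProjVar.isClosed_iff.1 hC'
  obtain ⟨T, hT, rfl⟩ := ProjVar.isClosed_iff.1 hD'
  by_contra! h
  obtain ⟨⟨_, ⟨x, rfl⟩, hx⟩, ⟨_, ⟨y, rfl⟩, hy⟩⟩ := h.imp Set.not_subset.1 Set.not_subset.1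
  simp only [ProjVar.zeroLocus, Set.mem_preimage, Set.mem_ofPred_eq, not_forall] at hx hy
  obtain ⟨f, hf, hfx⟩ := hx
  obtain ⟨g, hg, hgy⟩ := hy
  obtain ⟨d, hd⟩ := hS f hf
  obtain ⟨e, he⟩ := hT g hg
  obtain ⟨F, hF⟩ := exists_eval_truncate k (param (numbering.symm f))
  obtain ⟨G, hG⟩ := exists_eval_truncate k (param (numbering.symm g))
  rw [eval_point hd, ← hF] at hfx
  rw [eval_point he, ← hG] at hgy
  have h0 : F * G = 0 := MvPolynomial.funext fun z => by
    rw [map_mul, map_zero, mul_eq_zero, hF, hG, ← eval_point hd, ← eval_point he]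
    exact (hCD ⟨z, rfl⟩).imp (fun h => h f hf) (fun h => h g hg)
  rcases mul_eq_zero.1 h0 with rfl | rfl
  · exact hfx (map_zero _)
  · exact hgy (map_zero _)

/-- The closure of the set of points whose moments of orders one and two vanish except for the first
`k`. -/
def coordinateSubvariety (k : ℕ) : TopologicalSpace.IrreducibleCloseds (gaussianMomentVariety 2 4) where
  carrier := closure (coordinatePoints k)
  isIrreducible' := isIrreducible_iff_closure.2
    ⟨Set.range_nonempty _, isPreirreducible_coordinatePoints k⟩
  isClosed' := isClosed_closure

/-- The low moment numbered `k` vanishes on the smaller closure, but not at the point of the larger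
one whose first `k + 1` low moments are 1. -/
lemma coordinateSubvariety_lt (k : Fin 5) :
    coordinateSubvariety k < coordinateSubvariety (k + 1) := by
  let := ProjVar.zariskiTopology ℂ (Index 2 4)
  refine lt_of_le_not_ge (closure_mono ?_) fun h => ?_
  · rintro _ ⟨x, rfl⟩
    refine ⟨truncate k x, congrArg point (funext fun i => ?_)⟩
    simp only [truncate]
    split_ifs <;> first | rfl | omega
  · have hX : (X (momentEquiv (lowMoment k)) : MvPolynomial (Index 2 4) ℂ).IsHomogeneous 1 :=
      isHomogeneous_X _ _
    have hparam : param (numbering.symm (X (momentEquiv (lowMoment k)))) = X k := by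
      rw [← param_lowMoment]
      congr 1
      rw [AlgEquiv.symm_apply_eq, renameEquiv_apply, rename_X]
    have h1 : closure (coordinatePoints k) ⊆
        Subtype.val ⁻¹' ProjVar.zeroLocus {X (momentEquiv (lowMoment k))} := by
      refine closure_minimal ?_
        (isClosed_induced_iff.2 ⟨_, ProjVar.isClosed_zeroLocus_singleton hX, rfl⟩)
      rintro _ ⟨x, rfl⟩ f rfl
      rw [eval_point hX, hparam, eval_X, truncate, if_neg (lt_irrefl _)]
    have h2 := h1 (h (subset_closure ⟨fun _ => 1, rfl⟩)) _ rfl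
    rw [eval_point hX, hparam, eval_X, truncate, if_pos (by omega)] at h2
    exact one_ne_zero h2

lemma dimension_eq : ProjVar.dimension (gaussianMomentVariety 2 4) = 5 := by
  refine le_antisymm ?_ ?_
  · have : Finite (Index 2 4) := Finite.of_equiv _ momentEquiv
    have h := ProjVar.dimension_le_natDegree isHilbertPolynomial
    rwa [natDegree_hilbertPolynomial] at h
  · exact Order.LTSeries.length_le_krullDim (LTSeries.mk 5 (fun i => coordinateSubvariety i)
      (Fin.strictMono_iff_lt_succ.2 coordinateSubvariety_lt))

end GaussianMoment

end

theorem mainTheorem8 :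
    -- the ambient projective space has 15 homogeneous coordinates
    Nat.card (GaussianMoment.Index 2 4) = 14 + 1 ∧
    ProjVar.dimension (GaussianMoment.gaussianMomentVariety 2 4) = 5 ∧
    ProjVar.HasDegree (GaussianMoment.gaussianMomentVariety 2 4) 102 ∧
    (ProjVar.vanishingIdeal (GaussianMoment.gaussianMomentVariety 2 4)).IsPrime ∧
    (∃ A B C : Finset (MvPolynomial (GaussianMoment.Index 2 4) ℂ),
      A.card = 99 ∧ (∀ f ∈ A, f.IsHomogeneous 3) ∧
      B.card = 41 ∧ (∀ f ∈ B, f.IsHomogeneous 4) ∧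
      C.card = 1 ∧ (∀ f ∈ C, f.IsHomogeneous 5) ∧
      ProjVar.IsMinimalGeneratingSet
        (ProjVar.vanishingIdeal (GaussianMoment.gaussianMomentVariety 2 4))
        ((A : Set (MvPolynomial (GaussianMoment.Index 2 4) ℂ)) ∪ B ∪ C)) ∧
    ProjVar.hilbertSeries (ProjVar.vanishingIdeal (GaussianMoment.gaussianMomentVariety 2 4)) =
      (1 + 9 * PowerSeries.X + 45 * PowerSeries.X ^ 2 + 66 * PowerSeries.X ^ 3
        - 27 * PowerSeries.X ^ 4 + 13 * PowerSeries.X ^ 5 - 8 * PowerSeries.X ^ 6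
        + 4 * PowerSeries.X ^ 7 - PowerSeries.X ^ 8) * ((1 - PowerSeries.X) ^ 6)⁻¹ :=
  ⟨by rw [Nat.card_congr GaussianMoment.momentEquiv.symm, Nat.card_fin],
    GaussianMoment.dimension_eq, GaussianMoment.hasDegree, GaussianMoment.vanishingIdeal_isPrime,
    GaussianMoment.exists_generators, GaussianMoment.hilbertSeries_eq⟩
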